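/- Let $\Omega\subset\mathbb R^n$ be a bounded, open, connected (nonempty) set with $C^1$ boundary $\Gamma=\partial\Omega$ and outer unit normal $\nu$. Let $H\in C(\overline\Omega\times\mathbb R^n)$ be such that, for each $x\in\overline\Omega$, $H(x,\cdot)$ is convex and $H(x,p)\to\infty$ as $|p|\to\infty$; let $\gamma\in C(\Gamma,\mathbb R^n)$ satisfy $\nu(x)\cdot\gamma(x)>0$ for all $x\in\Gamma$, and let $g\in C(\Gamma)$. For $a\in\mathbb R$ consider the problem $$(\mathrm N_a)\qquad H(x,Du(x))=a\ \text{ in }\Omega,\qquad \gamma(x)\cdot Du(x)=g(x)\ \text{ on }\Gamma .$$ For $u:\overline\Omega\to\mathbb R$ let $u^*$ and $u_*$ denote its upper and lower semicontinuous envelopes on $\overline\Omega$. A function $u:\overline\Omega\to\mathbb R$ is a *subsolution* (resp. *supersolution*) of $(\mathrm N_a)$ if it is bounded above (resp. below) and, whenever $\phi$ is the restriction to $\overline\Omega$ of a $C^1$ function on $\mathbb R^n$ and $u^*-\phi$ attains a maximum over $\overline\Omega$ (resp. $u_*-\phi$ attains a minimum over $\overline\Omega$) at $x\in\overline\Omega$,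 one has $H(x,D\phi(x))\le a$ (resp. $\ge a$) if $x\in\Omega$, and $H(x,D\phi(x))\le a$ or $\gamma(x)\cdot D\phi(x)\le g(x)$ (resp. $H(x,D\phi(x))\ge a$ or $\gamma(x)\cdot D\phi(x)\ge g(x)$) if $x\in\Gamma$. A *solution* is a function that is both a subsolution and a supersolution. Let $$c=\inf\{a\in\mathbb R: (\mathrm N_a)\text{ has a subsolution}\}$$ be the critical value, let $$d(x,y)=\sup\{v(x)-v(y): v \text{ is an upper semicontinuous subsolution of }(\mathrm N_c)\}\qquad(x,y\in\overline\Omega),$$ and let $\mathcal A=\{y\in\overline\Omega: d(\cdot,y)\text{ is a solution of }(\mathrm N_c)\}$ be the Aubry–Mather set. Theorem 6.6. Let $u\in C(\overline\Omega)$ be a solution of $(\mathrm N_c)$. Then $d(x,y)$ is finite for all $x,y\in\overline\Omega$, and $$u(x)=\min\{u(y)+d(x,y): y\in\mathcal A\}\qquad\text{for all }x\in\overline\Omega,$$ where the minimum is attained. In particular, if $w\in C(\overline\Omega)$ is another solution of $(\mathrm N_c)$ with $w=u$ on $\mathcal A$, then $w=u$ on $\overline\Omega$. -/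

import Mathlib

open Set Filter Topology

noncomputable section

namespace NeumannHJ

/-- `ρ` is a `C¹` defining function of the open set `Ω` near the boundary point `x`: its gradient
does not vanish at `x`, and near `x` the set `Ω` is the strict sublevel set `{ρ < 0}`. -/
structure IsLocalDefiningFunction {n : ℕ} (Ω : Set (EuclideanSpace ℝ (Fin n)))
    (x : EuclideanSpace ℝ (Fin n)) (ρ : EuclideanSpace ℝ (Fin n) → ℝ) : Prop where
  contDiffAt : ContDiffAt ℝ 1 ρ x
  gradient_ne_zero : gradient ρ x ≠ 0
  eventually_mem_iff : ∀ᶠ z in 𝓝 x, (z ∈ Ω ↔ ρ z < 0)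

/-- The boundary of the (open) set `Ω` is of class `C¹`. -/
def HasC1Boundary {n : ℕ} (Ω : Set (EuclideanSpace ℝ (Fin n))) : Prop :=
  ∀ x ∈ frontier Ω, ∃ ρ, IsLocalDefiningFunction Ω x ρ

/-- `ν` is the outer unit normal vector of `Ω` at the boundary point `x`, i.e. the normalized
gradient of a local defining function. -/
def IsOuterUnitNormal {n : ℕ} (Ω : Set (EuclideanSpace ℝ (Fin n)))
    (x ν : EuclideanSpace ℝ (Fin n)) : Prop :=
  ∃ ρ, IsLocalDefiningFunction Ω x ρ ∧ ν = ‖gradient ρ x‖⁻¹ • gradient ρ x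

/-- The vector field `γ` is oblique to the boundary of `Ω`: `ν(x) · γ(x) > 0` for `x ∈ ∂Ω`. -/
def IsOblique {n : ℕ} (Ω : Set (EuclideanSpace ℝ (Fin n)))
    (γ : EuclideanSpace ℝ (Fin n) → EuclideanSpace ℝ (Fin n)) : Prop :=
  ∀ x ∈ frontier Ω, ∀ ν, IsOuterUnitNormal Ω x ν → 0 < inner ℝ ν (γ x)

/-- Upper semicontinuous envelope `u^*` of `u`, relative to the set `K`
(the limsup at `x ∈ K` includes the value at `x`). -/
def uscEnvelope {n : ℕ} (K : Set (EuclideanSpace ℝ (Fin n)))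
    (u : EuclideanSpace ℝ (Fin n) → ℝ) (x : EuclideanSpace ℝ (Fin n)) : ℝ :=
  limsup u (𝓝[K] x)

/-- Lower semicontinuous envelope `u_*` of `u`, relative to the set `K`. -/
def lscEnvelope {n : ℕ} (K : Set (EuclideanSpace ℝ (Fin n)))
    (u : EuclideanSpace ℝ (Fin n) → ℝ) (x : EuclideanSpace ℝ (Fin n)) : ℝ :=
  liminf u (𝓝[K] x)

/-- `u : closure Ω → ℝ` is a viscosity subsolution of `H(x, Du) = a` in `Ω`,
`γ · Du = g` on `∂Ω`. Only the values of `u` on `closure Ω` matter. -/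
structure IsSubsolution {n : ℕ} (Ω : Set (EuclideanSpace ℝ (Fin n)))
    (H : EuclideanSpace ℝ (Fin n) → EuclideanSpace ℝ (Fin n) → ℝ)
    (γ : EuclideanSpace ℝ (Fin n) → EuclideanSpace ℝ (Fin n))
    (g : EuclideanSpace ℝ (Fin n) → ℝ) (a : ℝ)
    (u : EuclideanSpace ℝ (Fin n) → ℝ) : Prop where
  bddAbove : BddAbove (u '' closure Ω)
  interior_le : ∀ x ∈ Ω, ∀ φ : EuclideanSpace ℝ (Fin n) → ℝ, ContDiff ℝ 1 φ →
    IsMaxOn (fun z => uscEnvelope (closure Ω) u z - φ z) (closure Ω) x →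
      H x (gradient φ x) ≤ a
  boundary_le : ∀ x ∈ frontier Ω, ∀ φ : EuclideanSpace ℝ (Fin n) → ℝ, ContDiff ℝ 1 φ →
    IsMaxOn (fun z => uscEnvelope (closure Ω) u z - φ z) (closure Ω) x →
      H x (gradient φ x) ≤ a ∨ inner ℝ (γ x) (gradient φ x) ≤ g x

/-- `u : closure Ω → ℝ` is a viscosity supersolution of `H(x, Du) = a` in `Ω`,
`γ · Du = g` on `∂Ω`. -/
structure IsSupersolution {n : ℕ} (Ω : Set (EuclideanSpace ℝ (Fin n)))
    (H : EuclideanSpace ℝ (Fin n) → EuclideanSpace ℝ (Fin n) → ℝ)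
    (γ : EuclideanSpace ℝ (Fin n) → EuclideanSpace ℝ (Fin n))
    (g : EuclideanSpace ℝ (Fin n) → ℝ) (a : ℝ)
    (u : EuclideanSpace ℝ (Fin n) → ℝ) : Prop where
  bddBelow : BddBelow (u '' closure Ω)
  interior_ge : ∀ x ∈ Ω, ∀ φ : EuclideanSpace ℝ (Fin n) → ℝ, ContDiff ℝ 1 φ →
    IsMinOn (fun z => lscEnvelope (closure Ω) u z - φ z) (closure Ω) x →
      a ≤ H x (gradient φ x)
  boundary_ge : ∀ x ∈ frontier Ω, ∀ φ : EuclideanSpace ℝ (Fin n) → ℝ, ContDiff ℝ 1 φ →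
    IsMinOn (fun z => lscEnvelope (closure Ω) u z - φ z) (closure Ω) x →
      a ≤ H x (gradient φ x) ∨ g x ≤ inner ℝ (γ x) (gradient φ x)

/-- `u` is a (bounded) viscosity solution of `H(x, Du) = a` in `Ω`, `γ · Du = g` on `∂Ω`. -/
def IsSolution {n : ℕ} (Ω : Set (EuclideanSpace ℝ (Fin n)))
    (H : EuclideanSpace ℝ (Fin n) → EuclideanSpace ℝ (Fin n) → ℝ)
    (γ : EuclideanSpace ℝ (Fin n) → EuclideanSpace ℝ (Fin n))
    (g : EuclideanSpace ℝ (Fin n) → ℝ) (a : ℝ)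
    (u : EuclideanSpace ℝ (Fin n) → ℝ) : Prop :=
  IsSubsolution Ω H γ g a u ∧ IsSupersolution Ω H γ g a u

/-- The critical value: the infimum of all levels `a` at which there is a subsolution. -/
def criticalValue {n : ℕ} (Ω : Set (EuclideanSpace ℝ (Fin n)))
    (H : EuclideanSpace ℝ (Fin n) → EuclideanSpace ℝ (Fin n) → ℝ)
    (γ : EuclideanSpace ℝ (Fin n) → EuclideanSpace ℝ (Fin n))
    (g : EuclideanSpace ℝ (Fin n) → ℝ) : ℝ :=
  sInf {a : ℝ | ∃ u, IsSubsolution Ω H γ g a u}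

/-- The differences `v x - v y`, where `v` runs over the upper semicontinuous subsolutions at
level `a`. (Without semicontinuity the value `v y` could be lowered at will, as only the
envelope of `v` enters the definition of a subsolution.) -/
def subsolutionDifferences {n : ℕ} (Ω : Set (EuclideanSpace ℝ (Fin n)))
    (H : EuclideanSpace ℝ (Fin n) → EuclideanSpace ℝ (Fin n) → ℝ)
    (γ : EuclideanSpace ℝ (Fin n) → EuclideanSpace ℝ (Fin n))
    (g : EuclideanSpace ℝ (Fin n) → ℝ) (a : ℝ)
    (x y : EuclideanSpace ℝ (Fin n)) : Set ℝ :=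
  {r : ℝ | ∃ v, UpperSemicontinuousOn v (closure Ω) ∧ IsSubsolution Ω H γ g a v ∧
    r = v x - v y}

/-- The function `d(x, y) = sup {v(x) - v(y) : v an u.s.c. subsolution at level a}`. -/
def semiDist {n : ℕ} (Ω : Set (EuclideanSpace ℝ (Fin n)))
    (H : EuclideanSpace ℝ (Fin n) → EuclideanSpace ℝ (Fin n) → ℝ)
    (γ : EuclideanSpace ℝ (Fin n) → EuclideanSpace ℝ (Fin n))
    (g : EuclideanSpace ℝ (Fin n) → ℝ) (a : ℝ)
    (x y : EuclideanSpace ℝ (Fin n)) : ℝ :=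
  sSup (subsolutionDifferences Ω H γ g a x y)

/-- The Aubry–Mather set at level `a`: all `y ∈ closure Ω` such that `d(·, y)` is a solution. -/
def aubryMatherSet {n : ℕ} (Ω : Set (EuclideanSpace ℝ (Fin n)))
    (H : EuclideanSpace ℝ (Fin n) → EuclideanSpace ℝ (Fin n) → ℝ)
    (γ : EuclideanSpace ℝ (Fin n) → EuclideanSpace ℝ (Fin n))
    (g : EuclideanSpace ℝ (Fin n) → ℝ) (a : ℝ) : Set (EuclideanSpace ℝ (Fin n)) :=
  {y | y ∈ closure Ω ∧ IsSolution Ω H γ g a (fun x => semiDist Ω H γ g a x y)}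

end NeumannHJ

end

noncomputable section

namespace NeumannHJ

open Metric

variable {n : ℕ}

local notation "𝔼[" n "]" => EuclideanSpace ℝ (Fin n)

section

/-! ### Semicontinuous envelopes -/

/-! The proof trades viscosity inequalities for bounds on increments. Near `x`, a subsolution
satisfies `v y - v z ≤ p · (y - z)` for some `p`, depending on `y` and `z`, close to the convex set
`{H(x, ·) ≤ a}`; when `y` and `z` are boundary points, `p` can be found close to the smaller set
where also `γ(x) · p ≤ g(x)`. This is `HasSlopesAt`. Subsolutions have it, with radii independent of
the function (`Admissible.exists_slopes`), and it implies the subsolution property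
(`Admissible.isSubsolution_of_hasSlopesAt`). It visibly passes to maxima, convex combinations, and
every function whose increments are at most `d`; in particular `d(·, y)` is a subsolution.

That subsolutions have slope bounds is a barrier argument: a cone or paraboloid that violates the
subsolution inequalities controls the increments of all subsolutions (`IsSubsolution.le_of_strict`).
At the boundary the Euclidean norm gives way to `‖B z‖`, with `B` adapted to `γ` so that `γ · B*B z`
is the normal component of `z`; between points near the boundary this component has a favourable
sign up to a small error, so the cone hardly disturbs the oblique condition. The converse is convex
separation: tangential directions place the gradient of a test function on a normal line that meets
the oblique slope set, and directions entering the domain decide on which side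
(`Admissible.gradient_of_slopesIn`).

Comparison rests on `HasSlopesAt.not_isMax`: doubling variables, with a penalty whose oblique slope
lies strictly between `g - δ` and `g`, shows that a locally strict subsolution cannot touch a
supersolution from below. Strict subsolutions exist near each `y` outside the Aubry–Mather set:
where `d(·, y)` fails to be a supersolution it can be raised, and the maximality of `d` forces the
point of failure to be `y` (`Admissible.exists_strict_of_notMem`). Averaging finitely many of them
gives a subsolution strict on a compact set that misses the Aubry–Mather set, and mixing a little of
it into `w` rules out a positive maximum of `w - u` (`Admissible.le_of_le_on_aubryMatherSet`).

Finally, the minimum of `u y + d(·, y)` over the Aubry–Mather set is at least `u` by the definition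
of `d`; its increments are at most `d`, so it is a subsolution; and it is at most `u` on the
Aubry–Mather set because `d(y, y) = 0`. Comparison gives equality. -/

theorem uscEnvelope_eq {K : Set 𝔼[n]} {v : 𝔼[n] → ℝ} (hv : UpperSemicontinuousOn v K)
    {x : 𝔼[n]} (hx : x ∈ K) : uscEnvelope K v x = v x := by
  have hfr : ∃ᶠ y in 𝓝[K] x, v x ≤ v y := by
    intro h
    exact (mem_of_mem_nhdsWithin hx h) le_rfl
  have hb : ∀ b, v x < b → ∀ᶠ y in 𝓝[K] x, v y ≤ b := fun b hxb =>
    (hv x hx b hxb).mono fun _ h => h.le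
  apply le_antisymm
  · refine le_of_forall_gt_imp_ge_of_dense fun b hxb => ?_
    exact limsup_le_of_le (IsCoboundedUnder.of_frequently_ge hfr) (hb b hxb)
  · exact le_limsup_of_frequently_le hfr ⟨v x + 1, eventually_map.2 (hb _ (by linarith))⟩

theorem lscEnvelope_eq {K : Set 𝔼[n]} {v : 𝔼[n] → ℝ} (hv : ContinuousOn v K)
    {x : 𝔼[n]} (hx : x ∈ K) : lscEnvelope K v x = v x := by
  have : (𝓝[K] x).NeBot := mem_closure_iff_nhdsWithin_neBot.1 (subset_closure hx)
  exact (hv x hx).liminf_eq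

/-! ### Localization of test functions -/

/-- A local test function that touches from above can be replaced by a global one. -/
theorem exists_global_test {K : Set 𝔼[n]} {v ψ : 𝔼[n] → ℝ} {x p : 𝔼[n]} (hv : BddAbove (v '' K))
    (hψ : ContDiffAt ℝ 1 ψ x) (hp : HasGradientAt ψ p x)
    (hmax : ∀ᶠ z in 𝓝[K] x, v z - ψ z ≤ v x - ψ x) :
    ∃ φ : 𝔼[n] → ℝ, ContDiff ℝ 1 φ ∧ gradient φ x = p ∧
      IsMaxOn (fun z => v z - φ z) K x := by
  obtain ⟨B, hB⟩ := hv
  have h1 : ∀ᶠ z in 𝓝 x, ContDiffAt ℝ 1 ψ z ∧ (z ∈ K → v z - ψ z ≤ v x - ψ x) :=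
    (hψ.eventually (by simp)).and (eventually_nhdsWithin_iff.1 hmax)
  obtain ⟨r, hr, hball⟩ := Metric.eventually_nhds_iff_ball.1 h1
  let χ : ContDiffBump x := ⟨r / 3, r / 2, by positivity, by linarith⟩
  -- The value of the global test function where the bump vanishes; it makes `v - C ≤ v x - ψ x` on
  -- all of `K`.
  set C := B - (v x - ψ x)
  have hχ1 : ∀ᶠ z in 𝓝 x, χ z = 1 := χ.eventuallyEq_one
  have heq : (fun z => χ z * (ψ z - C) + C) =ᶠ[𝓝 x] ψ := by
    filter_upwards [hχ1] with z hz
    rw [hz]; ring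
  refine ⟨fun z => χ z * (ψ z - C) + C, ?_, ?_, ?_⟩
  · rw [contDiff_iff_contDiffAt]
    intro z
    by_cases hz : z ∈ ball x r
    · exact ((χ.contDiff.contDiffAt).mul ((hball z hz).1.sub contDiffAt_const)).add
        contDiffAt_const
    · have hz' : z ∉ tsupport χ := by
        rw [χ.tsupport_eq]
        intro h
        exact hz (closedBall_subset_ball (show r / 2 < r by linarith) h)
      have : (fun z => χ z * (ψ z - C) + C) =ᶠ[𝓝 z] fun _ => C := by
        filter_upwards [notMem_tsupport_iff_eventuallyEq.1 hz'] with w hw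
        rw [hw]; simp
      exact contDiffAt_const.congr_of_eventuallyEq this
  · exact (hp.congr_of_eventuallyEq heq).gradient
  · intro z hz
    have hx1 : χ x = 1 := hχ1.self_of_nhds
    have hvz : v z ≤ B := hB (mem_image_of_mem v hz)
    simp only [mem_ofPred_eq, hx1]
    by_cases hzr : z ∈ ball x r
    · have h2 := (hball z hzr).2 hz
      have h3 : 0 ≤ χ z := χ.nonneg
      have h4 : χ z ≤ 1 := χ.le_one
      have : v z - (χ z * (ψ z - C) + C) = χ z * (v z - ψ z) + (1 - χ z) * (v z - C) := by ring
      rw [this]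
      have e1 : χ z * (v z - ψ z) ≤ χ z * (v x - ψ x) := mul_le_mul_of_nonneg_left h2 h3
      have e2 : (1 - χ z) * (v z - C) ≤ (1 - χ z) * (v x - ψ x) :=
        mul_le_mul_of_nonneg_left (by simp only [C]; linarith) (by linarith)
      linarith
    · have : χ z = 0 := χ.zero_of_le_dist (by
        show r / 2 ≤ dist z x
        have : r ≤ dist z x := not_lt.1 hzr
        linarith)
      rw [this]
      simp only [C]
      linarith

/-! ### The standing assumptions -/

/-- The standing assumptions on the domain and the data of the Neumann problem. -/
structure Admissible (Ω : Set 𝔼[n]) (H : 𝔼[n] → 𝔼[n] → ℝ) (γ : 𝔼[n] → 𝔼[n]) (g : 𝔼[n] → ℝ) : Prop where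
  isOpen : IsOpen Ω
  isConnected : IsConnected Ω
  isBounded : Bornology.IsBounded Ω
  hasC1Boundary : HasC1Boundary Ω
  continuousOn : ContinuousOn (Function.uncurry H) (closure Ω ×ˢ univ)
  convexOn : ∀ x ∈ closure Ω, ConvexOn ℝ univ (H x)
  coercive : ∀ x ∈ closure Ω, Tendsto (H x) (Bornology.cobounded 𝔼[n]) atTop
  continuousOn_oblique : ContinuousOn γ (frontier Ω)
  isOblique : IsOblique Ω γ
  continuousOn_datum : ContinuousOn g (frontier Ω)

variable {Ω : Set 𝔼[n]} {H : 𝔼[n] → 𝔼[n] → ℝ} {γ : 𝔼[n] → 𝔼[n]} {g : 𝔼[n] → ℝ} {a b : ℝ} {v : 𝔼[n] → ℝ}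

theorem Admissible.isCompact (h : Admissible Ω H γ g) : IsCompact (closure Ω) :=
  h.isBounded.isCompact_closure

theorem Admissible.mem_or (h : Admissible Ω H γ g) {x : 𝔼[n]} (hx : x ∈ closure Ω) :
    x ∈ Ω ∨ x ∈ frontier Ω := by
  rw [h.isOpen.frontier_eq]
  by_cases hxΩ : x ∈ Ω
  · exact Or.inl hxΩ
  · exact Or.inr ⟨hx, hxΩ⟩

theorem Admissible.notMem (h : Admissible Ω H γ g) {x : 𝔼[n]} (hx : x ∈ frontier Ω) : x ∉ Ω := by
  rw [h.isOpen.frontier_eq] at hx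
  exact hx.2

theorem frontier_mem_closure {x : 𝔼[n]} (hx : x ∈ frontier Ω) : x ∈ closure Ω :=
  frontier_subset_closure hx

/-- Frees the definition from envelopes and from global `C¹` test functions: barriers are smooth
only near the point of contact. -/
theorem IsSubsolution.local_test (hv : IsSubsolution Ω H γ g a v)
    (husc : UpperSemicontinuousOn v (closure Ω)) {ψ : 𝔼[n] → ℝ} {x p : 𝔼[n]} (hx : x ∈ closure Ω)
    (hψ : ContDiffAt ℝ 1 ψ x) (hp : HasGradientAt ψ p x)
    (hmax : ∀ᶠ z in 𝓝[closure Ω] x, v z - ψ z ≤ v x - ψ x) :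
    (x ∈ Ω → H x p ≤ a) ∧ (x ∈ frontier Ω → H x p ≤ a ∨ inner ℝ (γ x) p ≤ g x) := by
  obtain ⟨φ, h1, h2, h3⟩ := exists_global_test hv.bddAbove hψ hp hmax
  have h4 : IsMaxOn (fun z => uscEnvelope (closure Ω) v z - φ z) (closure Ω) x := by
    intro z hz
    simp only [mem_ofPred_eq, uscEnvelope_eq husc hz, uscEnvelope_eq husc hx]
    exact h3 hz
  rw [← h2]
  exact ⟨fun h => hv.interior_le x h φ h1 h4, fun h => hv.boundary_le x h φ h1 h4⟩

/-- Changing the sign of `v` and `ψ` turns touching from below into touching from above, where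
`exists_global_test` applies. -/
theorem IsSupersolution.local_test (hv : IsSupersolution Ω H γ g a v)
    (hcont : ContinuousOn v (closure Ω)) {ψ : 𝔼[n] → ℝ} {x p : 𝔼[n]} (hx : x ∈ closure Ω)
    (hψ : ContDiffAt ℝ 1 ψ x) (hp : HasGradientAt ψ p x)
    (hmin : ∀ᶠ z in 𝓝[closure Ω] x, v x - ψ x ≤ v z - ψ z) :
    (x ∈ Ω → a ≤ H x p) ∧ (x ∈ frontier Ω → a ≤ H x p ∨ g x ≤ inner ℝ (γ x) p) := by
  have hb : BddAbove ((fun z => -v z) '' closure Ω) := by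
    obtain ⟨B, hB⟩ := hv.bddBelow
    refine ⟨-B, ?_⟩
    rintro _ ⟨z, hz, rfl⟩
    exact neg_le_neg (hB (mem_image_of_mem v hz))
  have hp' : HasGradientAt (fun z => -ψ z) (-p) x := by
    rw [hasGradientAt_iff_hasFDerivAt] at hp ⊢
    simpa using! hp.neg
  obtain ⟨φ, h1, h2, h3⟩ := exists_global_test (v := fun z => -v z) (ψ := fun z => -ψ z) hb
    hψ.neg hp' (hmin.mono fun z hz => by linarith)
  have hgr : gradient (fun z => -φ z) x = p := by
    have hd : HasGradientAt φ (-p) x := by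
      rw [← h2]; exact ((h1.differentiable (by simp)) x).hasGradientAt
    have : HasGradientAt (fun z => -φ z) p x := by
      rw [hasGradientAt_iff_hasFDerivAt] at hd ⊢
      simpa using! hd.neg
    exact this.gradient
  have h4 : IsMinOn (fun z => lscEnvelope (closure Ω) v z - -φ z) (closure Ω) x := by
    intro z hz
    simp only [mem_ofPred_eq, lscEnvelope_eq hcont hz, lscEnvelope_eq hcont hx]
    have := h3 hz
    simp only [mem_ofPred_eq] at this
    linarith
  rw [← hgr]
  exact ⟨fun h => hv.interior_ge x h _ h1.neg h4, fun h => hv.boundary_ge x h _ h1.neg h4⟩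

/-! ### Sublevel sets of the Hamiltonian -/

/-- The slopes admissible at `x` for `H ≤ a`. -/
def sublevel (H : 𝔼[n] → 𝔼[n] → ℝ) (a : ℝ) (x : 𝔼[n]) : Set 𝔼[n] := {p | H x p ≤ a}

/-- The slopes admissible at a boundary point `x` for `H ≤ a` and `γ · p ≤ b`. -/
def obliqueSublevel (H : 𝔼[n] → 𝔼[n] → ℝ) (γ : 𝔼[n] → 𝔼[n]) (a b : ℝ) (x : 𝔼[n]) : Set 𝔼[n] :=
  {p | H x p ≤ a ∧ inner ℝ (γ x) p ≤ b}

theorem Admissible.continuous_ham (h : Admissible Ω H γ g) {x : 𝔼[n]} (hx : x ∈ closure Ω) :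
    Continuous (H x) := by
  have : ContinuousOn (fun p => Function.uncurry H (x, p)) univ :=
    h.continuousOn.comp (by fun_prop) fun p _ => ⟨hx, mem_univ p⟩
  exact continuousOn_univ.1 this

/-- Keeping membership in `closure Ω` as a premise makes the set open in the full product, ready for
the tube lemma. -/
theorem Admissible.isOpen_lt (h : Admissible Ω H γ g) (a : ℝ) :
    IsOpen {z : 𝔼[n] × 𝔼[n] | z.1 ∈ closure Ω → H z.1 z.2 < a} := by
  have hcl : IsClosed ((closure Ω ×ˢ (univ : Set 𝔼[n])) ∩ Function.uncurry H ⁻¹' Ici a) :=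
    h.continuousOn.preimage_isClosed_of_isClosed (isClosed_closure.prod isClosed_univ) isClosed_Ici
  convert hcl.isOpen_compl using 1
  ext z
  simp [Function.uncurry]

theorem Admissible.isOpen_gt (h : Admissible Ω H γ g) (a : ℝ) :
    IsOpen {z : 𝔼[n] × 𝔼[n] | z.1 ∈ closure Ω → a < H z.1 z.2} := by
  have hcl : IsClosed ((closure Ω ×ˢ (univ : Set 𝔼[n])) ∩ Function.uncurry H ⁻¹' Iic a) :=
    h.continuousOn.preimage_isClosed_of_isClosed (isClosed_closure.prod isClosed_univ) isClosed_Iic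
  convert hcl.isOpen_compl using 1
  ext z
  simp [Function.uncurry]

/-- Coercivity is assumed only pointwise; convexity makes it locally uniform. If `H x` exceeds `m`
on a sphere, so does `H y` for `y` near `x`, while `H y 0 < m`; convexity along rays then keeps `H
y` above `m` outside the sphere. Compactness of the closure does the rest. -/
theorem Admissible.exists_bound (h : Admissible Ω H γ g) (a : ℝ) :
    ∃ R > 0, ∀ x ∈ closure Ω, ∀ p, H x p ≤ a → ‖p‖ ≤ R := by
  have key : ∀ x ∈ closure Ω, ∃ t ∈ 𝓝[closure Ω] x, ∃ R > 0,
      ∀ y ∈ t, y ∈ closure Ω → ∀ p, H y p ≤ a → ‖p‖ ≤ R := by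
    intro x hx
    set m := max a (H x 0 + 1)
    have h1 : ∀ᶠ p in Bornology.cobounded 𝔼[n], m < H x p := (h.coercive x hx).eventually_gt_atTop m
    obtain ⟨R, hR0, hR⟩ : ∃ R > 0, ∀ p : 𝔼[n], R ≤ ‖p‖ → m < H x p := by
      obtain ⟨s, hs⟩ := (hasBasis_cobounded_norm (E := 𝔼[n])).eventually_iff.1 h1
      exact ⟨max s 1, by positivity, fun p hp => hs.2 (le_trans (le_max_left _ _) hp)⟩
    have hopen := h.isOpen_gt m
    obtain ⟨U, V, hU, hV, hxU, hSV, hUV⟩ := generalized_tube_lemma (isCompact_singleton (x := x))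
      (isCompact_sphere (0 : 𝔼[n]) R) hopen (by
        rintro ⟨z, p⟩ ⟨hz, hp⟩ _
        rw [mem_singleton_iff] at hz
        simp only at hz
        subst hz
        exact hR p (by simpa using (mem_sphere_zero_iff_norm.1 hp).ge))
    have hW : {y | y ∈ closure Ω → H y 0 < H x 0 + 1} ∈ 𝓝 x := by
      have : IsOpen {y : 𝔼[n] | y ∈ closure Ω → H y 0 < H x 0 + 1} :=
        (h.isOpen_lt (H x 0 + 1)).preimage (by fun_prop : Continuous fun y : 𝔼[n] => (y, (0 : 𝔼[n])))
      exact this.mem_nhds fun _ => by linarith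
    refine ⟨U ∩ {y | y ∈ closure Ω → H y 0 < H x 0 + 1}, mem_nhdsWithin_of_mem_nhds
      (inter_mem (hU.mem_nhds (hxU rfl)) hW), R, hR0, ?_⟩
    rintro y ⟨hyU, hyW⟩ hy p hp
    by_contra! hlt
    have hpn : 0 < ‖p‖ := hR0.trans hlt
    set t := R / ‖p‖
    have ht0 : 0 ≤ t := by positivity
    have ht1 : t ≤ 1 := (div_le_one hpn).2 hlt.le
    have hsph : t • p ∈ sphere (0 : 𝔼[n]) R := by
      rw [mem_sphere_zero_iff_norm, norm_smul, Real.norm_of_nonneg ht0]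
      exact div_mul_cancel₀ _ hpn.ne'
    have h2 : m < H y (t • p) := hUV (⟨hyU, hSV hsph⟩ : (y, t • p) ∈ U ×ˢ V) hy
    have h3 := (h.convexOn y hy).2 (mem_univ (0 : 𝔼[n])) (mem_univ p) (sub_nonneg.2 ht1) ht0
      (by ring)
    simp only [smul_zero, zero_add, smul_eq_mul] at h3
    have h4 : H y 0 ≤ m := (hyW hy).le.trans (le_max_right _ _)
    have h5 : H y p ≤ m := hp.trans (le_max_left _ _)
    have : (1 - t) * H y 0 + t * H y p ≤ (1 - t) * m + t * m :=
      add_le_add (mul_le_mul_of_nonneg_left h4 (sub_nonneg.2 ht1))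
        (mul_le_mul_of_nonneg_left h5 ht0)
    linarith
  obtain ⟨R, hR0, hR⟩ := h.isCompact.induction_on
    (p := fun s => ∃ R > 0, ∀ y ∈ s, y ∈ closure Ω → ∀ p, H y p ≤ a → ‖p‖ ≤ R)
    ⟨1, one_pos, fun y hy => absurd hy (notMem_empty y)⟩
    (fun s t hst ⟨R, hR, hs⟩ => ⟨R, hR, fun y hy => hs y (hst hy)⟩)
    (fun s t ⟨R, hR, hs⟩ ⟨R', hR', ht⟩ => ⟨max R R', by positivity, fun y hy hyc p hp => by
      rcases hy with hy | hy
      · exact (hs y hy hyc p hp).trans (le_max_left _ _)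
      · exact (ht y hy hyc p hp).trans (le_max_right _ _)⟩) key
  exact ⟨R, hR0, fun x hx => hR x hx hx⟩

theorem Admissible.isCompact_sublevel (h : Admissible Ω H γ g) {x : 𝔼[n]} (hx : x ∈ closure Ω) :
    IsCompact (sublevel H a x) := by
  obtain ⟨R, -, hR⟩ := h.exists_bound a
  refine Metric.isCompact_of_isClosed_isBounded
    (isClosed_le (h.continuous_ham hx) continuous_const)
    ((isBounded_closedBall (x := (0 : 𝔼[n])) (r := R)).subset fun p hp => ?_)
  simpa using hR x hx p hp

theorem Admissible.convex_sublevel (h : Admissible Ω H γ g) {x : 𝔼[n]} (hx : x ∈ closure Ω) :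
    Convex ℝ (sublevel H a x) := by
  have := (h.convexOn x hx).convex_le a
  simpa [sublevel] using this

theorem obliqueSublevel_eq (x : 𝔼[n]) : obliqueSublevel H γ a b x =
    sublevel H a x ∩ {p | inner ℝ (γ x) p ≤ b} := rfl

theorem Admissible.isCompact_obliqueSublevel (h : Admissible Ω H γ g) {x : 𝔼[n]}
    (hx : x ∈ closure Ω) : IsCompact (obliqueSublevel H γ a b x) := by
  rw [obliqueSublevel_eq]
  exact (h.isCompact_sublevel hx).inter_right (isClosed_le (by fun_prop) continuous_const)

theorem Admissible.convex_obliqueSublevel (h : Admissible Ω H γ g) {x : 𝔼[n]}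
    (hx : x ∈ closure Ω) : Convex ℝ (obliqueSublevel H γ a b x) := by
  rw [obliqueSublevel_eq]
  exact (h.convex_sublevel hx).inter (convex_halfSpace_le (innerₛₗ ℝ (γ x)).isLinear b)

theorem Admissible.continuousOn_ball_sublevel (h : Admissible Ω H γ g) (a : ℝ) :
    IsClosed {z : 𝔼[n] × 𝔼[n] | z.1 ∈ closure Ω ∧ H z.1 z.2 ≤ a} := by
  have := h.continuousOn.preimage_isClosed_of_isClosed (isClosed_closure.prod isClosed_univ)
    (isClosed_Iic (a := a))
  convert this using 1
  ext z
  simp [Function.uncurry]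

/-- Upper semicontinuity of `x ↦ {H x ≤ a}`. -/
theorem Admissible.sublevel_usc (h : Admissible Ω H γ g) {x : 𝔼[n]} {a : ℝ} {U : Set 𝔼[n]} (hU : IsOpen U)
    (hsub : sublevel H a x ⊆ U) : ∃ r > 0, ∀ z ∈ closure Ω ∩ ball x r, sublevel H a z ⊆ U := by
  obtain ⟨R, -, hR⟩ := h.exists_bound a
  have hop : IsOpen {z : 𝔼[n] × 𝔼[n] | ¬ ((z.1 ∈ closure Ω ∧ H z.1 z.2 ≤ a) ∧ z.2 ∈ Uᶜ)} :=
    ((h.continuousOn_ball_sublevel a).inter (hU.isClosed_compl.preimage continuous_snd)).isOpen_compl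
  obtain ⟨V, W, hV, hW, hxV, hSW, hVW⟩ := generalized_tube_lemma (isCompact_singleton (x := x))
    (isCompact_closedBall (0 : 𝔼[n]) R) hop (by
      rintro ⟨z, p⟩ ⟨hz, hp⟩ ⟨⟨h1, h2⟩, h3⟩
      rw [mem_singleton_iff] at hz
      simp only at hz h2 h3
      subst hz
      exact h3 (hsub h2))
  obtain ⟨r, hr, hball⟩ := Metric.isOpen_iff.1 hV x (hxV rfl)
  refine ⟨r, hr, fun z hz p hp => ?_⟩
  by_contra hpU
  exact hVW (⟨hball hz.2, hSW (by simpa using hR z hz.1 p hp)⟩ : (z, p) ∈ V ×ˢ W)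
    ⟨⟨hz.1, hp⟩, hpU⟩

/-- Upper semicontinuity of the oblique sublevel set, with a fixed direction and a perturbed
level of the oblique constraint. -/
theorem Admissible.obliqueSublevel_usc (h : Admissible Ω H γ g) {x : 𝔼[n]} {a b : ℝ} {U : Set 𝔼[n]}
    (hU : IsOpen U) (hsub : obliqueSublevel H γ a b x ⊆ U) :
    ∃ η > 0, ∃ r > 0, ∀ z ∈ closure Ω ∩ ball x r, ∀ p, H z p ≤ a →
      inner ℝ (γ x) p ≤ b + η → p ∈ U := by
  obtain ⟨R, -, hR⟩ := h.exists_bound a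
  -- The perturbation of the level enters the tube lemma as one more variable, near `0`, so one
  -- radius controls it together with the displacement.
  have hop : IsOpen {z : (𝔼[n] × ℝ) × 𝔼[n] | ¬ ((z.1.1 ∈ closure Ω ∧ H z.1.1 z.2 ≤ a) ∧ z.2 ∈ Uᶜ ∧
      inner ℝ (γ x) z.2 ≤ b + z.1.2)} :=
    (((h.continuousOn_ball_sublevel a).preimage
      (by fun_prop : Continuous fun z : (𝔼[n] × ℝ) × 𝔼[n] => (z.1.1, z.2))).inter
      ((hU.isClosed_compl.preimage continuous_snd).inter
      (isClosed_le (by fun_prop : Continuous fun z : (𝔼[n] × ℝ) × 𝔼[n] => inner ℝ (γ x) z.2)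
        (by fun_prop : Continuous fun z : (𝔼[n] × ℝ) × 𝔼[n] => b + z.1.2)))).isOpen_compl
  obtain ⟨V, W, hV, hW, hxV, hSW, hVW⟩ := generalized_tube_lemma
    (isCompact_singleton (x := (x, (0 : ℝ)))) (isCompact_closedBall (0 : 𝔼[n]) R) hop (by
      rintro ⟨z, p⟩ ⟨hz, hp⟩ ⟨⟨h1, h2⟩, h3, h4⟩
      rw [mem_singleton_iff] at hz
      simp only at hz h2 h3 h4
      subst hz
      exact h3 (hsub ⟨h2, by simpa using h4⟩))
  obtain ⟨r, hr, hball⟩ := Metric.isOpen_iff.1 hV _ (hxV rfl)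
  refine ⟨r / 2, by positivity, r, hr, fun z hz p hp hpη => ?_⟩
  by_contra hpU
  have hmem : (z, r / 2) ∈ V := hball (by
    rw [mem_ball, Prod.dist_eq, max_lt_iff]
    refine ⟨hz.2, ?_⟩
    simp only [Real.dist_eq, sub_zero]
    rw [abs_of_pos (by positivity)]
    linarith)
  exact hVW (⟨hmem, hSW (by simpa using hR z hz.1 p hp)⟩ : ((z, r / 2), p) ∈ V ×ˢ W)
    ⟨⟨hz.1, hp⟩, hpU, hpη⟩

/-- Points near `x` and slopes near the compact set `{H x ≤ a}` satisfy `H < a'` for `a < a'`. -/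
theorem Admissible.ham_lt_near (h : Admissible Ω H γ g) {x : 𝔼[n]} (hx : x ∈ closure Ω) {a a' : ℝ}
    (haa' : a < a') : ∃ r > 0, ∀ z ∈ closure Ω ∩ ball x r, ∀ p ∈ sublevel H a x, ∀ p',
      ‖p' - p‖ < r → H z p' < a' := by
  obtain ⟨V, W, hV, hW, hxV, hSW, hVW⟩ := generalized_tube_lemma (isCompact_singleton (x := x))
    (h.isCompact_sublevel (a := a) hx) (h.isOpen_lt a') (by
      rintro ⟨z, p⟩ ⟨hz, hp⟩ _
      rw [mem_singleton_iff] at hz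
      simp only at hz hp
      subst hz
      exact lt_of_le_of_lt hp haa')
  obtain ⟨r, hr, hball⟩ := Metric.isOpen_iff.1 hV x (hxV rfl)
  obtain ⟨δ, hδ, hth⟩ := (h.isCompact_sublevel (a := a) hx).exists_cthickening_subset_open hW hSW
  refine ⟨min r δ, lt_min hr hδ, fun z hz p hp p' hpp => ?_⟩
  refine hVW (⟨hball (ball_subset_ball (min_le_left _ _) hz.2), hth ?_⟩ : (z, p') ∈ V ×ˢ W) hz.1
  exact mem_cthickening_of_dist_le p' p δ _ hp
    (by rw [dist_eq_norm]; exact (hpp.trans_le (min_le_right _ _)).le)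

/-! ### Closed thickenings as Minkowski sums -/

/-- The closed `ε`-neighbourhood of a compact set. -/
def thick (ε : ℝ) (C : Set 𝔼[n]) : Set 𝔼[n] := {p | ∃ q ∈ C, ‖p - q‖ ≤ ε}

theorem thick_eq (ε : ℝ) (C : Set 𝔼[n]) : thick ε C = Set.image2 (· + ·) C (closedBall 0 ε) := by
  ext p
  simp only [thick, mem_ofPred_eq, mem_image2, mem_closedBall, dist_zero_right]
  constructor
  · rintro ⟨q, hq, hpq⟩
    exact ⟨q, hq, p - q, hpq, by abel⟩
  · rintro ⟨q, hq, e, he, rfl⟩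
    exact ⟨q, hq, by simpa using he⟩

open Pointwise in
theorem isCompact_thick {ε : ℝ} {C : Set 𝔼[n]} (hC : IsCompact C) : IsCompact (thick ε C) := by
  rw [thick_eq]
  exact hC.add (isCompact_closedBall 0 ε)

open Pointwise in
theorem convex_thick {ε : ℝ} {C : Set 𝔼[n]} (hC : Convex ℝ C) : Convex ℝ (thick ε C) := by
  rw [thick_eq]
  exact hC.add (convex_closedBall 0 ε)

theorem thick_mono {ε ε' : ℝ} {C C' : Set 𝔼[n]} (hε : ε ≤ ε') (hC : C ⊆ C') :
    thick ε C ⊆ thick ε' C' := fun _ ⟨q, hq, h⟩ => ⟨q, hC hq, h.trans hε⟩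

theorem thick_thick_subset {ε ε' : ℝ} {C : Set 𝔼[n]} : thick ε (thick ε' C) ⊆ thick (ε + ε') C := by
  rintro p ⟨q, ⟨q', hq', h'⟩, h⟩
  refine ⟨q', hq', ?_⟩
  calc ‖p - q'‖ = ‖(p - q) + (q - q')‖ := by rw [sub_add_sub_cancel]
    _ ≤ _ := (norm_add_le _ _).trans (add_le_add h h')

theorem subset_thick {ε : ℝ} (hε : 0 ≤ ε) {C : Set 𝔼[n]} : C ⊆ thick ε C :=
  fun p hp => ⟨p, hp, by simpa using hε⟩

theorem exists_isOpen_subset_thick {ε : ℝ} (hε : 0 < ε) {C : Set 𝔼[n]} :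
    ∃ U, IsOpen U ∧ C ⊆ U ∧ U ⊆ thick ε C := by
  refine ⟨thickening ε C, isOpen_thickening, self_subset_thickening hε C, fun p hp => ?_⟩
  obtain ⟨q, hq, h⟩ := mem_thickening_iff.1 hp
  exact ⟨q, hq, by rw [← dist_eq_norm]; exact h.le⟩

theorem mem_of_forall_mem_thick {C : Set 𝔼[n]} (hC : IsClosed C) {p : 𝔼[n]}
    (hp : ∀ ε > 0, p ∈ thick ε C) : p ∈ C := by
  rw [← hC.closure_eq, Metric.mem_closure_iff]
  intro ε hε
  obtain ⟨q, hq, h⟩ := hp (ε / 2) (by positivity)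
  exact ⟨q, hq, by rw [dist_eq_norm]; linarith⟩

end

section

/-! ### Geometry of the boundary -/

section Geometry

variable {Ω : Set 𝔼[n]} {ρ : 𝔼[n] → ℝ} {x : 𝔼[n]}

theorem IsLocalDefiningFunction.eventually_isLocalDefiningFunction
    (hρ : IsLocalDefiningFunction Ω x ρ) : ∀ᶠ z in 𝓝 x, IsLocalDefiningFunction Ω z ρ := by
  have h1 := hρ.contDiffAt.eventually (by simp)
  have h2 := hρ.eventually_mem_iff.eventually_nhds
  have hc : ContinuousAt (fderiv ℝ ρ) x :=
    (hρ.contDiffAt.fderiv_right (m := 0) (by simp)).continuousAt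
  have hg : ContinuousAt (gradient ρ) x :=
    ((InnerProductSpace.toDual ℝ 𝔼[n]).symm.continuous.continuousAt).comp hc
  have h3 := hg.eventually_ne hρ.gradient_ne_zero
  filter_upwards [h1, h2, h3] with z h1 h2 h3 using ⟨h1, h3, h2⟩

theorem IsLocalDefiningFunction.hasGradientAt (hρ : IsLocalDefiningFunction Ω x ρ) :
    HasGradientAt ρ (gradient ρ x) x :=
  (hρ.contDiffAt.differentiableAt (by simp)).hasGradientAt

/-- A `C¹` function is strictly differentiable: the affine error is controlled between two moving
points, as chords and doubled variables require. -/
theorem hasStrictGradient_estimate {f : 𝔼[n] → ℝ} {p x : 𝔼[n]} (hf : ContDiffAt ℝ 1 f x)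
    (hp : HasGradientAt f p x) {κ : ℝ} (hκ : 0 < κ) :
    ∃ r > 0, ∀ y ∈ ball x r, ∀ z ∈ ball x r,
      |f y - f z - inner ℝ p (y - z)| ≤ κ * ‖y - z‖ := by
  have h1 := hf.hasStrictFDerivAt (by simp)
  have h2 : fderiv ℝ f x = InnerProductSpace.toDual ℝ 𝔼[n] p :=
    (hasGradientAt_iff_hasFDerivAt.1 hp).fderiv
  rw [h2] at h1
  have h3 := (h1.isLittleO).bound hκ
  obtain ⟨r, hr, hb⟩ := Metric.eventually_nhds_iff_ball.1 h3
  refine ⟨r, hr, fun y hy z hz => ?_⟩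
  have := hb (y, z) (by
    rw [mem_ball, Prod.dist_eq, max_lt_iff]
    exact ⟨hy, hz⟩)
  simpa [InnerProductSpace.toDual_apply_apply] using this

/-- Near a boundary point, the defining function is nearly affine and describes `Ω`, its closure
and its frontier. -/
theorem IsLocalDefiningFunction.exists_chart (hΩ : IsOpen Ω)
    (hρ : IsLocalDefiningFunction Ω x ρ) {κ : ℝ} (hκ : 0 < κ) :
    ∃ r > 0, (∀ z ∈ ball x r, IsLocalDefiningFunction Ω z ρ ∧ (z ∈ Ω ↔ ρ z < 0) ∧
        (z ∈ closure Ω → ρ z ≤ 0) ∧ (z ∈ frontier Ω ↔ ρ z = 0)) ∧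
      ∀ y ∈ ball x r, ∀ z ∈ ball x r,
        |ρ y - ρ z - inner ℝ (gradient ρ x) (y - z)| ≤ κ * ‖y - z‖ := by
  obtain ⟨r, hr, hest⟩ := hasStrictGradient_estimate hρ.contDiffAt hρ.hasGradientAt hκ
  obtain ⟨r', hr', hdef⟩ := Metric.eventually_nhds_iff_ball.1 hρ.eventually_isLocalDefiningFunction
  refine ⟨min r r', lt_min hr hr', fun z hz => ?_, fun y hy z hz =>
    hest y (ball_subset_ball (min_le_left _ _) hy) z (ball_subset_ball (min_le_left _ _) hz)⟩
  have hz' := hdef z (ball_subset_ball (min_le_right _ _) hz)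
  have hiff : z ∈ Ω ↔ ρ z < 0 := hz'.eventually_mem_iff.self_of_nhds
  have hcont : ContinuousAt ρ z := hz'.contDiffAt.continuousAt
  have hcl : z ∈ closure Ω → ρ z ≤ 0 := by
    intro hzc
    by_contra! hpos
    have h1 : ∀ᶠ w in 𝓝 z, w ∉ Ω := by
      filter_upwards [hcont.eventually (lt_mem_nhds hpos), hz'.eventually_mem_iff] with w h1 h2 h3
      exact lt_asymm h1 (h2.1 h3)
    exact (mem_closure_iff_frequently.1 hzc) h1
  refine ⟨hz', hiff, hcl, ?_⟩
  rw [hΩ.frontier_eq]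
  constructor
  · rintro ⟨h1, h2⟩
    exact le_antisymm (hcl h1) (not_lt.1 fun h => h2 (hiff.2 h))
  · intro h0
    refine ⟨?_, fun h => (hiff.1 h).ne h0⟩
    set q := gradient ρ z
    have hq : 0 < ‖q‖ := norm_pos_iff.2 hz'.gradient_ne_zero
    obtain ⟨s, hs, hest'⟩ := hasStrictGradient_estimate hz'.contDiffAt hz'.hasGradientAt
      (half_pos hq)
    -- A zero of `ρ` lies in the closure because moving against the gradient makes `ρ` negative at
    -- once.
    have htend : Tendsto (fun t : ℝ => z - t • q) (𝓝[>] 0) (𝓝 z) := by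
      have : Tendsto (fun t : ℝ => z - t • q) (𝓝 0) (𝓝 (z - (0 : ℝ) • q)) :=
        Continuous.tendsto (by fun_prop) 0
      simpa using this.mono_left nhdsWithin_le_nhds
    refine mem_closure_of_tendsto htend ?_
    filter_upwards [htend (ball_mem_nhds z hs), htend hz'.eventually_mem_iff,
      self_mem_nhdsWithin] with t h1 h2 h3
    rw [mem_preimage, mem_ofPred_eq] at h2
    rw [h2]
    have h4 := (abs_le.1 (hest' _ h1 z (mem_ball_self hs))).2
    have e : z - t • q - z = -(t • q) := by abel
    rw [e, inner_neg_right, inner_smul_right, real_inner_self_eq_norm_sq, h0, norm_neg, norm_smul,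
      Real.norm_of_nonneg (le_of_lt h3)] at h4
    have h5 : 0 < t * ‖q‖ ^ 2 := by have : 0 < t := h3; positivity
    nlinarith

/-- Every direction orthogonal to the gradient of the defining function is tangent to the
frontier. -/
theorem IsLocalDefiningFunction.exists_frontier_near (hΩ : IsOpen Ω)
    (hρ : IsLocalDefiningFunction Ω x ρ) (hx : x ∈ frontier Ω) {e : 𝔼[n]}
    (he : inner ℝ (gradient ρ x) e = 0) {κ : ℝ} (hκ : 0 < κ) :
    ∃ h₀ > 0, ∀ h, 0 < h → h < h₀ → ∃ y ∈ frontier Ω, ‖y - (x - h • e)‖ ≤ κ * h := by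
  set q := gradient ρ x
  have hq : 0 < ‖q‖ := norm_pos_iff.2 hρ.gradient_ne_zero
  set D := ‖e‖ + κ
  have hD : 0 < D := by positivity
  -- With this constant the affine error is at most half of `κ h ‖q‖`, the change of `ρ` under a
  -- normal shift of length `κ h`. Hence `ρ` has opposite signs at the two shifts `±κ h` of `x - h
  -- e`, and it vanishes in between.
  obtain ⟨r, hr, hch, hest⟩ := hρ.exists_chart hΩ (κ := κ * ‖q‖ / (2 * D)) (by positivity)
  refine ⟨r / D, by positivity, fun h h0 hlt => ?_⟩
  have hhD : h * D < r := (lt_div_iff₀ hD).1 hlt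
  set pt : ℝ → 𝔼[n] := fun s => x - h • e + (s * ‖q‖⁻¹) • q
  have hdist : ∀ s ∈ Icc (-(κ * h)) (κ * h), ‖pt s - x‖ ≤ h * D := by
    intro s hs
    have e1 : pt s - x = -(h • e) + (s * ‖q‖⁻¹) • q := by simp only [pt]; abel
    rw [e1]
    refine (norm_add_le _ _).trans ?_
    rw [norm_neg, norm_smul, norm_smul, Real.norm_of_nonneg h0.le, norm_mul, norm_inv, norm_norm,
      mul_assoc, inv_mul_cancel₀ hq.ne', mul_one, Real.norm_eq_abs]
    have := abs_le.2 hs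
    simp only [D]
    linarith
  have hmem : ∀ s ∈ Icc (-(κ * h)) (κ * h), pt s ∈ ball x r := fun s hs => by
    rw [mem_ball, dist_eq_norm]
    exact (hdist s hs).trans_lt hhD
  have hx0 : ρ x = 0 := ((hch x (mem_ball_self hr)).2.2.2).1 hx
  have hval : ∀ s ∈ Icc (-(κ * h)) (κ * h), |ρ (pt s) - s * ‖q‖| ≤ κ * h * ‖q‖ / 2 := by
    intro s hs
    have h1 := hest _ (hmem s hs) x (mem_ball_self hr)
    have e1 : pt s - x = -(h • e) + (s * ‖q‖⁻¹) • q := by simp only [pt]; abel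
    have e2 : inner ℝ q (pt s - x) = s * ‖q‖ := by
      rw [e1, inner_add_right, inner_neg_right, inner_smul_right, inner_smul_right, he,
        real_inner_self_eq_norm_sq]
      field_simp
      ring
    rw [e2, hx0, sub_zero] at h1
    refine h1.trans ?_
    calc κ * ‖q‖ / (2 * D) * ‖pt s - x‖ ≤ κ * ‖q‖ / (2 * D) * (h * D) :=
          mul_le_mul_of_nonneg_left (hdist s hs) (by positivity)
      _ = _ := by field_simp
  have hκh : 0 < κ * h := by positivity
  have hcont : ContinuousOn (fun s => ρ (pt s)) (Icc (-(κ * h)) (κ * h)) := by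
    intro s hs
    have h1 : ContinuousAt ρ (pt s) := (hch _ (hmem s hs)).1.contDiffAt.continuousAt
    have h2 : ContinuousAt pt s := by simp only [pt]; fun_prop
    exact (ContinuousAt.comp (f := pt) (g := ρ) h1 h2).continuousWithinAt
  have h1 := hval (-(κ * h)) ⟨le_rfl, by linarith⟩
  have h2 := hval (κ * h) ⟨by linarith, le_rfl⟩
  have hpos : 0 < κ * h * ‖q‖ := by positivity
  obtain ⟨s, hs, hs0⟩ := intermediate_value_Icc (by linarith : -(κ * h) ≤ κ * h) hcont
    (⟨by have := (abs_le.1 h1).2; linarith,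
      by have := (abs_le.1 h2).1; linarith⟩ :
      (0 : ℝ) ∈ Icc (ρ (pt (-(κ * h)))) (ρ (pt (κ * h))))
  refine ⟨pt s, ((hch _ (hmem s hs)).2.2.2).2 hs0, ?_⟩
  have e3 : pt s - (x - h • e) = (s * ‖q‖⁻¹) • q := by simp only [pt]; abel
  rw [e3, norm_smul, norm_mul, norm_inv, norm_norm, mul_assoc, inv_mul_cancel₀ hq.ne', mul_one,
    Real.norm_eq_abs]
  exact abs_le.2 hs

theorem IsOblique.inner_gradient_pos {γ : 𝔼[n] → 𝔼[n]} (hγ : IsOblique Ω γ)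
    (hx : x ∈ frontier Ω) (hρ : IsLocalDefiningFunction Ω x ρ) :
    0 < inner ℝ (gradient ρ x) (γ x) := by
  have h := hγ x hx _ ⟨ρ, hρ, rfl⟩
  rw [real_inner_smul_left] at h
  exact (pos_iff_pos_of_mul_pos h).1 (by
    have := norm_pos_iff.2 hρ.gradient_ne_zero
    positivity)

end Geometry

/-! ### Linear maps adapted to an oblique direction -/

/-- If `q · γ > 0`, then some injective linear map `B` satisfies `⟪B z, B γ⟫ = q · z`. -/
theorem exists_adapted_map {q γ : 𝔼[n]} (h : 0 < inner ℝ q γ) :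
    ∃ B : 𝔼[n] →L[ℝ] 𝔼[n], ∃ c > 0, (∀ z, c * ‖z‖ ≤ ‖B z‖) ∧
      ∀ z, inner ℝ (B z) (B γ) = inner ℝ q z := by
  set β := inner ℝ q γ
  have hq : q ≠ 0 := by
    rintro rfl
    simp [β] at h
  have hqn : 0 < ‖q‖ := norm_pos_iff.2 hq
  -- `B` projects along `γ` onto the hyperplane orthogonal to `q` and records the removed component
  -- along `q`. Thus `B γ` is parallel to `q`, and `t` is normalized by `β t² ‖q‖² = 1`.
  set t := (Real.sqrt β * ‖q‖)⁻¹
  let B : 𝔼[n] →L[ℝ] 𝔼[n] := ContinuousLinearMap.id ℝ 𝔼[n] -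
    (innerSL ℝ q).smulRight (β⁻¹ • γ) + (innerSL ℝ q).smulRight (t • q)
  have hB : ∀ z, B z = (z - (inner ℝ q z * β⁻¹) • γ) + (inner ℝ q z * t) • q := by
    intro z
    simp [B, smul_smul]
  have horth : ∀ z, inner ℝ q (z - (inner ℝ q z * β⁻¹) • γ) = 0 := by
    intro z
    rw [inner_sub_right, inner_smul_right]
    change inner ℝ q z - inner ℝ q z * β⁻¹ * β = 0
    field_simp
    ring
  have hBγ : B γ = (β * t) • q := by
    rw [hB]
    change (γ - (β * β⁻¹) • γ) + (β * t) • q = (β * t) • q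
    rw [mul_inv_cancel₀ h.ne', one_smul, sub_self, zero_add]
  have hs : Real.sqrt β ^ 2 = β := Real.sq_sqrt h.le
  have hs0 : 0 < Real.sqrt β := Real.sqrt_pos.2 h
  have hinner : ∀ z, inner ℝ (B z) (B γ) = inner ℝ q z := by
    intro z
    rw [hBγ, inner_smul_right, real_inner_comm, hB, inner_add_right, horth, inner_smul_right,
      real_inner_self_eq_norm_sq]
    simp only [t]
    field_simp
    rw [hs]
    ring
  have hinj : ∀ z, B z = 0 → z = 0 := by
    intro z hz
    have h0 : inner ℝ q z = 0 := by rw [← hinner, hz, inner_zero_left]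
    rw [hB, h0] at hz
    simpa using hz
  obtain ⟨K, hK, hanti⟩ := B.toLinearMap.exists_antilipschitzWith
    (LinearMap.ker_eq_bot'.2 fun z hz => hinj z hz)
  refine ⟨B, (K : ℝ)⁻¹, by positivity, fun z => ?_, hinner⟩
  have h1 := hanti.le_mul_dist z 0
  rw [map_zero, dist_zero_right, dist_zero_right] at h1
  rw [inv_mul_le_iff₀ (by positivity)]
  exact h1

theorem hasGradientAt_norm_map (B : 𝔼[n] →L[ℝ] 𝔼[n]) {y z : 𝔼[n]} (h : B (z - y) ≠ 0) :
    HasGradientAt (fun w => ‖B (w - y)‖)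
      (‖B (z - y)‖⁻¹ • B.adjoint (B (z - y))) z := by
  have h1 : HasFDerivAt (fun w => B (w - y)) B z := B.hasFDerivAt.comp z
    ((hasFDerivAt_id z).sub_const y)
  have h2 := h1.norm_sq.sqrt (by positivity)
  rw [hasGradientAt_iff_hasFDerivAt]
  simp only [Real.sqrt_sq (norm_nonneg _)] at h2
  convert! h2 using 1
  ext w
  simp [ContinuousLinearMap.adjoint_inner_left]
  field_simp

theorem contDiffAt_norm_map (B : 𝔼[n] →L[ℝ] 𝔼[n]) {y z : 𝔼[n]} (h : B (z - y) ≠ 0) :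
    ContDiffAt ℝ 1 (fun w => ‖B (w - y)‖) z := by
  have : ContDiffAt ℝ 1 (fun w => B (w - y)) z :=
    (B.contDiff.comp (contDiff_id.sub contDiff_const)).contDiffAt
  exact this.norm ℝ h

end

section

variable {Ω : Set 𝔼[n]} {H : 𝔼[n] → 𝔼[n] → ℝ} {γ : 𝔼[n] → 𝔼[n]} {g : 𝔼[n] → ℝ} {a b : ℝ}
  {v : 𝔼[n] → ℝ}

/-! ### Equi-Lipschitz continuity of subsolutions -/

/-- A function which violates the subsolution inequalities off `y`, and which is large on the
sphere, bounds the increments of every subsolution. -/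
theorem IsSubsolution.le_of_strict (h : Admissible Ω H γ g) (hv : IsSubsolution Ω H γ g a v)
    (husc : UpperSemicontinuousOn v (closure Ω)) {x₀ y : 𝔼[n]} {r : ℝ}
    (hy : y ∈ closure Ω ∩ ball x₀ r) {ψ : 𝔼[n] → ℝ} {G : 𝔼[n] → 𝔼[n]} (hcont : Continuous ψ)
    (hψ : ∀ z ∈ closure Ω ∩ ball x₀ r, z ≠ y → ContDiffAt ℝ 1 ψ z ∧ HasGradientAt ψ (G z) z ∧
      a < H z (G z) ∧ (z ∈ frontier Ω → g z < inner ℝ (γ z) (G z)))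
    (hedge : ∀ z ∈ closure Ω, dist z x₀ = r → v z - ψ z ≤ v y - ψ y) :
    ∀ z ∈ closure Ω ∩ ball x₀ r, v z - ψ z ≤ v y - ψ y := by
  have hyc : y ∈ closure Ω ∩ closedBall x₀ r := ⟨hy.1, ball_subset_closedBall hy.2⟩
  have hu : UpperSemicontinuousOn (fun z => v z + -ψ z) (closure Ω ∩ closedBall x₀ r) :=
    (husc.mono inter_subset_left).add (hcont.neg.upperSemicontinuous.upperSemicontinuousOn _)
  -- A maximum point inside the ball and off `y` would contradict the test inequalities; on the
  -- sphere `hedge` applies. Nothing is asked of `ψ` at `y` beyond continuity, so cones with vertex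
  -- `y` are allowed.
  obtain ⟨m, hm, hmax⟩ := hu.exists_isMaxOn ⟨y, hyc⟩
    (h.isCompact.inter_right isClosed_closedBall)
  have hmax' : ∀ z ∈ closure Ω ∩ closedBall x₀ r, v z - ψ z ≤ v m - ψ m := fun z hz => by
    simpa [sub_eq_add_neg] using hmax hz
  suffices hmy : v m - ψ m ≤ v y - ψ y from fun z hz =>
    (hmax' z ⟨hz.1, ball_subset_closedBall hz.2⟩).trans hmy
  rcases (mem_closedBall.1 hm.2).lt_or_eq with hlt | heq
  · by_cases hmy : m = y
    · rw [hmy]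
    · obtain ⟨h1, h2, h3, h4⟩ := hψ m ⟨hm.1, hlt⟩ hmy
      have h5 := hv.local_test husc hm.1 h1 h2 (by
        filter_upwards [self_mem_nhdsWithin,
          mem_nhdsWithin_of_mem_nhds (isOpen_ball.mem_nhds (mem_ball.2 hlt))] with z hz hz'
        exact hmax' z ⟨hz, ball_subset_closedBall hz'⟩)
      rcases h.mem_or hm.1 with hmΩ | hmΓ
      · exact absurd (h5.1 hmΩ) (not_le.2 h3)
      · rcases h5.2 hmΓ with h6 | h6
        · exact absurd h6 (not_le.2 h3)
        · exact absurd h6 (not_le.2 (h4 hmΓ))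
  · exact hedge m hm.1 heq

theorem Admissible.exists_datum_bound (h : Admissible Ω H γ g) :
    ∃ M > 0, ∀ z ∈ frontier Ω, g z ≤ M := by
  have hc : IsCompact (frontier Ω) := h.isCompact.of_isClosed_subset isClosed_frontier
    frontier_subset_closure
  obtain ⟨M, hM⟩ := (hc.image_of_continuousOn h.continuousOn_datum).bddAbove
  exact ⟨max M 1, by positivity, fun z hz => (hM (mem_image_of_mem g hz)).trans (le_max_left _ _)⟩

/-- Lipschitz estimate from a tilted cone whose slopes point out of the domain. -/
theorem Admissible.lipschitz_of_cone (h : Admissible Ω H γ g) (a : ℝ) {x₀ : 𝔼[n]}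
    (B : 𝔼[n] →L[ℝ] 𝔼[n]) (e : 𝔼[n]) {c r : ℝ} (hc : 0 < c) (hr : 0 < r)
    (hP : ∀ w, c * ‖w‖ ≤ ‖B w‖ + inner ℝ e w) (hB : ∀ w, B w = 0 → w = 0)
    (hbd : ∀ z ∈ frontier Ω ∩ ball x₀ r, ∀ y ∈ closure Ω ∩ ball x₀ r, z ≠ y →
      c ≤ inner ℝ (γ z) (‖B (z - y)‖⁻¹ • B.adjoint (B (z - y)) + e)) :
    ∃ r > 0, ∃ L > 0, ∀ v, UpperSemicontinuousOn v (closure Ω) → IsSubsolution Ω H γ g a v →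
      ∀ x ∈ closure Ω ∩ ball x₀ r, ∀ y ∈ closure Ω ∩ ball x₀ r, v x - v y ≤ L * ‖x - y‖ := by
  obtain ⟨R, hR, hbound⟩ := h.exists_bound a
  obtain ⟨M, hM, hgM⟩ := h.exists_datum_bound
  set C := ‖B‖ + ‖e‖ + c
  have hC : 0 < C := by positivity
  have hPC : ∀ w, ‖B w‖ + inner ℝ e w ≤ C * ‖w‖ := fun w => by
    have h1 := B.le_opNorm w
    have h2 := real_inner_le_norm e w
    have h3 : 0 ≤ c * ‖w‖ := by positivity
    simp only [C]
    linarith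
  -- The slopes of the cone have norm, and at boundary points oblique component, at least `c`. This
  -- steepness carries them beyond the bound `R` for `{H ≤ a}` and beyond the bound `M` for the
  -- datum.
  set L := (R + M + 1) / c
  have hL : 0 < L := by positivity
  have hLc : L * c = R + M + 1 := div_mul_cancel₀ _ hc.ne'
  set R₁ := c * (r / 2)
  have hR₁ : 0 < R₁ := by positivity
  have hCc : c ≤ C := by simp only [C]; have := norm_nonneg B; have := norm_nonneg e; linarith
  refine ⟨R₁ / (2 * C), by positivity, L * C, by positivity, fun v husc hv x hx y hy => ?_⟩
  have hr₁ : R₁ / (2 * C) ≤ r / 2 / 2 := by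
    rw [div_le_iff₀ (by positivity)]
    simp only [R₁]
    nlinarith
  have hxr : x ∈ ball x₀ (r / 2 / 2) := ball_subset_ball hr₁ hx.2
  have hyr : y ∈ ball x₀ (r / 2 / 2) := ball_subset_ball hr₁ hy.2
  set P : 𝔼[n] → ℝ := fun z => ‖B (z - y)‖ + inner ℝ e (z - y)
  have hPcont : Continuous P := by simp only [P]; fun_prop
  have hP0 : P y = 0 := by simp [P]
  have hPnn : ∀ z, 0 ≤ P z := fun z => (by positivity : 0 ≤ c * ‖z - y‖).trans (hP _)
  obtain ⟨S, hS⟩ := hv.bddAbove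
  set W := max (S - v y) 0
  -- `W` depends on `v`. The power term is at least `W` on the sphere, where `P ≥ R₁`, but tends to
  -- zero at `x` as `k → ∞` because `P x < R₁`; the limiting Lipschitz constant is therefore
  -- independent of `v`.
  have key : ∀ k : ℕ, v x - v y ≤ L * P x + W * (P x / R₁) ^ (k + 1) := by
    intro k
    have := hv.le_of_strict h husc (x₀ := x₀) (y := y) (r := r)
      ⟨hy.1, ball_subset_ball (by linarith) hyr⟩
      (ψ := fun z => L * P z + W * (P z / R₁) ^ (k + 1))
      (G := fun z => (L + W * ((k + 1 : ℕ) * (P z / R₁) ^ k * R₁⁻¹)) •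
        (‖B (z - y)‖⁻¹ • B.adjoint (B (z - y)) + e)) (by fun_prop) ?_ ?_ x
        ⟨hx.1, ball_subset_ball (by linarith) hxr⟩
    · simp only [hP0] at this
      simp only [mul_zero, zero_div] at this
      rw [zero_pow (Nat.succ_ne_zero k), mul_zero] at this
      linarith
    · intro z hz hzy
      have hBz : B (z - y) ≠ 0 := fun h0 => hzy (sub_eq_zero.1 (hB _ h0))
      have hcd : ContDiffAt ℝ 1 P z := (contDiffAt_norm_map B hBz).add
        (contDiffAt_const.inner ℝ (contDiffAt_id.sub contDiffAt_const))
      set Gz := ‖B (z - y)‖⁻¹ • B.adjoint (B (z - y)) + e with hGz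
      have hgr : HasGradientAt P Gz z := by
        have h1 := hasGradientAt_norm_map B hBz
        rw [hasGradientAt_iff_hasFDerivAt] at h1 ⊢
        have h2 : HasFDerivAt (fun w => inner ℝ e (w - y)) (innerSL ℝ e) z :=
          (innerSL ℝ e).hasFDerivAt.comp z ((hasFDerivAt_id z).sub_const y)
        rw [hGz, map_add]
        exact h1.add h2
      set m := L + W * ((k + 1 : ℕ) * (P z / R₁) ^ k * R₁⁻¹) with hm
      have hWnn : 0 ≤ W := le_max_right _ _
      have hmL : L ≤ m := by
        have : 0 ≤ W * ((k + 1 : ℕ) * (P z / R₁) ^ k * R₁⁻¹) := by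
          have := hPnn z
          positivity
        rw [hm]; linarith
      have hm0 : 0 < m := hL.trans_le hmL
      refine ⟨?_, ?_, ?_, ?_⟩
      · exact (contDiffAt_const.mul hcd).add (contDiffAt_const.mul ((hcd.div_const _).pow _))
      · have h1 : HasDerivAt (fun s : ℝ => L * s + W * (s / R₁) ^ (k + 1)) m (P z) := by
          have h2 := ((hasDerivAt_id (P z)).const_mul L).add
            ((((hasDerivAt_id (P z)).div_const R₁).pow (k + 1)).const_mul W)
          convert! h2 using 1
          simp [hm]
        rw [hasGradientAt_iff_hasFDerivAt] at hgr ⊢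
        have h3 := h1.comp_hasFDerivAt z hgr
        rw [map_smul]
        exact h3
      · by_contra! hle
        have h1 := hbound z hz.1 _ hle
        have hGc : c ≤ ‖Gz‖ := by
          have hpos : 0 < ‖z - y‖ := norm_pos_iff.2 (sub_ne_zero.2 hzy)
          have h2 : inner ℝ Gz (z - y) = P z := by
            rw [hGz, inner_add_left, inner_smul_left, ContinuousLinearMap.adjoint_inner_left,
              real_inner_self_eq_norm_sq]
            have : ‖B (z - y)‖ ≠ 0 := norm_ne_zero_iff.2 hBz
            simp only [P, conj_trivial]
            field_simp
          have h3 := real_inner_le_norm Gz (z - y)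
          rw [h2] at h3
          have h4 := (hP (z - y)).trans h3
          exact le_of_mul_le_mul_right h4 hpos
        rw [norm_smul, Real.norm_of_nonneg hm0.le] at h1
        have : L * c ≤ m * ‖Gz‖ := mul_le_mul hmL hGc hc.le hm0.le
        linarith
      · intro hzΓ
        rw [inner_smul_right]
        have h1 := hbd z ⟨hzΓ, hz.2⟩ y ⟨hy.1, ball_subset_ball (by linarith) hyr⟩ hzy
        have : L * c ≤ m * inner ℝ (γ z) Gz := mul_le_mul hmL h1 hc.le hm0.le
        have := hgM z hzΓ
        linarith
    · intro z hz hzr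
      have h1 : R₁ ≤ P z := by
        refine le_trans ?_ (hP (z - y))
        refine mul_le_mul_of_nonneg_left ?_ hc.le
        have h2 := dist_triangle z y x₀
        have h3 : dist y x₀ < r / 2 / 2 := hyr
        rw [← dist_eq_norm]
        linarith
      have h2 : W ≤ W * (P z / R₁) ^ (k + 1) := le_mul_of_one_le_right (le_max_right _ _)
        (one_le_pow₀ ((one_le_div hR₁).2 h1))
      have h3 : v z ≤ S := hS (mem_image_of_mem v hz)
      have h4 : S - v y ≤ W := le_max_left _ _
      have h5 : 0 ≤ L * P z := mul_nonneg hL.le (hPnn z)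
      simp only [hP0, mul_zero, zero_div]
      rw [zero_pow (Nat.succ_ne_zero k)]
      linarith
  have hPx : P x / R₁ < 1 := by
    rw [div_lt_one hR₁]
    refine (hPC _).trans_lt ?_
    have h1 : ‖x - y‖ < R₁ / C := by
      rw [← dist_eq_norm]
      have h2 := dist_triangle_right x y x₀
      have h3 : dist x x₀ < R₁ / (2 * C) := hx.2
      have h4 : dist y x₀ < R₁ / (2 * C) := hy.2
      have h5 : R₁ / (2 * C) + R₁ / (2 * C) = R₁ / C := by field_simp; ring
      linarith
    rw [lt_div_iff₀ hC] at h1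
    linarith
  have hlim : Tendsto (fun k : ℕ => L * P x + W * (P x / R₁) ^ (k + 1)) atTop
      (𝓝 (L * P x + W * 0)) :=
    ((((tendsto_pow_atTop_nhds_zero_of_lt_one (div_nonneg (hPnn x) hR₁.le) hPx).comp
      (tendsto_add_atTop_nat 1)).const_mul W).const_add _)
  have h1 := ge_of_tendsto' hlim key
  calc v x - v y ≤ L * P x := by linarith
    _ ≤ L * (C * ‖x - y‖) := mul_le_mul_of_nonneg_left (hPC _) hL.le
    _ = _ := by ring

/-- Subsolutions at a given level are locally equi-Lipschitz up to the boundary. -/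
theorem Admissible.exists_lipschitz (h : Admissible Ω H γ g) (a : ℝ) {x₀ : 𝔼[n]}
    (hx₀ : x₀ ∈ closure Ω) :
    ∃ r > 0, ∃ L > 0, ∀ v, UpperSemicontinuousOn v (closure Ω) → IsSubsolution Ω H γ g a v →
      ∀ x ∈ closure Ω ∩ ball x₀ r, ∀ y ∈ closure Ω ∩ ball x₀ r, v x - v y ≤ L * ‖x - y‖ := by
  rcases h.mem_or hx₀ with hΩ | hΓ
  · obtain ⟨r, hr, hball⟩ := Metric.isOpen_iff.1 h.isOpen x₀ hΩ
    refine h.lipschitz_of_cone a (ContinuousLinearMap.id ℝ _) 0 one_pos hr (by simp)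
      (fun w hw => hw) fun z hz => absurd (hball hz.2) (h.notMem hz.1)
  · obtain ⟨ρ, hρ⟩ := h.hasC1Boundary x₀ hΓ
    set q := gradient ρ x₀ with hq_def
    have hβ : 0 < inner ℝ q (γ x₀) := h.isOblique.inner_gradient_pos hΓ hρ
    set β := inner ℝ q (γ x₀)
    have hq : 0 < ‖q‖ := norm_pos_iff.2 hρ.gradient_ne_zero
    obtain ⟨B, c, hc, hBc, hBγ⟩ := exists_adapted_map hβ
    -- The tilt `t q` leaves the cone coercive, with constant `c / 2`, and adds `t β` to the oblique
    -- component of its slopes. The bending of the boundary and the variation of `γ` may each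
    -- consume a quarter of `t β`.
    set t := c / (2 * ‖q‖)
    have ht : 0 < t := by positivity
    obtain ⟨r, hr, hch, hest⟩ := hρ.exists_chart h.isOpen (κ := c * (t * β / 4)) (by positivity)
    have hγc : ∃ r' > 0, ∀ z ∈ frontier Ω ∩ ball x₀ r',
        ‖γ z - γ x₀‖ * (‖B‖ + ‖t • q‖) ≤ t * β / 4 := by
      have h1 : ContinuousWithinAt (fun z => ‖γ z - γ x₀‖ * (‖B‖ + ‖t • q‖)) (frontier Ω) x₀ :=
        (((h.continuousOn_oblique x₀ hΓ).sub continuousWithinAt_const).norm).mul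
          continuousWithinAt_const
      have h2 : ∀ᶠ z in 𝓝[frontier Ω] x₀, ‖γ z - γ x₀‖ * (‖B‖ + ‖t • q‖) < t * β / 4 :=
        h1.eventually_lt continuousWithinAt_const (by simp; positivity)
      obtain ⟨r', hr', hb⟩ := Metric.eventually_nhds_iff_ball.1 (eventually_nhdsWithin_iff.1 h2)
      exact ⟨r', hr', fun z hz => (hb z hz.2 hz.1).le⟩
    obtain ⟨r', hr', hγr⟩ := hγc
    have hBinj : ∀ w, B w = 0 → w = 0 := fun w hw => by
      have := hBc w
      rw [hw, norm_zero] at this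
      exact norm_le_zero_iff.1 (nonpos_of_mul_nonpos_right this hc)
    refine h.lipschitz_of_cone a B (t • q) (c := min (c / 2) (t * β / 2)) (by positivity)
      (lt_min hr hr') ?_ hBinj ?_
    · intro w
      have h1 := hBc w
      have h2 := neg_le_of_abs_le (abs_real_inner_le_norm (t • q) w)
      rw [norm_smul, Real.norm_of_nonneg ht.le] at h2
      have h3 : t * ‖q‖ = c / 2 := by simp only [t]; field_simp
      rw [h3] at h2
      have h4 : min (c / 2) (t * β / 2) * ‖w‖ ≤ c / 2 * ‖w‖ :=
        mul_le_mul_of_nonneg_right (min_le_left _ _) (norm_nonneg _)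
      linarith
    · intro z hz y hy hzy
      refine (min_le_right _ _).trans ?_
      have hz1 : z ∈ ball x₀ r := ball_subset_ball (min_le_left _ _) hz.2
      have hz2 : z ∈ ball x₀ r' := ball_subset_ball (min_le_right _ _) hz.2
      have hy1 : y ∈ ball x₀ r := ball_subset_ball (min_le_left _ _) hy.2
      have hBw0 : 0 < ‖B (z - y)‖ := norm_pos_iff.2 fun h0 => hzy (sub_eq_zero.1 (hBinj _ h0))
      set w := z - y
      set G := ‖B w‖⁻¹ • B.adjoint (B w) + t • q with hG
      have hGn : ‖G‖ ≤ ‖B‖ + ‖t • q‖ := by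
        refine (norm_add_le _ _).trans (add_le_add_left ?_ _)
        rw [norm_smul, norm_inv, norm_norm, inv_mul_le_iff₀ hBw0]
        have := B.adjoint.le_opNorm (B w)
        rw [LinearIsometryEquiv.norm_map] at this
        linarith
      have h1 : inner ℝ (γ x₀) G = ‖B w‖⁻¹ * inner ℝ q w + t * β := by
        rw [hG, inner_add_right, inner_smul_right, inner_smul_right,
          ContinuousLinearMap.adjoint_inner_right, real_inner_comm, hBγ,
          real_inner_comm q (γ x₀)]
      have h2 : -(c * (t * β / 4) * ‖w‖) ≤ inner ℝ q w := by
        have h3 := (abs_le.1 (hest z hz1 y hy1)).2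
        have h4 : ρ z = 0 := ((hch z hz1).2.2.2).1 hz.1
        have h5 := (hch y hy1).2.2.1 hy.1
        linarith
      have h3 : -(t * β / 4) ≤ ‖B w‖⁻¹ * inner ℝ q w := by
        rw [← div_eq_inv_mul, le_div_iff₀ hBw0]
        have := mul_le_mul_of_nonneg_left (hBc w) (by positivity : 0 ≤ t * β / 4)
        linarith
      have h4 : inner ℝ (γ z) G = inner ℝ (γ x₀) G + inner ℝ (γ z - γ x₀) G := by
        rw [inner_sub_left]; ring
      have h5 := neg_le_of_abs_le (abs_real_inner_le_norm (γ z - γ x₀) G)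
      have h6 := (mul_le_mul_of_nonneg_left hGn (norm_nonneg (γ z - γ x₀))).trans
        (hγr z ⟨hz.1, hz2⟩)
      rw [h4, h1]
      linarith

end

section

variable {Ω : Set 𝔼[n]} {H : 𝔼[n] → 𝔼[n] → ℝ} {γ : 𝔼[n] → 𝔼[n]} {g : 𝔼[n] → ℝ} {a b : ℝ}
  {v : 𝔼[n] → ℝ}

/-! ### Slope bounds -/

/-- The increments of `v` on `S` are bounded by the support function of `C`. -/
def SlopesIn (S C : Set 𝔼[n]) (v : 𝔼[n] → ℝ) : Prop :=
  ∀ x ∈ S, ∀ y ∈ S, ∃ p ∈ C, v x - v y ≤ inner ℝ p (x - y)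

theorem SlopesIn.mono {S S' C C' : Set 𝔼[n]} (h : SlopesIn S C v) (hS : S' ⊆ S) (hC : C ⊆ C') :
    SlopesIn S' C' v := fun x hx y hy =>
  let ⟨p, hp, hxy⟩ := h x (hS hx) y (hS hy)
  ⟨p, hC hp, hxy⟩

/-- A cone with vertex `y`, steepened by a quadratic term, bounds a Lipschitz subsolution. -/
theorem IsSubsolution.le_cone (h : Admissible Ω H γ g) (hv : IsSubsolution Ω H γ g a v)
    (husc : UpperSemicontinuousOn v (closure Ω)) {x₀ y q : 𝔼[n]} {B : 𝔼[n] →L[ℝ] 𝔼[n]}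
    {c L Λ C R : ℝ} (hc : 0 < c) (hB : ∀ w, c * ‖w‖ ≤ ‖B w‖) (hR : 0 < R) (hC : 0 ≤ C)
    (hL : ∀ z ∈ closure Ω ∩ closedBall x₀ R, v z - v y ≤ L * ‖z - y‖) (hΛ : 0 ≤ Λ)
    (hCL : L + ‖q‖ ≤ C * c ^ 2 / 2) (hy : y ∈ closure Ω ∩ ball x₀ (R / 2))
    (hcond : ∀ z ∈ closure Ω ∩ ball x₀ R, z ≠ y → ∀ m, Λ ≤ m → m ≤ Λ + 4 * C * ‖B‖ →
      a < H z (q + m • (‖B (z - y)‖⁻¹ • B.adjoint (B (z - y)))) ∧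
      (z ∈ frontier Ω →
        g z < inner ℝ (γ z) (q + m • (‖B (z - y)‖⁻¹ • B.adjoint (B (z - y)))))) :
    ∀ x ∈ closure Ω ∩ ball x₀ R,
      v x - v y ≤ inner ℝ q (x - y) + Λ * ‖B (x - y)‖ + C / R * ‖B (x - y)‖ ^ 2 := by
  intro x hx
  have hyR : y ∈ closure Ω ∩ ball x₀ R := ⟨hy.1, ball_subset_ball (by linarith) hy.2⟩
  -- The quadratic term dominates `v - v y` on the sphere, where `‖z - y‖ ≥ R / 2`, thanks to `hCL`.
  -- Within the ball it raises the radial steepness by at most `4 C ‖B‖`, whence the range of `m` in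
  -- `hcond`.
  set ψ : 𝔼[n] → ℝ := fun z =>
    inner ℝ q (z - y) + (Λ * ‖B (z - y)‖ + C / R * ‖B (z - y)‖ ^ 2) with hψ
  have hψy : ψ y = 0 := by simp [ψ]
  have := hv.le_of_strict h husc hyR (ψ := ψ)
    (G := fun z => q + (Λ + C / R * (2 * ‖B (z - y)‖)) •
      (‖B (z - y)‖⁻¹ • B.adjoint (B (z - y)))) (by simp only [ψ]; fun_prop) ?_ ?_ x hx
  · rw [hψy] at this
    simp only [ψ] at this
    linarith
  · intro z hz hzy
    have hBz : B (z - y) ≠ 0 := fun h0 => by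
      have h1 := hB (z - y)
      rw [h0, norm_zero] at h1
      exact hzy (sub_eq_zero.1 (norm_le_zero_iff.1 (nonpos_of_mul_nonpos_right h1 hc)))
    have hcd := contDiffAt_norm_map B hBz
    refine ⟨?_, ?_, hcond z hz hzy _ ?_ ?_⟩
    · exact (contDiffAt_const.inner ℝ (contDiffAt_id.sub contDiffAt_const)).add
        ((contDiffAt_const.mul hcd).add (contDiffAt_const.mul (hcd.pow 2)))
    · have h1 := hasGradientAt_norm_map B hBz
      rw [hasGradientAt_iff_hasFDerivAt] at h1 ⊢
      have h2 : HasFDerivAt (fun w => inner ℝ q (w - y)) (innerSL ℝ q) z :=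
        (innerSL ℝ q).hasFDerivAt.comp z ((hasFDerivAt_id z).sub_const y)
      have h3 : HasDerivAt (fun s : ℝ => Λ * s + C / R * s ^ 2)
          (Λ + C / R * (2 * ‖B (z - y)‖)) ‖B (z - y)‖ := by
        have h4 := ((hasDerivAt_id ‖B (z - y)‖).const_mul Λ).add
            (((hasDerivAt_id ‖B (z - y)‖).pow 2).const_mul (C / R))
        convert! h4 using 1
        simp
      rw [map_add, map_smul]
      have h5 := h3.comp_hasFDerivAt z h1
      exact h2.add h5
    · have : 0 ≤ C / R * (2 * ‖B (z - y)‖) := by positivity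
      linarith
    · have h1 : ‖z - y‖ ≤ 2 * R := by
        rw [← dist_eq_norm]
        have h2 := dist_triangle_right z y x₀
        have h3 : dist z x₀ < R := hz.2
        have h4 : dist y x₀ < R := hyR.2
        linarith
      have h2 : ‖B (z - y)‖ ≤ ‖B‖ * (2 * R) :=
        (B.le_opNorm _).trans (mul_le_mul_of_nonneg_left h1 (norm_nonneg _))
      have h3 : C / R * (2 * ‖B (z - y)‖) ≤ C / R * (2 * (‖B‖ * (2 * R))) := by gcongr
      have h4 : C / R * (2 * (‖B‖ * (2 * R))) = 4 * C * ‖B‖ := by field_simp; ring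
      linarith
  · intro z hz hzR
    have h1 := hL z ⟨hz, hzR.le⟩
    have h2 : R / 2 ≤ ‖z - y‖ := by
      have h3 := dist_triangle z y x₀
      have h4 : dist y x₀ < R / 2 := hy.2
      rw [← dist_eq_norm]
      linarith
    have h3 := neg_le_of_abs_le (abs_real_inner_le_norm q (z - y))
    have h4 : (c * ‖z - y‖) ^ 2 ≤ ‖B (z - y)‖ ^ 2 := by
      have := hB (z - y)
      gcongr
    have h5 : C / R * (c * ‖z - y‖) ^ 2 ≤ C / R * ‖B (z - y)‖ ^ 2 :=
      mul_le_mul_of_nonneg_left h4 (by positivity)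
    have h6 : C * c ^ 2 / 2 * ‖z - y‖ ≤ C / R * (c * ‖z - y‖) ^ 2 := by
      have : C / R * (c * ‖z - y‖) ^ 2 = C * c ^ 2 / R * ‖z - y‖ * ‖z - y‖ := by ring
      rw [this]
      refine mul_le_mul_of_nonneg_right ?_ (norm_nonneg _)
      have : C * c ^ 2 / 2 = C * c ^ 2 / R * (R / 2) := by field_simp
      rw [this]
      exact mul_le_mul_of_nonneg_left h2 (by positivity)
    have h7 : (L + ‖q‖) * ‖z - y‖ ≤ C * c ^ 2 / 2 * ‖z - y‖ :=
      mul_le_mul_of_nonneg_right hCL (norm_nonneg _)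
    have h8 : 0 ≤ Λ * ‖B (z - y)‖ := by positivity
    rw [hψy]
    simp only [ψ]
    linarith

/-- A large ellipsoid supported at `e` leaves out the points of a bounded set strictly below its
supporting hyperplane. -/
theorem exists_large_ellipsoid (B : 𝔼[n] →L[ℝ] 𝔼[n]) {c C δ : ℝ} (hc : 0 < c)
    (hB : ∀ w, c * ‖w‖ ≤ ‖B w‖) (hδ : 0 < δ) :
    ∃ Λ : ℝ, 0 < Λ ∧ ∀ m : ℝ, Λ ≤ m → ∀ e u, ‖B e‖ = 1 → ‖B u‖ = 1 →
      ‖m • B.adjoint (B u) - Λ • B.adjoint (B e)‖ ≤ C →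
      -δ < inner ℝ (m • B.adjoint (B u) - Λ • B.adjoint (B e)) e := by
  -- Pairing the difference of slopes with `u` and splitting `u = e + (u - e)`, a violation would
  -- give `Λ c² τ² / 2 ≤ -δ + C τ` with `τ = ‖u - e‖`. This `Λ` makes the discriminant negative.
  set Λ := C ^ 2 / (c ^ 2 * δ) + 1
  have hΛ : 0 < Λ := by positivity
  refine ⟨Λ, hΛ, fun m hm e u he hu hs => ?_⟩
  set s := m • B.adjoint (B u) - Λ • B.adjoint (B e) with hs_def
  by_contra! hle
  have h1 : inner ℝ s u = m - Λ * inner ℝ (B e) (B u) := by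
    rw [hs_def, inner_sub_left, inner_smul_left, inner_smul_left,
      ContinuousLinearMap.adjoint_inner_left, ContinuousLinearMap.adjoint_inner_left,
      real_inner_self_eq_norm_sq, hu]
    simp
  have h2 : ‖B (u - e)‖ ^ 2 = 2 - 2 * inner ℝ (B e) (B u) := by
    rw [map_sub, norm_sub_sq_real, hu, he, real_inner_comm]
    ring
  have h3 : (c * ‖u - e‖) ^ 2 ≤ ‖B (u - e)‖ ^ 2 := by
    have := hB (u - e)
    gcongr
  have h4 : inner ℝ s u = inner ℝ s e + inner ℝ s (u - e) := by
    rw [inner_sub_right]; ring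
  have h5 : inner ℝ s (u - e) ≤ C * ‖u - e‖ :=
    (real_inner_le_norm _ _).trans (mul_le_mul_of_nonneg_right hs (norm_nonneg _))
  set τ := ‖u - e‖
  have h6 : Λ * (c * τ) ^ 2 / 2 ≤ -δ + C * τ := by
    have h7 : Λ * (c * τ) ^ 2 ≤ Λ * (2 - 2 * inner ℝ (B e) (B u)) := by
      rw [← h2]
      exact mul_le_mul_of_nonneg_left h3 hΛ.le
    linarith
  have h8 : Λ * (c ^ 2 * δ) = C ^ 2 + c ^ 2 * δ := by
    simp only [Λ]
    field_simp
  have h9 : C ^ 2 * τ ^ 2 + c ^ 2 * δ * τ ^ 2 ≤ 2 * δ * (-δ + C * τ) := by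
    have := mul_le_mul_of_nonneg_left h6 (by positivity : 0 ≤ 2 * δ)
    have e1 : 2 * δ * (Λ * (c * τ) ^ 2 / 2) = Λ * (c ^ 2 * δ) * τ ^ 2 := by ring
    rw [e1, h8] at this
    linarith
  have h10 : 0 ≤ c ^ 2 * δ * τ ^ 2 := by positivity
  nlinarith [sq_nonneg (C * τ - δ)]

/-- The facts on the boundary and the oblique direction that the slope estimates use. -/
theorem Admissible.exists_frame (h : Admissible Ω H γ g) {x₀ : 𝔼[n]} (hx₀ : x₀ ∈ frontier Ω) :
    ∃ q : 𝔼[n], 0 < inner ℝ q (γ x₀) ∧ (∃ B : 𝔼[n] →L[ℝ] 𝔼[n], ∃ c > 0,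
      (∀ z, c * ‖z‖ ≤ ‖B z‖) ∧ ∀ z, inner ℝ (B z) (B (γ x₀)) = inner ℝ q z) ∧
      ∀ κ > 0, ∃ r > 0, ∀ z ∈ closure Ω ∩ ball x₀ r, ∀ y ∈ closure Ω ∩ ball x₀ r,
        (z ∈ frontier Ω → -(κ * ‖z - y‖) ≤ inner ℝ q (z - y)) ∧
        (y ∈ frontier Ω → inner ℝ q (z - y) ≤ κ * ‖z - y‖) := by
  obtain ⟨ρ, hρ⟩ := h.hasC1Boundary x₀ hx₀
  have hβ := h.isOblique.inner_gradient_pos hx₀ hρ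
  refine ⟨gradient ρ x₀, hβ, exists_adapted_map hβ, fun κ hκ => ?_⟩
  obtain ⟨r, hr, hch, hest⟩ := hρ.exists_chart h.isOpen hκ
  refine ⟨r, hr, fun z hz y hy => ?_⟩
  have h1 := abs_le.1 (hest z hz.2 y hy.2)
  have h2 := (hch z hz.2).2.2.1 hz.1
  have h3 := (hch y hy.2).2.2.1 hy.1
  constructor
  · intro hzΓ
    have h4 := ((hch z hz.2).2.2.2).1 hzΓ
    linarith [h1.2]
  · intro hyΓ
    have h4 := ((hch y hy.2).2.2.2).1 hyΓ
    linarith [h1.1]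

theorem Admissible.data_near (h : Admissible Ω H γ g) {x₀ : 𝔼[n]} (hx₀ : x₀ ∈ frontier Ω) {C η : ℝ}
    (hη : 0 < η) : ∃ r > 0, ∀ z ∈ frontier Ω ∩ ball x₀ r,
      |g z - g x₀| ≤ η ∧ ∀ p, ‖p‖ ≤ C → |inner ℝ (γ z) p - inner ℝ (γ x₀) p| ≤ η := by
  have h1 : ∀ᶠ z in 𝓝[frontier Ω] x₀, ‖g z - g x₀‖ < η :=
    (((h.continuousOn_datum x₀ hx₀).sub continuousWithinAt_const).norm).eventually_lt
      continuousWithinAt_const (by simpa using hη)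
  have h2 : ∀ᶠ z in 𝓝[frontier Ω] x₀, ‖γ z - γ x₀‖ * C < η :=
    ((((h.continuousOn_oblique x₀ hx₀).sub continuousWithinAt_const).norm).mul
      continuousWithinAt_const).eventually_lt continuousWithinAt_const (by simpa using hη)
  obtain ⟨r, hr, hb⟩ := Metric.eventually_nhds_iff_ball.1 (eventually_nhdsWithin_iff.1 (h1.and h2))
  refine ⟨r, hr, fun z hz => ?_⟩
  obtain ⟨h3, h4⟩ := hb z hz.2 hz.1
  refine ⟨h3.le, fun p hp => ?_⟩
  rw [← inner_sub_left]
  exact ((abs_real_inner_le_norm _ _).trans (mul_le_mul_of_nonneg_left hp (norm_nonneg _))).trans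
    h4.le

end

/-! ### Paraboloid tests and slope bounds at interior points. -/

section

variable {Ω : Set 𝔼[n]} {H : 𝔼[n] → 𝔼[n] → ℝ} {γ : 𝔼[n] → 𝔼[n]} {g : 𝔼[n] → ℝ} {a b : ℝ}
  {v : 𝔼[n] → ℝ}

theorem contDiff_quadratic (B : 𝔼[n] →L[ℝ] 𝔼[n]) (q y : 𝔼[n]) (k : ℝ) :
    ContDiff ℝ 1 (fun w => inner ℝ q (w - y) + k * ‖B (w - y)‖ ^ 2) := by
  have h1 : ContDiff ℝ 1 fun w => B (w - y) := B.contDiff.comp (contDiff_id.sub contDiff_const)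
  exact (contDiff_const.inner ℝ (contDiff_id.sub contDiff_const)).add
    (contDiff_const.mul (h1.norm_sq ℝ))

theorem hasGradientAt_quadratic (B : 𝔼[n] →L[ℝ] 𝔼[n]) (q y z : 𝔼[n]) (k : ℝ) :
    HasGradientAt (fun w => inner ℝ q (w - y) + k * ‖B (w - y)‖ ^ 2)
      (q + (2 * k) • B.adjoint (B (z - y))) z := by
  rw [hasGradientAt_iff_hasFDerivAt]
  have h1 : HasFDerivAt (fun w => B (w - y)) B z := B.hasFDerivAt.comp z
    ((hasFDerivAt_id z).sub_const y)
  have h2 : HasFDerivAt (fun w => inner ℝ q (w - y)) (innerSL ℝ q) z :=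
    (innerSL ℝ q).hasFDerivAt.comp z ((hasFDerivAt_id z).sub_const y)
  have h3 := h2.add (h1.norm_sq.const_mul k)
  convert! h3 using 1
  ext w
  simp [ContinuousLinearMap.adjoint_inner_left]
  ring

/-- A tilted paraboloid cannot violate the subsolution inequalities at all points near `x₀`. -/
theorem IsSubsolution.exists_paraboloid (h : Admissible Ω H γ g) (hv : IsSubsolution Ω H γ g a v)
    (husc : UpperSemicontinuousOn v (closure Ω)) {x₀ : 𝔼[n]} (hx₀ : x₀ ∈ closure Ω) (q : 𝔼[n])
    {B : 𝔼[n] →L[ℝ] 𝔼[n]} {c L R : ℝ} (hc : 0 < c) (hB : ∀ w, c * ‖w‖ ≤ ‖B w‖) (hR : 0 < R)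
    (hL₀ : 0 ≤ L)
    (hL : ∀ z ∈ closure Ω ∩ closedBall x₀ R, v z - v x₀ ≤ L * ‖z - x₀‖) :
    ∃ z ∈ closure Ω ∩ ball x₀ R,
      ¬ (a < H z (q + (2 * ((L + ‖q‖) / (c ^ 2 * R))) • B.adjoint (B (z - x₀))) ∧
      (z ∈ frontier Ω → g z <
        inner ℝ (γ z) (q + (2 * ((L + ‖q‖) / (c ^ 2 * R))) • B.adjoint (B (z - x₀))))) := by
  by_contra! hcon
  -- Chosen so that `W (c R)² = (L + ‖q‖) R`: on the sphere the quadratic term pays for both the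
  -- growth of `v` and the tilt.
  set W := (L + ‖q‖) / (c ^ 2 * R) with hW
  set ψ : 𝔼[n] → ℝ := fun z => inner ℝ q (z - x₀) + W * ‖B (z - x₀)‖ ^ 2 with hψ
  have hψ0 : ψ x₀ = 0 := by simp [ψ]
  have hx₀R : x₀ ∈ closure Ω ∩ ball x₀ R := ⟨hx₀, mem_ball_self hR⟩
  have hcd : ContDiff ℝ 1 ψ := contDiff_quadratic B q x₀ W
  have hgr : ∀ z, HasGradientAt ψ (q + (2 * W) • B.adjoint (B (z - x₀))) z := fun z =>
    hasGradientAt_quadratic B q x₀ z W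
  have hmax := hv.le_of_strict h husc hx₀R (ψ := ψ)
    (G := fun z => q + (2 * W) • B.adjoint (B (z - x₀))) hcd.continuous
    (fun z hz _ => ⟨hcd.contDiffAt, hgr z, (hcon z hz).1, (hcon z hz).2⟩) (by
      intro z hz hzR
      have h1 := hL z ⟨hz, hzR.le⟩
      have h2 : ‖z - x₀‖ = R := by rw [← dist_eq_norm]; exact hzR
      have h3 := neg_le_of_abs_le (abs_real_inner_le_norm q (z - x₀))
      have h4 := hB (z - x₀)
      rw [h2] at h1 h3 h4
      rw [hψ0]
      simp only [ψ]
      have h5 : W * (c * R) ^ 2 ≤ W * ‖B (z - x₀)‖ ^ 2 := by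
        have : 0 ≤ W := by positivity
        gcongr
      have h6 : W * (c * R) ^ 2 = (L + ‖q‖) * R := by
        rw [hW]; field_simp
      linarith)
  -- Unlike a cone, the paraboloid is smooth at its vertex, so a maximum there is contradictory as
  -- well.
  have h1 := hv.local_test husc hx₀ hcd.contDiffAt (hgr x₀) (by
    filter_upwards [self_mem_nhdsWithin, mem_nhdsWithin_of_mem_nhds (ball_mem_nhds x₀ hR)]
      with z hz hz' using hmax z ⟨hz, hz'⟩)
  obtain ⟨h2, h3⟩ := hcon x₀ hx₀R
  rcases h.mem_or hx₀ with hΩ | hΓ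
  · exact absurd (h1.1 hΩ) (not_le.2 h2)
  · rcases h1.2 hΓ with h4 | h4
    · exact absurd h4 (not_le.2 h2)
    · exact absurd h4 (not_le.2 (h3 hΓ))

/-- Subsolutions satisfy the slope bound near interior points. -/
theorem Admissible.exists_interior_slopes (h : Admissible Ω H γ g) (a : ℝ) {x₀ : 𝔼[n]}
    (hx₀ : x₀ ∈ Ω) {ε : ℝ} (hε : 0 < ε) :
    ∃ r > 0, ∀ v, UpperSemicontinuousOn v (closure Ω) → IsSubsolution Ω H γ g a v →
      SlopesIn (closure Ω ∩ ball x₀ r) (thick ε (sublevel H a x₀)) v := by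
  obtain ⟨r₀, hr₀, L, hL, hLip⟩ := h.exists_lipschitz a (subset_closure hx₀)
  obtain ⟨U, hU, hZU, hUth⟩ := exists_isOpen_subset_thick (half_pos hε)
    (C := sublevel H a x₀)
  obtain ⟨r₁, hr₁, husc₁⟩ := h.sublevel_usc hU hZU
  obtain ⟨r₂, hr₂, hball⟩ := Metric.isOpen_iff.1 h.isOpen x₀ hx₀
  obtain ⟨RH, hRH, hbound⟩ := h.exists_bound a
  set I := ContinuousLinearMap.id ℝ 𝔼[n]
  have hI : ∀ w : 𝔼[n], 1 * ‖w‖ ≤ ‖I w‖ := fun w => by simp [I]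
  have hIadj : ∀ w : 𝔼[n], I.adjoint w = w := fun w => by
    refine ext_inner_right ℝ fun u => ?_
    rw [ContinuousLinearMap.adjoint_inner_left]
    rfl
  have hI1 : ‖I‖ ≤ 1 := ContinuousLinearMap.norm_id_le
  obtain ⟨Λ, hΛ, hell⟩ := exists_large_ellipsoid I (C := RH + (L + ε)) one_pos hI
    (by positivity : 0 < ε / 4)
  set Q := L + ε + Λ
  set C := 2 * (L + Q)
  have hC : 0 < C := by positivity
  set R := min r₀ (min r₁ r₂) / 2
  have hR : 0 < R := by positivity
  have hRr₀ : R < r₀ := by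
    have : min r₀ (min r₁ r₂) ≤ r₀ := min_le_left _ _
    simp only [R]; linarith
  have hRr₁ : R < r₁ := by
    have : min r₀ (min r₁ r₂) ≤ r₁ := (min_le_right _ _).trans (min_le_left _ _)
    simp only [R]; linarith
  have hRr₂ : R < r₂ := by
    have : min r₀ (min r₁ r₂) ≤ r₂ := (min_le_right _ _).trans (min_le_right _ _)
    simp only [R]; linarith
  set r := min (R / 2) (ε * R / (16 * C))
  have hr : 0 < r := by positivity
  refine ⟨r, hr, fun v husc hv x hx y hy => ?_⟩
  by_contra! hcon
  have hLip' : ∀ x ∈ closure Ω ∩ closedBall x₀ R, ∀ y ∈ closure Ω ∩ closedBall x₀ R,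
      v x - v y ≤ L * ‖x - y‖ := fun x hx y hy => hLip v husc hv x
    ⟨hx.1, closedBall_subset_ball hRr₀ hx.2⟩ y ⟨hy.1, closedBall_subset_ball hRr₀ hy.2⟩
  have hrR : r ≤ R := (min_le_left _ _).trans (by linarith)
  have hx' : x ∈ closure Ω ∩ ball x₀ R := ⟨hx.1, ball_subset_ball hrR hx.2⟩
  have hy' : y ∈ closure Ω ∩ ball x₀ R := ⟨hy.1, ball_subset_ball hrR hy.2⟩
  -- For coinciding points the claim is only that the slope set is nonempty. If it were empty, `H >
  -- a` would hold near `x₀` for every slope, and a paraboloid would be contradicted.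
  by_cases hxy : x = y
  · subst hxy
    have hemp : ∀ p, p ∉ sublevel H a x₀ := fun p hp => by
      have := hcon p (subset_thick hε.le hp)
      simp at this
    obtain ⟨r₃, hr₃, hno⟩ := h.sublevel_usc (x := x₀) (a := a) isOpen_empty
      fun p hp => absurd hp (hemp p)
    set R' := min R r₃ / 2
    have hR' : 0 < R' := by positivity
    have hR'R : R' < R := by
      have : min R r₃ ≤ R := min_le_left _ _
      simp only [R']; linarith
    have hR'r : R' < r₃ := by
      have : min R r₃ ≤ r₃ := min_le_right _ _
      simp only [R']; linarith
    obtain ⟨z, hz, hnot⟩ := hv.exists_paraboloid h husc (subset_closure hx₀) 0 one_pos hI hR'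
      hL.le (L := L) fun z hz => hLip' z ⟨hz.1, closedBall_subset_closedBall hR'R.le hz.2⟩ x₀
        ⟨subset_closure hx₀, mem_closedBall_self hR.le⟩
    refine hnot ⟨?_, fun hzΓ => absurd (hball (ball_subset_ball (hR'R.trans hRr₂).le hz.2))
      (h.notMem hzΓ)⟩
    by_contra! hle
    exact hno z ⟨hz.1, ball_subset_ball hR'r.le hz.2⟩ hle
  · set d := x - y with hd
    set k := v x - v y
    have hℓ : 0 < ‖d‖ := norm_pos_iff.2 (sub_ne_zero.2 hxy)
    set ℓ := ‖d‖ with hℓ_def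
    set e := ℓ⁻¹ • d with he
    have hen : ‖e‖ = 1 := by
      rw [he, norm_smul, norm_inv, norm_norm, ← hℓ_def, inv_mul_cancel₀ hℓ.ne']
    have hk1 : k ≤ L * ℓ := hLip' x ⟨hx'.1, ball_subset_closedBall hx'.2⟩ y
      ⟨hy'.1, ball_subset_closedBall hy'.2⟩
    have hk2 : -(L * ℓ) ≤ k := by
      have := hLip' y ⟨hy'.1, ball_subset_closedBall hy'.2⟩ x ⟨hx'.1, ball_subset_closedBall hx'.2⟩
      rw [norm_sub_rev] at this
      simp only [k]
      linarith
    -- The cone has slope `s` from `y` towards `x`, just below the difference quotient; the gap `ε /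
    -- 4` absorbs the quadratic term. Far out, its set of slopes resembles the half-space beyond `s
    -- e`.
    set s := k / ℓ - ε / 4 with hs
    have hsn : |s| ≤ L + ε := by
      have h1 : k / ℓ ≤ L := (div_le_iff₀ hℓ).2 hk1
      have h2 : -L ≤ k / ℓ := (le_div_iff₀ hℓ).2 (by linarith)
      rw [abs_le]
      constructor <;> linarith
    have hpn : ‖s • e‖ ≤ L + ε := by
      rw [norm_smul, hen, mul_one]; exact hsn
    set q := (s - Λ) • e with hq
    have hqn : ‖q‖ ≤ Q := by
      rw [hq, sub_smul]
      refine (norm_sub_le _ _).trans (add_le_add hpn ?_)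
      rw [norm_smul, hen, mul_one, Real.norm_of_nonneg hΛ.le]
    have hcone := hv.le_cone h husc (x₀ := x₀) (y := y) (q := q) (Λ := Λ) (C := C) (L := L)
      one_pos hI hR hC.le (fun z hz => hLip' z hz y ⟨hy'.1, ball_subset_closedBall hy'.2⟩) hΛ.le
      (by simp only [C]; linarith) ⟨hy.1, ball_subset_ball (min_le_left _ _) hy.2⟩ ?_ x hx'
    · have h1 : inner ℝ q d = (s - Λ) * ℓ := by
        rw [hq, he, inner_smul_left, inner_smul_left, real_inner_self_eq_norm_sq, ← hℓ_def]
        simp only [conj_trivial]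
        field_simp
      have h2 : ‖I d‖ = ℓ := rfl
      rw [← hd, h1, h2] at hcone
      have h3 : s * ℓ = k - ε / 4 * ℓ := by rw [hs, sub_mul, div_mul_cancel₀ _ hℓ.ne']
      have h4 : ℓ < 2 * r := by
        have h5 := dist_triangle_right x y x₀
        have h6 : dist x x₀ < r := hx.2
        have h7 : dist y x₀ < r := hy.2
        rw [hℓ_def, hd, ← dist_eq_norm]
        linarith
      have h5 : C / R * ℓ ^ 2 < ε / 4 * ℓ := by
        have h6 : C / R * ℓ < C / R * (2 * r) := by gcongr
        have h7 : C / R * (2 * r) ≤ C / R * (2 * (ε * R / (16 * C))) := by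
          gcongr
          exact min_le_right _ _
        have h8 : C / R * (2 * (ε * R / (16 * C))) = ε / 8 := by field_simp; norm_num
        calc C / R * ℓ ^ 2 = C / R * ℓ * ℓ := by ring
          _ < ε / 4 * ℓ := by
            refine mul_lt_mul_of_pos_right ?_ hℓ
            linarith
      have h6 : k ≤ (s - Λ) * ℓ + Λ * ℓ + C / R * ℓ ^ 2 := hcone
      linarith
    · intro z hz hzy m hm _
      refine ⟨?_, fun hzΓ => absurd (hball (ball_subset_ball hRr₂.le hz.2)) (h.notMem hzΓ)⟩
      by_contra! hle
      set u := ‖z - y‖⁻¹ • (z - y)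
      have hPeq : q + m • (‖I (z - y)‖⁻¹ • I.adjoint (I (z - y))) = q + m • u := by
        rw [hIadj]; rfl
      rw [hPeq] at hle
      set P := q + m • u with hP
      have hPR : ‖P‖ ≤ RH := hbound z hz.1 P hle
      have hPU := hUth (husc₁ z ⟨hz.1, ball_subset_ball hRr₁.le hz.2⟩ hle)
      have hun : ‖u‖ = 1 := by
        rw [norm_smul, norm_inv, norm_norm, inv_mul_cancel₀]
        exact norm_ne_zero_iff.2 (sub_ne_zero.2 hzy)
      have hdiff : m • I.adjoint (I u) - Λ • I.adjoint (I e) = P - s • e := by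
        rw [hIadj, hIadj, hP, hq, sub_smul]
        change m • u - Λ • e = s • e - Λ • e + m • u - s • e
        abel
      have h1 := hell m hm e u hen hun (by
        rw [hdiff]
        exact (norm_sub_le _ _).trans (add_le_add hPR hpn))
      rw [hdiff] at h1
      -- A slope `P` of the cone with `H ≤ a` has `P · e > s - ε / 4`. Moved by `ε / 2` along `e` it
      -- stays in the `ε`-thickening and its component exceeds `k / ℓ`, against `hcon`.
      have h2 := hcon (P + (ε / 2) • e) (thick_thick_subset (ε := ε / 2) (ε' := ε / 2)
        ⟨P, hPU, by rw [add_sub_cancel_left, norm_smul, hen, Real.norm_of_nonneg (by positivity),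
          mul_one]⟩ |> (thick_mono (by linarith) subset_rfl ·))
      have h3 : inner ℝ (P + (ε / 2) • e) d = ℓ * (inner ℝ P e + ε / 2) := by
        have : d = ℓ • e := by rw [he, smul_smul, mul_inv_cancel₀ hℓ.ne', one_smul]
        rw [this, inner_smul_right, inner_add_left, inner_smul_left, real_inner_self_eq_norm_sq,
          hen]
        simp
      rw [h3] at h2
      have h4 : inner ℝ (P - s • e) e = inner ℝ P e - s := by
        rw [inner_sub_left, inner_smul_left, real_inner_self_eq_norm_sq, hen]
        simp
      rw [h4] at h1
      have h5 : inner ℝ P e + ε / 2 < k / ℓ := (lt_div_iff₀ hℓ).2 (by linarith)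
      linarith

end

/-! ### Slope bounds between boundary points. -/

section

variable {Ω : Set 𝔼[n]} {H : 𝔼[n] → 𝔼[n] → ℝ} {γ : 𝔼[n] → 𝔼[n]} {g : 𝔼[n] → ℝ} {a b : ℝ}
  {v : 𝔼[n] → ℝ}

/-- Lets a single small parameter meet several smallness requirements at once. -/
theorem exists_pos_mul_le {ι : Type*} (s : Finset ι) (X Y : ι → ℝ) (hX : ∀ i, 0 ≤ X i)
    (hY : ∀ i, 0 < Y i) : ∃ κ > 0, ∀ i ∈ s, κ * X i ≤ Y i := by
  classical
  induction s using Finset.induction_on with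
  | empty => exact ⟨1, one_pos, by simp⟩
  | insert i s _ ih =>
    obtain ⟨κ, hκ, hs⟩ := ih
    have hXi := hX i
    have hYi := hY i
    refine ⟨min κ (Y i / (X i + 1)), by positivity, fun j hj => ?_⟩
    rcases Finset.mem_insert.1 hj with rfl | hj
    · calc min κ (Y j / (X j + 1)) * X j ≤ Y j / (X j + 1) * (X j + 1) :=
            mul_le_mul (min_le_right _ _) (by linarith) hXi (by positivity)
        _ = Y j := div_mul_cancel₀ _ (by positivity)
    · exact (mul_le_mul_of_nonneg_right (min_le_left _ _) (hX j)).trans (hs j hj)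

/-- Some boundary slope is admissible as soon as there is a subsolution. -/
theorem Admissible.obliqueSublevel_nonempty (h : Admissible Ω H γ g)
    (hv : IsSubsolution Ω H γ g a v) (husc : UpperSemicontinuousOn v (closure Ω)) {x₀ : 𝔼[n]}
    (hx₀ : x₀ ∈ frontier Ω) : (obliqueSublevel H γ a (g x₀) x₀).Nonempty := by
  by_contra hemp
  rw [not_nonempty_iff_eq_empty] at hemp
  have hx₀c := frontier_mem_closure hx₀
  obtain ⟨r₀, hr₀, L, hL, hLip⟩ := h.exists_lipschitz a hx₀c
  obtain ⟨η, hη, r₁, hr₁, husc₁⟩ := h.obliqueSublevel_usc (x := x₀) (b := g x₀) (a := a)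
    isOpen_empty hemp.subset
  obtain ⟨q, hβ, ⟨B, c, hc, hB, hBγ⟩, hfr⟩ := h.exists_frame hx₀
  set β := inner ℝ q (γ x₀)
  -- The oblique component is placed halfway between `g x₀` and `g x₀ + η`. Up to small errors the
  -- paraboloid keeps it above `g` at boundary points and below `g x₀ + η` everywhere, where
  -- emptiness excludes `H ≤ a`.
  set p := ((g x₀ + η / 2) / β) • q with hp
  have hpγ : inner ℝ (γ x₀) p = g x₀ + η / 2 := by
    rw [hp, inner_smul_right, real_inner_comm]
    exact div_mul_cancel₀ _ hβ.ne'
  -- `T` is the product of the curvature `W` and the radius `R`; it does not depend on `R`, so `κ`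
  -- can be fixed first.
  set T := (L + ‖p‖) / c ^ 2 with hT
  have hT0 : 0 < T := by positivity
  obtain ⟨κ, hκ, hκη⟩ := exists_pos_mul_le {()} (fun _ => 2 * T) (fun _ => η / 8)
    (fun _ => by positivity) (fun _ => by positivity)
  replace hκη := hκη () (by simp)
  obtain ⟨r₂, hr₂, hfr₂⟩ := hfr κ hκ
  obtain ⟨r₃, hr₃, hdata⟩ := h.data_near hx₀ (C := ‖p‖ + 2 * T * (‖B‖ * ‖B‖))
    (by positivity : 0 < η / 8)
  set R := min (min r₀ r₁) (min r₂ r₃) / 2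
  have hm : 0 < min (min r₀ r₁) (min r₂ r₃) := by positivity
  have hR : 0 < R := by positivity
  have hRm : R < min (min r₀ r₁) (min r₂ r₃) := by simp only [R]; linarith
  obtain ⟨⟨hR0, hR1⟩, hR2, hR3⟩ : (R < r₀ ∧ R < r₁) ∧ R < r₂ ∧ R < r₃ := by
    simpa only [lt_min_iff] using hRm
  obtain ⟨z, hz, hnot⟩ := hv.exists_paraboloid h husc hx₀c p hc hB hR hL.le (L := L)
    fun z hz => hLip v husc hv z ⟨hz.1, closedBall_subset_ball hR0 hz.2⟩ x₀
      ⟨hx₀c, mem_ball_self hr₀⟩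
  set W := (L + ‖p‖) / (c ^ 2 * R) with hW
  have hW0 : 0 < W := by positivity
  have hWR : W * R = T := by rw [hW, hT]; field_simp
  set P := p + (2 * W) • B.adjoint (B (z - x₀)) with hP
  have hzR : ‖z - x₀‖ ≤ R := by
    rw [← dist_eq_norm]; exact (mem_ball.1 hz.2).le
  have hPγ : inner ℝ (γ x₀) P = g x₀ + η / 2 + 2 * W * inner ℝ q (z - x₀) := by
    rw [hP, inner_add_right, hpγ, inner_smul_right, ContinuousLinearMap.adjoint_inner_right,
      real_inner_comm, hBγ]
  have hsm : 2 * W * (κ * ‖z - x₀‖) ≤ η / 8 := by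
    calc 2 * W * (κ * ‖z - x₀‖) ≤ 2 * W * (κ * R) := by gcongr
      _ = κ * (2 * T) := by rw [← hWR]; ring
      _ ≤ _ := hκη
  have hfz := hfr₂ z ⟨hz.1, ball_subset_ball hR2.le hz.2⟩ x₀ ⟨hx₀c, mem_ball_self hr₂⟩
  refine hnot ⟨?_, fun hzΓ => ?_⟩
  · by_contra! hle
    refine husc₁ z ⟨hz.1, ball_subset_ball hR1.le hz.2⟩ P hle ?_
    have := mul_le_mul_of_nonneg_left (hfz.2 hx₀) (by positivity : 0 ≤ 2 * W)
    linarith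
  · have h1 := mul_le_mul_of_nonneg_left (hfz.1 hzΓ) (by positivity : 0 ≤ 2 * W)
    obtain ⟨h2, h3⟩ := hdata z ⟨hzΓ, ball_subset_ball hR3.le hz.2⟩
    have h4 := h3 P (by
      rw [hP]
      refine (norm_add_le _ _).trans (add_le_add_right ?_ _)
      rw [norm_smul, Real.norm_of_nonneg (by positivity)]
      have h5 : ‖B.adjoint (B (z - x₀))‖ ≤ ‖B‖ * (‖B‖ * R) := by
        refine (B.adjoint.le_opNorm _).trans ?_
        rw [LinearIsometryEquiv.norm_map]
        exact mul_le_mul_of_nonneg_left ((B.le_opNorm _).trans (by gcongr)) (norm_nonneg _)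
      calc 2 * W * ‖B.adjoint (B (z - x₀))‖ ≤ 2 * W * (‖B‖ * (‖B‖ * R)) := by gcongr
        _ = _ := by rw [← hWR]; ring)
    have h5 := (abs_le.1 h2).2
    have h6 := (abs_le.1 h4).1
    linarith

set_option maxHeartbeats 1000000 in
/-- Subsolutions satisfy the oblique slope bound on the boundary. -/
theorem Admissible.exists_boundary_slopes (h : Admissible Ω H γ g) (a : ℝ) {x₀ : 𝔼[n]}
    (hx₀ : x₀ ∈ frontier Ω) {ε : ℝ} (hε : 0 < ε) :
    ∃ r > 0, ∀ v, UpperSemicontinuousOn v (closure Ω) → IsSubsolution Ω H γ g a v →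
      SlopesIn (frontier Ω ∩ ball x₀ r) (thick ε (obliqueSublevel H γ a (g x₀) x₀)) v := by
  have hx₀c := frontier_mem_closure hx₀
  obtain ⟨r₀, hr₀, L, hL, hLip⟩ := h.exists_lipschitz a hx₀c
  set Z := obliqueSublevel H γ a (g x₀) x₀
  obtain ⟨U, hU, hZU, hUth⟩ := exists_isOpen_subset_thick (half_pos hε) (C := Z)
  obtain ⟨η, hη, r₁, hr₁, husc₁⟩ := h.obliqueSublevel_usc hU hZU
  obtain ⟨q₀, hβ, ⟨B, c, hc, hB, hBγ⟩, hfr⟩ := h.exists_frame hx₀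
  obtain ⟨RH, hRH, hbound⟩ := h.exists_bound a
  set β := inner ℝ q₀ (γ x₀) with hβ_def
  set bB := ‖B‖ + 1 with hbB_def
  have hbB : 0 < bB := by positivity
  have hBle : ∀ w, ‖B w‖ ≤ bB * ‖w‖ := fun w =>
    (B.le_opNorm w).trans (mul_le_mul_of_nonneg_right (by simp [bB]) (norm_nonneg _))
  have hadj : ∀ w, ‖B w‖ = 1 → ‖B.adjoint (B w)‖ ≤ bB := fun w hw => by
    have := B.adjoint.le_opNorm (B w)
    rw [LinearIsometryEquiv.norm_map, hw] at this
    simp only [bB]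
    linarith
  set Gn := ‖γ x₀‖
  set A₁ := 2 * (L + ε) with hA₁
  have hA₁0 : 0 < A₁ := by positivity
  set C₁ := A₁ + (|g x₀| + η + A₁ * Gn) / β * ‖q₀‖ with hC₁
  have hC₁0 : 0 < C₁ := by positivity
  obtain ⟨Λ, hΛ, hell⟩ := exists_large_ellipsoid B (C := RH + C₁) hc hB
    (by positivity : 0 < ε / (16 * bB))
  set Q := C₁ + Λ * bB with hQ
  set C := 2 * (L + Q) / c ^ 2 with hC_def
  have hC : 0 < C := by positivity
  set M := Λ + 4 * C * ‖B‖ with hM_def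
  have hM : 0 < M := by positivity
  -- `κ` measures how far chords of the frontier are from tangent. The first four entries make
  -- replacing a chord by its tangential part harmless; the last bounds the cone's effect on the
  -- oblique component by `η / 8`.
  obtain ⟨κ, hκ, hκs⟩ := exists_pos_mul_le (Finset.univ : Finset (Fin 5))
    ![Gn / β, RH * (Gn / β), C₁ * (Gn / β), 2 * Λ * bB * (Gn / β), M / c]
    ![1 / 2, ε / 16, ε / 32, ε / 32, η / 8]
    (fun i => by fin_cases i <;> simp <;> positivity)
    (fun i => by fin_cases i <;> simp <;> positivity)
  have hκ0 : κ * (Gn / β) ≤ 1 / 2 := hκs 0 (Finset.mem_univ _)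
  have hκ1 : κ * (RH * (Gn / β)) ≤ ε / 16 := hκs 1 (Finset.mem_univ _)
  have hκ2 : κ * (C₁ * (Gn / β)) ≤ ε / 32 := hκs 2 (Finset.mem_univ _)
  have hκ3 : κ * (2 * Λ * bB * (Gn / β)) ≤ ε / 32 := hκs 3 (Finset.mem_univ _)
  have hκ4 : κ * (M / c) ≤ η / 8 := hκs 4 (Finset.mem_univ _)
  set κ' := κ * (Gn / β) with hκ'
  have hκ'0 : 0 ≤ κ' := by positivity
  obtain ⟨r₂, hr₂, hfr₂⟩ := hfr κ hκ
  obtain ⟨r₃, hr₃, hdata⟩ := h.data_near hx₀ (C := Q + M * bB) (by positivity : 0 < η / 8)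
  set R := min (min r₀ r₁) (min r₂ r₃) / 2
  have hm : 0 < min (min r₀ r₁) (min r₂ r₃) := by positivity
  have hR : 0 < R := by positivity
  have hRm : R < min (min r₀ r₁) (min r₂ r₃) := by simp only [R]; linarith
  obtain ⟨⟨hR0, hR1⟩, hR2, hR3⟩ : (R < r₀ ∧ R < r₁) ∧ R < r₂ ∧ R < r₃ := by
    simpa only [lt_min_iff] using hRm
  set r := min (R / 2) (ε * R / (64 * C * bB ^ 2))
  have hr : 0 < r := by positivity
  refine ⟨r, hr, fun v husc hv x hx y hy => ?_⟩
  by_contra! hcon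
  have hLip' : ∀ x ∈ closure Ω ∩ closedBall x₀ R, ∀ y ∈ closure Ω ∩ closedBall x₀ R,
      v x - v y ≤ L * ‖x - y‖ := fun x hx y hy => hLip v husc hv x
    ⟨hx.1, closedBall_subset_ball hR0 hx.2⟩ y ⟨hy.1, closedBall_subset_ball hR0 hy.2⟩
  have hrR : r ≤ R := (min_le_left _ _).trans (by linarith)
  have hx' : x ∈ closure Ω ∩ ball x₀ R :=
    ⟨frontier_mem_closure hx.1, ball_subset_ball hrR hx.2⟩
  have hy' : y ∈ closure Ω ∩ ball x₀ R :=
    ⟨frontier_mem_closure hy.1, ball_subset_ball hrR hy.2⟩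
  have hx2 : x ∈ closure Ω ∩ ball x₀ r₂ := ⟨hx'.1, ball_subset_ball hR2.le hx'.2⟩
  have hy2 : y ∈ closure Ω ∩ ball x₀ r₂ := ⟨hy'.1, ball_subset_ball hR2.le hy'.2⟩
  by_cases hxy : x = y
  · subst hxy
    obtain ⟨p, hp⟩ := h.obliqueSublevel_nonempty hv husc hx₀
    have := hcon p (subset_thick hε.le hp)
    simp at this
  set d := x - y with hd
  set k := v x - v y
  have hℓ : 0 < ‖d‖ := norm_pos_iff.2 (sub_ne_zero.2 hxy)
  set ℓ := ‖d‖ with hℓ_def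
  have hk1 : k ≤ L * ℓ := hLip' x ⟨hx'.1, ball_subset_closedBall hx'.2⟩ y
    ⟨hy'.1, ball_subset_closedBall hy'.2⟩
  have hk2 : -(L * ℓ) ≤ k := by
    have := hLip' y ⟨hy'.1, ball_subset_closedBall hy'.2⟩ x ⟨hx'.1, ball_subset_closedBall hx'.2⟩
    rw [norm_sub_rev] at this
    simp only [k]
    linarith
  -- the tangential part of the displacement
  set d' := d - (inner ℝ q₀ d / β) • γ x₀ with hd'
  have hsd : |inner ℝ q₀ d| ≤ κ * ℓ :=
    abs_le.2 ⟨(hfr₂ x hx2 y hy2).1 hx.1, (hfr₂ x hx2 y hy2).2 hy.1⟩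
  have hdd' : ‖d - d'‖ ≤ κ' * ℓ := by
    rw [hd', sub_sub_cancel, norm_smul, Real.norm_eq_abs, abs_div, abs_of_pos hβ]
    calc |inner ℝ q₀ d| / β * Gn ≤ κ * ℓ / β * Gn := by gcongr
      _ = κ' * ℓ := by rw [hκ']; ring
  have hqd' : inner ℝ q₀ d' = 0 := by
    rw [hd', inner_sub_right, inner_smul_right, ← hβ_def, div_mul_cancel₀ _ hβ.ne', sub_self]
  have hd'1 : ℓ / 2 ≤ ‖d'‖ := by
    have h1 := norm_sub_norm_le d d'
    have h2 : κ' * ℓ ≤ 1 / 2 * ℓ := mul_le_mul_of_nonneg_right hκ0 hℓ.le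
    linarith
  have hd'2 : ‖d'‖ ≤ 2 * ℓ := by
    have h1 := norm_sub_norm_le d' d
    rw [norm_sub_rev d' d] at h1
    have h2 : κ' * ℓ ≤ 1 / 2 * ℓ := mul_le_mul_of_nonneg_right hκ0 hℓ.le
    linarith
  have hd'0 : 0 < ‖d'‖ := by linarith
  have hBd' : 0 < ‖B d'‖ := lt_of_lt_of_le (by positivity) (hB d')
  set e := ‖B d'‖⁻¹ • d' with he
  have hBe : ‖B e‖ = 1 := by
    rw [he, map_smul, norm_smul, norm_inv, norm_norm, inv_mul_cancel₀ hBd'.ne']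
  -- the centre of the supporting hyperplane
  set lam := (k - ε / 4 * ℓ) / ‖d'‖ ^ 2 with hlam
  set μ := (g x₀ + η / 2 - lam * inner ℝ (γ x₀) d') / β with hμ
  set p := lam • d' + μ • q₀ with hp
  have hpd' : inner ℝ p d' = k - ε / 4 * ℓ := by
    rw [hp, inner_add_left, inner_smul_left, inner_smul_left, hqd', real_inner_self_eq_norm_sq,
      mul_zero, add_zero, conj_trivial, hlam, div_mul_cancel₀ _ (by positivity)]
  have hpγ : inner ℝ (γ x₀) p = g x₀ + η / 2 := by
    rw [hp, inner_add_right, inner_smul_right, inner_smul_right, real_inner_comm q₀ (γ x₀),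
      ← hβ_def, hμ, div_mul_cancel₀ _ hβ.ne']
    ring
  have hlamn : |lam| * ‖d'‖ ≤ A₁ := by
    rw [hlam, abs_div, abs_of_pos (by positivity : 0 < ‖d'‖ ^ 2)]
    have h1 : |k - ε / 4 * ℓ| ≤ (L + ε) * ℓ := by
      have : 0 < ε * ℓ := by positivity
      rw [abs_le]
      constructor <;> linarith
    calc |k - ε / 4 * ℓ| / ‖d'‖ ^ 2 * ‖d'‖ = |k - ε / 4 * ℓ| / ‖d'‖ := by field_simp
      _ ≤ (L + ε) * ℓ / (ℓ / 2) := by gcongr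
      _ = A₁ := by rw [hA₁]; field_simp
  have hpn : ‖p‖ ≤ C₁ := by
    refine (norm_add_le _ _).trans ?_
    rw [norm_smul, norm_smul, Real.norm_eq_abs, Real.norm_eq_abs]
    refine add_le_add hlamn (mul_le_mul_of_nonneg_right ?_ (norm_nonneg _))
    rw [hμ, abs_div, abs_of_pos hβ]
    refine div_le_div_of_nonneg_right ?_ hβ.le
    have h1 : |lam * inner ℝ (γ x₀) d'| ≤ A₁ * Gn := by
      rw [abs_mul]
      calc |lam| * |inner ℝ (γ x₀) d'| ≤ |lam| * (Gn * ‖d'‖) :=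
            mul_le_mul_of_nonneg_left (abs_real_inner_le_norm _ _) (abs_nonneg _)
        _ = |lam| * ‖d'‖ * Gn := by ring
        _ ≤ _ := by gcongr
    have h2 := abs_sub (g x₀ + η / 2) (lam * inner ℝ (γ x₀) d')
    have h3 := abs_add_le (g x₀) (η / 2)
    rw [abs_of_pos (by positivity : 0 < η / 2)] at h3
    linarith
  -- The slopes of the cone are `q + m B*B u`, equal to `p` when `m = Λ` and `u = e`. Since `q₀ · e
  -- = 0`, their oblique component is that of `p` plus `m q₀ · u`.
  set q := p - Λ • B.adjoint (B e) with hq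
  have hqn : ‖q‖ ≤ Q := by
    refine (norm_sub_le _ _).trans (add_le_add hpn ?_)
    rw [norm_smul, Real.norm_of_nonneg hΛ.le]
    exact mul_le_mul_of_nonneg_left (hadj e hBe) hΛ.le
  have hcone := hv.le_cone h husc (x₀ := x₀) (y := y) (q := q) (Λ := Λ) (C := C) (L := L)
    hc hB hR hC.le (fun z hz => hLip' z hz y ⟨hy'.1, ball_subset_closedBall hy'.2⟩) hΛ.le
    (by
      have : C * c ^ 2 / 2 = L + Q := by rw [hC_def]; field_simp
      rw [this]; linarith) ⟨hy'.1, ball_subset_ball (min_le_left _ _) hy.2⟩ ?_ x hx'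
  · have h1 : inner ℝ q d = inner ℝ p d - Λ * inner ℝ (B e) (B d) := by
      rw [hq, inner_sub_left, inner_smul_left, ContinuousLinearMap.adjoint_inner_left,
        conj_trivial]
    have h2 : inner ℝ p d ≤ k - ε / 4 * ℓ + C₁ * (κ' * ℓ) := by
      have h3 : inner ℝ p d = inner ℝ p d' + inner ℝ p (d - d') := by
        rw [inner_sub_right p d d']; ring
      have h4 := (real_inner_le_norm p (d - d')).trans
        (mul_le_mul hpn hdd' (norm_nonneg _) hC₁0.le)
      linarith
    have h3 : ‖B d‖ - inner ℝ (B e) (B d) ≤ 2 * (bB * (κ' * ℓ)) := by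
      have h4 : ‖B (d - d')‖ ≤ bB * (κ' * ℓ) :=
        (hBle _).trans (mul_le_mul_of_nonneg_left hdd' hbB.le)
      have h5 : inner ℝ (B e) (B d) = ‖B d'‖ + inner ℝ (B e) (B (d - d')) := by
        have h6 : inner ℝ (B e) (B d') = ‖B d'‖ := by
          rw [he, map_smul, inner_smul_left, real_inner_self_eq_norm_sq, conj_trivial]
          field_simp
        rw [map_sub B d d', inner_sub_right (B e) (B d) (B d'), h6]; ring
      have h6 : ‖B d‖ ≤ ‖B d'‖ + ‖B (d - d')‖ := by
        have := norm_add_le (B d') (B (d - d'))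
        rwa [← map_add, add_sub_cancel] at this
      have h7 := neg_le_of_abs_le (abs_real_inner_le_norm (B e) (B (d - d')))
      rw [hBe, one_mul] at h7
      linarith
    have h4 : ℓ ≤ 2 * r := by
      have h5 := dist_triangle_right x y x₀
      have h6 : dist x x₀ < r := hx.2
      have h7 : dist y x₀ < r := hy.2
      rw [hℓ_def, hd, ← dist_eq_norm]
      linarith
    have h5 : C / R * ‖B d‖ ^ 2 ≤ ε / 32 * ℓ := by
      calc C / R * ‖B d‖ ^ 2 ≤ C / R * (bB * ℓ) ^ 2 := by
            have := hBle d
            gcongr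
        _ = C / R * bB ^ 2 * ℓ * ℓ := by ring
        _ ≤ C / R * bB ^ 2 * (2 * (ε * R / (64 * C * bB ^ 2))) * ℓ := by
            have : ℓ ≤ 2 * (ε * R / (64 * C * bB ^ 2)) :=
              h4.trans (mul_le_mul_of_nonneg_left (min_le_right _ _) two_pos.le)
            gcongr
        _ = ε / 32 * ℓ := by field_simp; norm_num
    have h6 : C₁ * (κ' * ℓ) ≤ ε / 32 * ℓ := by
      calc C₁ * (κ' * ℓ) = κ * (C₁ * (Gn / β)) * ℓ := by rw [hκ']; ring
        _ ≤ _ := mul_le_mul_of_nonneg_right hκ2 hℓ.le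
    have h7 : Λ * (2 * (bB * (κ' * ℓ))) ≤ ε / 32 * ℓ := by
      calc Λ * (2 * (bB * (κ' * ℓ))) = κ * (2 * Λ * bB * (Gn / β)) * ℓ := by rw [hκ']; ring
        _ ≤ _ := mul_le_mul_of_nonneg_right hκ3 hℓ.le
    have h8 := mul_le_mul_of_nonneg_left h3 hΛ.le
    have h9 : k ≤ inner ℝ q d + Λ * ‖B d‖ + C / R * ‖B d‖ ^ 2 := hcone
    have h10 : 0 < ε * ℓ := by positivity
    rw [h1] at h9
    linarith
  · intro z hz hzy m hmΛ hmM
    have hw : 0 < ‖B (z - y)‖ := lt_of_lt_of_le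
      (mul_pos hc (norm_pos_iff.2 (sub_ne_zero.2 hzy))) (hB _)
    set u := ‖B (z - y)‖⁻¹ • (z - y) with hu
    have hBu : ‖B u‖ = 1 := by
      rw [hu, map_smul, norm_smul, norm_inv, norm_norm, inv_mul_cancel₀ hw.ne']
    have hPeq : q + m • (‖B (z - y)‖⁻¹ • B.adjoint (B (z - y))) = q + m • B.adjoint (B u) := by
      rw [hu, map_smul, map_smul]
    rw [hPeq]
    have hm0 : 0 < m := hΛ.trans_le hmΛ
    set P := q + m • B.adjoint (B u) with hP
    have hqu : inner ℝ q₀ u = ‖B (z - y)‖⁻¹ * inner ℝ q₀ (z - y) := by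
      rw [hu, inner_smul_right]
    have hPγ : inner ℝ (γ x₀) P = g x₀ + η / 2 + m * inner ℝ q₀ u := by
      rw [hP, hq, inner_add_right, inner_sub_right, hpγ, inner_smul_right, inner_smul_right,
        ContinuousLinearMap.adjoint_inner_right, ContinuousLinearMap.adjoint_inner_right,
        real_inner_comm, hBγ, real_inner_comm (B u), hBγ, he, inner_smul_right, hqd']
      ring
    have hsm : m * (‖B (z - y)‖⁻¹ * (κ * ‖z - y‖)) ≤ η / 8 := by
      have h1 : ‖B (z - y)‖⁻¹ * (κ * ‖z - y‖) ≤ κ / c := by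
        rw [inv_mul_le_iff₀ hw]
        calc κ * ‖z - y‖ = κ / c * (c * ‖z - y‖) := by field_simp
          _ ≤ κ / c * ‖B (z - y)‖ := mul_le_mul_of_nonneg_left (hB _) (by positivity)
          _ = _ := by ring
      calc m * (‖B (z - y)‖⁻¹ * (κ * ‖z - y‖)) ≤ M * (κ / c) :=
            mul_le_mul hmM h1 (by positivity) hM.le
        _ = κ * (M / c) := by ring
        _ ≤ _ := hκ4
    have hfz := hfr₂ z ⟨hz.1, ball_subset_ball hR2.le hz.2⟩ y hy2
    constructor
    · by_contra! hle
      have hPR := hbound z hz.1 P hle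
      -- Here `y` being a boundary point matters: no point of the closure lies far outward from it,
      -- so the oblique component stays below `g x₀ + η`.
      have hup : m * inner ℝ q₀ u ≤ η / 8 := by
        rw [hqu]
        refine le_trans ?_ hsm
        have := hfz.2 hy.1
        gcongr
      have hPU := hUth (husc₁ z ⟨hz.1, ball_subset_ball hR1.le hz.2⟩ P hle (by
        rw [hPγ]; linarith))
      have hdiff : m • B.adjoint (B u) - Λ • B.adjoint (B e) = P - p := by
        rw [hP, hq]; abel
      have h1 := hell m hmΛ e u hBe hBu (by
        rw [hdiff]
        exact (norm_sub_le _ _).trans (add_le_add hPR hpn))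
      rw [hdiff] at h1
      -- By `hcon`, `P · d` lies below `k - (ε / 2) ℓ`, well under `p · d' = k - (ε / 4) ℓ`; the
      -- large ellipsoid does not allow `P` so far below its supporting hyperplane at `p`.
      have h2 := hcon (P + (ε / 2 / ℓ) • d) (thick_thick_subset (ε := ε / 2) (ε' := ε / 2)
        ⟨P, hPU, by
          rw [add_sub_cancel_left, norm_smul, Real.norm_of_nonneg (by positivity), ← hℓ_def,
            div_mul_cancel₀ _ hℓ.ne']⟩ |> (thick_mono (by linarith) subset_rfl ·))
      have h3 : inner ℝ (P + (ε / 2 / ℓ) • d) d = inner ℝ P d + ε / 2 * ℓ := by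
        rw [inner_add_left, inner_smul_left, real_inner_self_eq_norm_sq, ← hℓ_def, conj_trivial]
        field_simp
      rw [h3] at h2
      have h4 : inner ℝ P d' ≤ inner ℝ P d + ε / 16 * ℓ := by
        have h5 : inner ℝ P d' = inner ℝ P d - inner ℝ P (d - d') := by
          rw [inner_sub_right P d d']; ring
        have h6 := neg_le_of_abs_le (abs_real_inner_le_norm P (d - d'))
        have h7 : ‖P‖ * ‖d - d'‖ ≤ RH * (κ' * ℓ) := mul_le_mul hPR hdd' (norm_nonneg _) hRH.le
        have h8 : RH * (κ' * ℓ) = κ * (RH * (Gn / β)) * ℓ := by rw [hκ']; ring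
        have h9 := mul_le_mul_of_nonneg_right hκ1 hℓ.le
        linarith
      have h5 : inner ℝ (P - p) d' ≤ -(ε / 8 * ℓ) := by
        have : 0 < ε * ℓ := by positivity
        rw [inner_sub_left, hpd']
        linarith
      have h6 : inner ℝ (P - p) e = ‖B d'‖⁻¹ * inner ℝ (P - p) d' := by
        rw [he, inner_smul_right]
      have h7 : ‖B d'‖ ≤ bB * (2 * ℓ) :=
        (hBle _).trans (mul_le_mul_of_nonneg_left hd'2 hbB.le)
      have h8 : ε / (16 * bB) ≤ ‖B d'‖⁻¹ * (ε / 8 * ℓ) := by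
        rw [← div_eq_inv_mul, div_le_div_iff₀ (by positivity) hBd']
        have := mul_le_mul_of_nonneg_left h7 hε.le
        linarith
      have h9 : ‖B d'‖⁻¹ * inner ℝ (P - p) d' ≤ ‖B d'‖⁻¹ * (-(ε / 8 * ℓ)) :=
        mul_le_mul_of_nonneg_left h5 (by positivity)
      rw [h6] at h1
      linarith
    · intro hzΓ
      have hlow : -(η / 8) ≤ m * inner ℝ q₀ u := by
        rw [hqu]
        have h1 := hfz.1 hzΓ
        have h2 : m * (‖B (z - y)‖⁻¹ * (-(κ * ‖z - y‖))) ≤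
            m * (‖B (z - y)‖⁻¹ * inner ℝ q₀ (z - y)) := by gcongr
        linarith
      obtain ⟨h2, h3⟩ := hdata z ⟨hzΓ, ball_subset_ball hR3.le hz.2⟩
      have h4 := h3 P (by
        refine (norm_add_le _ _).trans (add_le_add hqn ?_)
        rw [norm_smul, Real.norm_of_nonneg hm0.le]
        exact mul_le_mul hmM (hadj u hBu) (norm_nonneg _) hM.le)
      have h5 := (abs_le.1 h2).2
      have h6 := (abs_le.1 h4).1
      linarith

end

/-! ### Slope bounds on the whole closure, by chaining along segments. -/

section

variable {Ω : Set 𝔼[n]} {H : 𝔼[n] → 𝔼[n] → ℝ} {γ : 𝔼[n] → 𝔼[n]} {g : 𝔼[n] → ℝ} {a b : ℝ}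
  {v : 𝔼[n] → ℝ}

theorem exists_max_inner {C : Set 𝔼[n]} (hC : IsCompact C) (hne : C.Nonempty) (d : 𝔼[n]) :
    ∃ p ∈ C, ∀ p' ∈ C, inner ℝ p' d ≤ inner ℝ p d := by
  obtain ⟨p, hp, hmax⟩ := hC.exists_isMaxOn hne
    (f := fun p => inner ℝ p d) (by fun_prop)
  exact ⟨p, hp, fun p' hp' => hmax hp'⟩

theorem SlopesIn.exists_lipschitz {S C : Set 𝔼[n]} (h : SlopesIn S C v) (hC : IsCompact C) :
    ∃ M > 0, ∀ x ∈ S, ∀ y ∈ S, |v x - v y| ≤ M * ‖x - y‖ := by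
  obtain ⟨M, hM⟩ := hC.isBounded.exists_norm_le
  have key : ∀ x ∈ S, ∀ y ∈ S, v x - v y ≤ max M 1 * ‖x - y‖ := fun x hx y hy => by
    obtain ⟨p, hp, hxy⟩ := h x hx y hy
    refine hxy.trans ((real_inner_le_norm _ _).trans ?_)
    exact mul_le_mul_of_nonneg_right ((hM p hp).trans (le_max_left _ _)) (norm_nonneg _)
  refine ⟨max M 1, by positivity, fun x hx y hy => ?_⟩
  rw [abs_le]
  have h1 := key x hx y hy
  have h2 := key y hy x hx
  rw [norm_sub_rev] at h2
  constructor <;> linarith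

/-- Slope bounds chain along segments. -/
theorem slope_bound_of_segment {C : Set 𝔼[n]} (hC : IsCompact C) {x y : 𝔼[n]}
    (h : ∀ z ∈ segment ℝ y x, ∃ r > 0, SlopesIn (ball z r) C v) :
    ∃ p ∈ C, v x - v y ≤ inner ℝ p (x - y) := by
  have hne : C.Nonempty := by
    obtain ⟨r, hr, hs⟩ := h y (left_mem_segment ℝ y x)
    obtain ⟨p, hp, -⟩ := hs y (mem_ball_self hr) y (mem_ball_self hr)
    exact ⟨p, hp⟩
  obtain ⟨p, hp, hmax⟩ := exists_max_inner hC hne (x - y)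
  refine ⟨p, hp, ?_⟩
  set d := x - y
  set k := inner ℝ p d
  set γ : ℝ → 𝔼[n] := fun t => y + t • d with hγ
  have hγc : Continuous γ := by simp only [γ]; fun_prop
  have hseg : ∀ t ∈ Icc (0 : ℝ) 1, γ t ∈ segment ℝ y x := fun t ht => by
    rw [segment_eq_image']
    exact ⟨t, ht, rfl⟩
  have hcont : ContinuousOn (fun t => v (γ t)) (Icc 0 1) := by
    intro t ht
    obtain ⟨r, hr, hs⟩ := h _ (hseg t ht)
    obtain ⟨M, hM, hLip⟩ := hs.exists_lipschitz hC
    have hv : ContinuousAt v (γ t) := by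
      rw [ContinuousAt, tendsto_iff_dist_tendsto_zero]
      have h1 : Tendsto (fun z => M * ‖z - γ t‖) (𝓝 (γ t)) (𝓝 0) := by
        have : Continuous fun z => M * ‖z - γ t‖ := by fun_prop
        simpa using this.tendsto (γ t)
      refine squeeze_zero' (Eventually.of_forall fun _ => dist_nonneg) ?_ h1
      filter_upwards [ball_mem_nhds _ hr] with z hz
      exact hLip z hz _ (mem_ball_self hr)
    exact (ContinuousAt.comp (f := γ) hv hγc.continuousAt).continuousWithinAt
  -- The maximizing slope `p` bounds every right difference quotient in the limit by `k`. The growth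
  -- lemma wants a strictly larger derivative, hence `η`.
  have key : ∀ η > 0, v (γ 1) ≤ v (γ 0) + (k + η) * 1 := by
    intro η hη
    refine image_le_of_liminf_slope_right_lt_deriv_boundary (f := fun t => v (γ t))
      (f' := fun _ => k) hcont ?_ (B := fun t => v (γ 0) + (k + η) * t) (B' := fun _ => k + η)
      (by simp) (fun t => ?_) (fun t _ _ => by linarith) ⟨zero_le_one, le_rfl⟩
    · intro t ht s hs
      obtain ⟨r, hr, hsl⟩ := h _ (hseg t ⟨ht.1, ht.2.le⟩)
      refine Eventually.frequently ?_
      filter_upwards [self_mem_nhdsWithin,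
        mem_nhdsWithin_of_mem_nhds (hγc.continuousAt (ball_mem_nhds (γ t) hr))] with t' htt' hb
      have htt : 0 < t' - t := sub_pos.2 htt'
      obtain ⟨p', hp', hle⟩ := hsl _ hb _ (mem_ball_self hr)
      have e1 : γ t' - γ t = (t' - t) • d := by simp only [γ]; module
      rw [e1, inner_smul_right] at hle
      refine lt_of_le_of_lt ?_ hs
      rw [slope_def_field, div_le_iff₀ htt]
      have := mul_le_mul_of_nonneg_left (hmax p' hp') htt.le
      linarith
    · have := ((hasDerivAt_id t).const_mul (k + η)).const_add (v (γ 0))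
      simpa using! this
  have e1 : γ 1 = x := by simp [γ, d]
  have e0 : γ 0 = y := by simp [γ]
  rw [e1, e0] at key
  have := le_of_forall_pos_le_add (a := v x) (b := v y + k) fun η hη => by
    have := key η hη; linarith
  linarith

/-- Subsolutions satisfy the slope bound up to the boundary. -/
theorem Admissible.exists_closure_slopes (h : Admissible Ω H γ g) (a : ℝ) {x₀ : 𝔼[n]}
    (hx₀ : x₀ ∈ frontier Ω) {ε : ℝ} (hε : 0 < ε) :
    ∃ r > 0, ∀ v, UpperSemicontinuousOn v (closure Ω) → IsSubsolution Ω H γ g a v →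
      SlopesIn (closure Ω ∩ ball x₀ r) (thick ε (sublevel H a x₀)) v := by
  have hx₀c := frontier_mem_closure hx₀
  obtain ⟨r₀, hr₀, L, hL, hLip⟩ := h.exists_lipschitz a hx₀c
  obtain ⟨U, hU, hZU, hUth⟩ := exists_isOpen_subset_thick (by positivity : 0 < ε / 4)
    (C := sublevel H a x₀)
  obtain ⟨r₁, hr₁, husc₁⟩ := h.sublevel_usc hU hZU
  obtain ⟨ρ, hρ⟩ := h.hasC1Boundary x₀ hx₀
  set q := gradient ρ x₀
  have hq : 0 < ‖q‖ := norm_pos_iff.2 hρ.gradient_ne_zero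
  -- The segment is pushed into the domain by `s q` with `s = τ ‖d‖`. Moving both endpoints costs `2
  -- L s ‖q‖ = (ε / 2) ‖d‖`; `κ`, which limits how far the segment can leave the domain, is then
  -- taken small against `τ`.
  set τ := ε / (4 * L * ‖q‖) with hτ
  have hτ0 : 0 < τ := by positivity
  set κ := τ * ‖q‖ ^ 2 / (2 * (1 + τ * ‖q‖)) with hκ
  have hκ0 : 0 < κ := by positivity
  have hκτ : κ * (1 + τ * ‖q‖) < τ * ‖q‖ ^ 2 := by
    have h1 : κ * (1 + τ * ‖q‖) = τ * ‖q‖ ^ 2 / 2 := by rw [hκ]; field_simp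
    rw [h1]
    have : 0 < τ * ‖q‖ ^ 2 := by positivity
    linarith
  obtain ⟨r₂, hr₂, hch, hest⟩ := hρ.exists_chart h.isOpen hκ0
  set R := min r₀ (min r₁ r₂)
  have hR : 0 < R := by positivity
  have hR0 : R ≤ r₀ := min_le_left _ _
  have hR1 : R ≤ r₁ := (min_le_right _ _).trans (min_le_left _ _)
  have hR2 : R ≤ r₂ := (min_le_right _ _).trans (min_le_right _ _)
  set r := R / (1 + 2 * (τ * ‖q‖))
  have hr : 0 < r := by positivity
  have hrR : r * (1 + 2 * (τ * ‖q‖)) = R := div_mul_cancel₀ _ (by positivity)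
  have hrR' : r ≤ R := by nlinarith [mul_pos hr (mul_pos hτ0 hq)]
  refine ⟨r, hr, fun v husc hv x hx y hy => ?_⟩
  by_cases hxy : x = y
  · subst hxy
    obtain ⟨p, hp⟩ := h.obliqueSublevel_nonempty hv husc hx₀
    exact ⟨p, subset_thick hε.le hp.1, by simp⟩
  set d := x - y with hd
  have hℓ : 0 < ‖d‖ := norm_pos_iff.2 (sub_ne_zero.2 hxy)
  set s := τ * ‖d‖ with hs
  have hs0 : 0 < s := by positivity
  have hd2 : ‖d‖ ≤ 2 * r := by
    rw [hd, ← dist_eq_norm]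
    have h1 := dist_triangle_right x y x₀
    have h2 : dist x x₀ < r := hx.2
    have h3 : dist y x₀ < r := hy.2
    linarith
  have hshift : ∀ z ∈ ball x₀ r, z - s • q ∈ ball x₀ R := fun z hz => by
    rw [mem_ball, dist_eq_norm] at hz ⊢
    have e1 : z - s • q - x₀ = (z - x₀) - s • q := by abel
    rw [e1]
    refine (norm_sub_le _ _).trans_lt ?_
    rw [norm_smul, Real.norm_of_nonneg hs0.le]
    have h1 : s * ‖q‖ ≤ τ * (2 * r) * ‖q‖ := by
      rw [hs]; gcongr
    linarith
  -- the shifted segment lies in the domain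
  have hsegΩ : ∀ t ∈ Icc (0 : ℝ) 1, y + t • d ∈ ball x₀ r ∧ y + t • d - s • q ∈ Ω := by
    intro t ht
    set z := y + t • d with hz
    have hzr : z ∈ ball x₀ r := (convex_ball x₀ r).add_smul_sub_mem hy.2 hx.2 ht
    refine ⟨hzr, ?_⟩
    have hB : ∀ w ∈ ball x₀ r, w ∈ ball x₀ r₂ := fun w hw =>
      ball_subset_ball (hrR'.trans hR2) hw
    have hz2 : z - s • q ∈ ball x₀ r₂ := ball_subset_ball hR2 (hshift z hzr)
    rw [(hch _ hz2).2.1]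
    have h1 := (abs_le.1 (hest z (hB z hzr) y (hB y hy.2))).2
    have h2 := (abs_le.1 (hest z (hB z hzr) x (hB x hx.2))).2
    have h3 := (abs_le.1 (hest _ hz2 z (hB z hzr))).2
    have e1 : z - y = t • d := by rw [hz]; abel
    have e2 : z - x = -((1 - t) • d) := by rw [hz, hd]; module
    have e3 : z - s • q - z = -(s • q) := by abel
    rw [e1, inner_smul_right, norm_smul, Real.norm_of_nonneg ht.1] at h1
    rw [e2, inner_neg_right, inner_smul_right, norm_neg, norm_smul,
      Real.norm_of_nonneg (sub_nonneg.2 ht.2)] at h2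
    rw [e3, inner_neg_right, inner_smul_right, real_inner_self_eq_norm_sq, norm_neg, norm_smul,
      Real.norm_of_nonneg hs0.le] at h3
    have hρx := (hch x (hB x hx.2)).2.2.1 hx.1
    have hρy := (hch y (hB y hy.2)).2.2.1 hy.1
    -- Averaging the affine estimates from the two endpoints with weights `1 - t` and `t` cancels
    -- the linear terms.
    have h4 : ρ z ≤ κ * ‖d‖ := by
      have h5 : (1 - t) * ρ z ≤ (1 - t) * (t * inner ℝ q d + κ * (t * ‖d‖)) :=
        mul_le_mul_of_nonneg_left (by linarith) (sub_nonneg.2 ht.2)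
      have h6 : t * ρ z ≤ t * (-((1 - t) * inner ℝ q d) + κ * ((1 - t) * ‖d‖)) :=
        mul_le_mul_of_nonneg_left (by linarith) ht.1
      have h7 : ρ z ≤ 2 * (t * (1 - t)) * (κ * ‖d‖) := by linarith
      have h8 : 2 * (t * (1 - t)) ≤ 1 := by nlinarith [sq_nonneg (t - 1 / 2)]
      have h9 : 2 * (t * (1 - t)) * (κ * ‖d‖) ≤ 1 * (κ * ‖d‖) :=
        mul_le_mul_of_nonneg_right h8 (by positivity)
      linarith
    have h5 : κ * (1 + τ * ‖q‖) * ‖d‖ < τ * ‖q‖ ^ 2 * ‖d‖ := mul_lt_mul_of_pos_right hκτ hℓ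
    have h6 : κ * (s * ‖q‖) = κ * (τ * ‖q‖) * ‖d‖ := by rw [hs]; ring
    have h7 : s * ‖q‖ ^ 2 = τ * ‖q‖ ^ 2 * ‖d‖ := by rw [hs]; ring
    linarith
  set x' := x - s • q with hx'
  set y' := y - s • q with hy'
  have exy : x' - y' = d := by rw [hx', hy', hd]; abel
  obtain ⟨p, hp, hpd⟩ := slope_bound_of_segment (v := v) (x := x') (y := y')
    (isCompact_thick (ε := ε / 2) (h.isCompact_sublevel (a := a) hx₀c)) (by
      intro z hz
      rw [segment_eq_image', exy] at hz
      obtain ⟨t, ht, rfl⟩ := hz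
      have e1 : y' + t • d = y + t • d - s • q := by rw [hy']; abel
      simp only [e1]
      obtain ⟨h1, h2⟩ := hsegΩ t ht
      set z := y + t • d - s • q
      obtain ⟨r', hr', hsl⟩ := h.exists_interior_slopes a h2 (by positivity : 0 < ε / 4)
      obtain ⟨r'', hr'', hball⟩ := Metric.isOpen_iff.1 h.isOpen z h2
      refine ⟨min r' r'', lt_min hr' hr'', (hsl v husc hv).mono (fun w hw =>
        ⟨subset_closure (hball (ball_subset_ball (min_le_right _ _) hw)),
          ball_subset_ball (min_le_left _ _) hw⟩) ?_⟩
      have h3 : sublevel H a z ⊆ thick (ε / 4) (sublevel H a x₀) :=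
        (husc₁ z ⟨subset_closure h2, ball_subset_ball hR1 (hshift _ h1)⟩).trans hUth
      exact ((thick_mono le_rfl h3).trans thick_thick_subset).trans
        (thick_mono (by linarith) subset_rfl))
  rw [exy] at hpd
  have hxΩ : x' ∈ Ω := by
    have := (hsegΩ 1 ⟨zero_le_one, le_rfl⟩).2
    rwa [one_smul, hd, add_sub_cancel] at this
  have hyΩ : y' ∈ Ω := by
    have := (hsegΩ 0 ⟨le_rfl, zero_le_one⟩).2
    rwa [zero_smul, add_zero] at this
  have hx0 : x ∈ closure Ω ∩ ball x₀ r₀ := ⟨hx.1, ball_subset_ball (hrR'.trans hR0) hx.2⟩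
  have hy0 : y ∈ closure Ω ∩ ball x₀ r₀ := ⟨hy.1, ball_subset_ball (hrR'.trans hR0) hy.2⟩
  have hx'0 : x' ∈ closure Ω ∩ ball x₀ r₀ :=
    ⟨subset_closure hxΩ, ball_subset_ball hR0 (hshift x hx.2)⟩
  have hy'0 : y' ∈ closure Ω ∩ ball x₀ r₀ :=
    ⟨subset_closure hyΩ, ball_subset_ball hR0 (hshift y hy.2)⟩
  have h1 := hLip v husc hv x hx0 x' hx'0
  have h2 := hLip v husc hv y' hy'0 y hy0
  have e1 : x - x' = s • q := by rw [hx']; abel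
  have e2 : y' - y = -(s • q) := by rw [hy']; abel
  rw [e1, norm_smul, Real.norm_of_nonneg hs0.le] at h1
  rw [e2, norm_neg, norm_smul, Real.norm_of_nonneg hs0.le] at h2
  have h3 : L * (s * ‖q‖) = ε / 4 * ‖d‖ := by rw [hs, hτ]; field_simp
  refine ⟨p + (ε / 2 / ‖d‖) • d, thick_mono (by linarith) subset_rfl
    (thick_thick_subset (ε := ε / 2) (ε' := ε / 2) ⟨p, hp, ?_⟩), ?_⟩
  · rw [add_sub_cancel_left, norm_smul, Real.norm_of_nonneg (by positivity),
      div_mul_cancel₀ _ hℓ.ne']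
  · have h4 : inner ℝ (p + (ε / 2 / ‖d‖) • d) d = inner ℝ p d + ε / 2 * ‖d‖ := by
      rw [inner_add_left, inner_smul_left, real_inner_self_eq_norm_sq, conj_trivial]
      field_simp
    rw [h4]
    linarith

/-- `v` satisfies, asymptotically at `x`, the slope bounds of a subsolution at level `a` with
oblique datum `b`. -/
def HasSlopesAt (Ω : Set 𝔼[n]) (H : 𝔼[n] → 𝔼[n] → ℝ) (γ : 𝔼[n] → 𝔼[n]) (a b : ℝ) (x : 𝔼[n])
    (v : 𝔼[n] → ℝ) : Prop :=
  ∀ ε > 0, ∃ r > 0, SlopesIn (closure Ω ∩ ball x r) (thick ε (sublevel H a x)) v ∧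
    SlopesIn (frontier Ω ∩ ball x r) (thick ε (obliqueSublevel H γ a b x)) v

/-- Subsolutions satisfy the slope bounds, locally uniformly. -/
theorem Admissible.exists_slopes (h : Admissible Ω H γ g) (a : ℝ) {x : 𝔼[n]}
    (hx : x ∈ closure Ω) {ε : ℝ} (hε : 0 < ε) :
    ∃ r > 0, ∀ v, UpperSemicontinuousOn v (closure Ω) → IsSubsolution Ω H γ g a v →
      SlopesIn (closure Ω ∩ ball x r) (thick ε (sublevel H a x)) v ∧
      SlopesIn (frontier Ω ∩ ball x r) (thick ε (obliqueSublevel H γ a (g x) x)) v := by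
  rcases h.mem_or hx with hΩ | hΓ
  · obtain ⟨r, hr, hs⟩ := h.exists_interior_slopes a hΩ hε
    obtain ⟨r', hr', hball⟩ := Metric.isOpen_iff.1 h.isOpen x hΩ
    refine ⟨min r r', lt_min hr hr', fun v h1 h2 => ⟨(hs v h1 h2).mono
      (inter_subset_inter_right _ (ball_subset_ball (min_le_left _ _))) subset_rfl, ?_⟩⟩
    intro z hz
    exact absurd (hball (ball_subset_ball (min_le_right _ _) hz.2)) (h.notMem hz.1)
  · obtain ⟨r, hr, hs⟩ := h.exists_closure_slopes a hΓ hε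
    obtain ⟨r', hr', hs'⟩ := h.exists_boundary_slopes a hΓ hε
    exact ⟨min r r', lt_min hr hr', fun v h1 h2 => ⟨(hs v h1 h2).mono
      (inter_subset_inter_right _ (ball_subset_ball (min_le_left _ _))) subset_rfl,
      (hs' v h1 h2).mono (inter_subset_inter_right _ (ball_subset_ball (min_le_right _ _)))
        subset_rfl⟩⟩

theorem IsSubsolution.hasSlopesAt (h : Admissible Ω H γ g) (hv : IsSubsolution Ω H γ g a v)
    (husc : UpperSemicontinuousOn v (closure Ω)) {x : 𝔼[n]} (hx : x ∈ closure Ω) :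
    HasSlopesAt Ω H γ a (g x) x v := fun _ hε =>
  let ⟨r, hr, hs⟩ := h.exists_slopes a hx hε
  ⟨r, hr, hs v husc hv⟩

end

section

variable {Ω : Set 𝔼[n]} {H : 𝔼[n] → 𝔼[n] → ℝ} {γ : 𝔼[n] → 𝔼[n]} {g : 𝔼[n] → ℝ} {a b : ℝ}
  {v : 𝔼[n] → ℝ}

/-! ### From slope bounds to test functions -/

theorem exists_pos_mul_le_of_pos {X Y : ℝ} (hX : 0 ≤ X) (hY : 0 < Y) : ∃ κ > 0, κ * X ≤ Y :=
  let ⟨κ, hκ, hs⟩ := exists_pos_mul_le {()} (fun _ => X) (fun _ => Y) (fun _ => hX) fun _ => hY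
  ⟨κ, hκ, hs () (Finset.mem_singleton_self _)⟩

theorem exists_inner_rep (f : StrongDual ℝ 𝔼[n]) : ∃ e : 𝔼[n], ∀ w, f w = inner ℝ w e :=
  ⟨(InnerProductSpace.toDual ℝ 𝔼[n]).symm f, fun w => by
    rw [real_inner_comm, InnerProductSpace.toDual_symm_apply]⟩

theorem mem_of_forall_inner_le {C : Set 𝔼[n]} (hC : IsCompact C) (hconv : Convex ℝ C) {p : 𝔼[n]}
    (h : ∀ e : 𝔼[n], ∃ c ∈ C, inner ℝ p e ≤ inner ℝ c e) : p ∈ C := by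
  by_contra hp
  obtain ⟨f, u, h1, h2⟩ := geometric_hahn_banach_closed_point hconv hC.isClosed hp
  obtain ⟨e, he⟩ := exists_inner_rep f
  obtain ⟨c, hc, hce⟩ := h e
  have := h1 c hc
  rw [he] at this h2
  linarith

/-- Otherwise a functional strictly separates `C` from the line through `p` along `q`. Being bounded
below on the line, it vanishes on `q`, so it is one of the directions covered by `h`. -/
theorem exists_add_smul_mem {C : Set 𝔼[n]} (hC : IsCompact C) (hconv : Convex ℝ C) {p q : 𝔼[n]}
    (hq : q ≠ 0) (h : ∀ e : 𝔼[n], inner ℝ q e = 0 → ∃ c ∈ C, inner ℝ p e ≤ inner ℝ c e) :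
    ∃ t : ℝ, p + t • q ∈ C := by
  by_contra! hcon
  have hcl : IsClosed (range fun t : ℝ => p + t • q) :=
    ((Homeomorph.addLeft p).isClosedEmbedding.comp (isClosedEmbedding_smul_left hq)).isClosed_range
  have hcv : Convex ℝ (range fun t : ℝ => p + t • q) := by
    rintro _ ⟨s, rfl⟩ _ ⟨t, rfl⟩ α β _ _ hαβ
    refine ⟨α * s + β * t, ?_⟩
    obtain rfl : α = 1 - β := by linarith
    simp only
    module
  obtain ⟨f, u, w, h1, h2, h3⟩ := geometric_hahn_banach_compact_closed hconv hC hcv hcl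
    (disjoint_left.2 fun c hc ⟨t, ht⟩ => hcon t (by simp only at ht; rwa [ht]))
  obtain ⟨e, he⟩ := exists_inner_rep f
  have h4 : ∀ t : ℝ, w < inner ℝ p e + t * inner ℝ q e := fun t => by
    have := h3 _ ⟨t, rfl⟩
    rwa [he, inner_add_left, inner_smul_left, conj_trivial] at this
  have hqe : inner ℝ q e = 0 := by
    by_contra hne
    have := h4 ((w - inner ℝ p e) / inner ℝ q e)
    rw [div_mul_cancel₀ _ hne] at this
    linarith
  obtain ⟨c, hc, hce⟩ := h e hqe
  have h5 := h1 c hc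
  have h6 := h4 0
  rw [he] at h5
  linarith

/-- Separation of `C` from a ray only makes the functional nonnegative on `q`; adding a small
multiple of `q` makes it positive without losing the strict gap. -/
theorem exists_add_nonneg_smul_mem {C : Set 𝔼[n]} (hC : IsCompact C) (hconv : Convex ℝ C)
    {p q : 𝔼[n]} (hq : q ≠ 0)
    (h : ∀ e : 𝔼[n], 0 < inner ℝ q e → ∃ c ∈ C, inner ℝ p e ≤ inner ℝ c e) :
    ∃ t : ℝ, 0 ≤ t ∧ p + t • q ∈ C := by
  by_contra! hcon
  have hcl : IsClosed ((fun t : ℝ => p + t • q) '' Ici 0) :=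
    ((Homeomorph.addLeft p).isClosedEmbedding.comp
      (isClosedEmbedding_smul_left hq)).isClosedMap _ isClosed_Ici
  have hcv : Convex ℝ ((fun t : ℝ => p + t • q) '' Ici 0) := by
    rintro _ ⟨s, hs, rfl⟩ _ ⟨t, ht, rfl⟩ α β hα hβ hαβ
    have hs' : 0 ≤ s := hs
    have ht' : 0 ≤ t := ht
    refine ⟨α * s + β * t, mem_Ici.2 (by positivity), ?_⟩
    obtain rfl : α = 1 - β := by linarith
    simp only
    module
  obtain ⟨f, u, w, h1, h2, h3⟩ := geometric_hahn_banach_compact_closed hconv hC hcv hcl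
    (disjoint_left.2 fun c hc ⟨t, ht0, ht⟩ => hcon t ht0 (by simp only at ht; rwa [ht]))
  obtain ⟨e, he⟩ := exists_inner_rep f
  have h4 : ∀ t : ℝ, 0 ≤ t → w < inner ℝ p e + t * inner ℝ q e := fun t ht => by
    have := h3 _ ⟨t, ht, rfl⟩
    rwa [he, inner_add_left, inner_smul_left, conj_trivial] at this
  have h40 := h4 0 le_rfl
  rw [zero_mul, add_zero] at h40
  have hqe : 0 ≤ inner ℝ q e := by
    by_contra! hne
    have := h4 ((w - inner ℝ p e) / inner ℝ q e) (div_nonneg_of_nonpos (by linarith) hne.le)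
    rw [div_mul_cancel₀ _ hne.ne] at this
    linarith
  obtain ⟨M, hM⟩ := hC.isBounded.exists_norm_le
  obtain ⟨η, hη, hηs⟩ := exists_pos_mul_le_of_pos (X := (|M| + ‖p‖) * ‖q‖) (Y := w - u)
    (by positivity) (by linarith)
  have hqq : 0 < ‖q‖ := norm_pos_iff.2 hq
  obtain ⟨c, hc, hce⟩ := h (e + η • q) (by
    rw [inner_add_right, inner_smul_right, real_inner_self_eq_norm_sq]
    positivity)
  rw [inner_add_right, inner_smul_right, inner_add_right, inner_smul_right] at hce
  have h5 := h1 c hc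
  rw [he] at h5
  have h6 : inner ℝ c q ≤ |M| * ‖q‖ := (real_inner_le_norm _ _).trans
    (mul_le_mul_of_nonneg_right ((hM c hc).trans (le_abs_self M)) (norm_nonneg _))
  have h7 := neg_le_of_abs_le (abs_real_inner_le_norm p q)
  have h8 : η * (inner ℝ c q - inner ℝ p q) ≤ η * ((|M| + ‖p‖) * ‖q‖) :=
    mul_le_mul_of_nonneg_left (by linarith) hη.le
  linarith

/-- A touching gradient is dominated by the slopes in each direction tangent to `S`. -/
theorem SlopesIn.exists_inner_le {S C : Set 𝔼[n]} (hs : SlopesIn S C v) (hC : IsCompact C)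
    {z p e : 𝔼[n]} {ψ : 𝔼[n] → ℝ} (hz : z ∈ S) (hp : HasGradientAt ψ p z)
    (hmax : ∀ᶠ y in 𝓝[S] z, v y - ψ y ≤ v z - ψ z)
    (htan : ∀ κ > 0, ∃ h₀ > 0, ∀ h, 0 < h → h < h₀ → ∃ y ∈ S, ‖y - (z - h • e)‖ ≤ κ * h) :
    ∃ c ∈ C, inner ℝ p e ≤ inner ℝ c e := by
  have hne : C.Nonempty := by
    obtain ⟨c, hc, -⟩ := hs z hz z hz
    exact ⟨c, hc⟩
  obtain ⟨c₀, hc₀, hc₀max⟩ := exists_max_inner hC hne e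
  refine ⟨c₀, hc₀, ?_⟩
  by_contra! hlt
  obtain ⟨M, hM⟩ := hC.isBounded.exists_norm_le
  obtain ⟨κ, hκ, hκs⟩ := exists_pos_mul_le_of_pos
    (X := |M| + ‖p‖ + (‖e‖ + 1)) (Y := (inner ℝ p e - inner ℝ c₀ e) / 2)
    (by positivity) (by linarith)
  wlog hκ1 : κ ≤ 1 generalizing κ
  · refine this 1 one_pos ?_ le_rfl
    refine le_trans ?_ hκs
    exact mul_le_mul_of_nonneg_right (not_le.1 hκ1).le (by positivity)
  -- For `y` near `z - h e`, touching gives `v z - v y ≥ h p · e` up to a small error, while the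
  -- slopes allow at most `h c₀ · e`; `κ` keeps the errors below the gap.
  obtain ⟨h₀, hh₀, htan'⟩ := htan κ hκ
  have hd : ∀ᶠ y in 𝓝 z, |ψ y - ψ z - inner ℝ p (y - z)| ≤ κ * ‖y - z‖ := by
    have := (hasGradientAt_iff_isLittleO.1 hp).bound hκ
    filter_upwards [this] with y hy
    simpa using hy
  obtain ⟨r, hr, hball⟩ := Metric.eventually_nhds_iff_ball.1
    (hd.and (eventually_nhdsWithin_iff.1 hmax))
  set h := min (h₀ / 2) (r / (2 * (‖e‖ + 1))) with hh
  have hh0 : 0 < h := by positivity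
  obtain ⟨y, hyS, hy⟩ := htan' h hh0 ((min_le_left _ _).trans_lt (by linarith))
  set o := y - (z - h • e) with ho
  have hzy : z - y = h • e - o := by rw [ho]; abel
  have hyz : ‖y - z‖ ≤ h * (‖e‖ + 1) := by
    rw [norm_sub_rev, hzy]
    refine (norm_sub_le _ _).trans ?_
    rw [norm_smul, Real.norm_of_nonneg hh0.le]
    have : κ * h ≤ 1 * h := mul_le_mul_of_nonneg_right hκ1 hh0.le
    linarith
  have hyr : y ∈ ball z r := by
    rw [mem_ball, dist_eq_norm]
    refine hyz.trans_lt ?_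
    have h1 : h * (‖e‖ + 1) ≤ r / (2 * (‖e‖ + 1)) * (‖e‖ + 1) :=
      mul_le_mul_of_nonneg_right (min_le_right _ _) (by positivity)
    have h2 : r / (2 * (‖e‖ + 1)) * (‖e‖ + 1) = r / 2 := by field_simp
    linarith
  obtain ⟨h1, h2⟩ := hball y hyr
  have h3 := h2 hyS
  obtain ⟨c, hc, hle⟩ := hs z hz y hyS
  rw [hzy, inner_sub_right, inner_smul_right] at hle
  have h4 := (abs_le.1 h1).2
  have h5 : y - z = -(h • e - o) := by rw [← hzy]; abel
  have h6 : κ * ‖y - z‖ ≤ κ * (h * (‖e‖ + 1)) := mul_le_mul_of_nonneg_left hyz hκ.le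
  rw [h5, inner_neg_right, inner_sub_right, inner_smul_right, norm_neg] at h4
  rw [h5, norm_neg] at h6
  have h7 := neg_le_of_abs_le (abs_real_inner_le_norm c o)
  have h8 := real_inner_le_norm p o
  have h9 : ‖c‖ * ‖o‖ ≤ |M| * (κ * h) :=
    mul_le_mul ((hM c hc).trans (le_abs_self M)) hy (norm_nonneg _) (abs_nonneg _)
  have h10 : ‖p‖ * ‖o‖ ≤ ‖p‖ * (κ * h) := mul_le_mul_of_nonneg_left hy (norm_nonneg _)
  have h11 := mul_le_mul_of_nonneg_left (hc₀max c hc) hh0.le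
  have h12 := mul_le_mul_of_nonneg_right hκs hh0.le
  have h13 : 0 < (inner ℝ p e - inner ℝ c₀ e) * h := mul_pos (by linarith) hh0
  nlinarith

/-- Gradients of test functions touching from above a function with slope bounds. -/
theorem Admissible.gradient_of_slopesIn (h : Admissible Ω H γ g) {C₀ C₁ : Set 𝔼[n]} {x z p : 𝔼[n]}
    {r : ℝ} {ψ : 𝔼[n] → ℝ} (hC₀ : IsCompact C₀) (hC₁ : IsCompact C₁) (hv₀ : Convex ℝ C₀)
    (hv₁ : Convex ℝ C₁) (hsub : C₁ ⊆ C₀) (hs₀ : SlopesIn (closure Ω ∩ ball x r) C₀ v)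
    (hs₁ : SlopesIn (frontier Ω ∩ ball x r) C₁ v) (hz : z ∈ ball x r)
    (hp : HasGradientAt ψ p z) (hmax : ∀ᶠ y in 𝓝[closure Ω] z, v y - ψ y ≤ v z - ψ z) :
    (z ∈ Ω → p ∈ C₀) ∧ (z ∈ frontier Ω → p ∈ C₀ ∨
      ∃ q, 0 < inner ℝ q (γ z) ∧ ∃ t : ℝ, 0 ≤ t ∧ p + t • q ∈ C₁) := by
  have hline : ∀ e : 𝔼[n], Tendsto (fun t : ℝ => z - t • e) (𝓝 0) (𝓝 z) := fun e => by
    have : Tendsto (fun t : ℝ => z - t • e) (𝓝 0) (𝓝 (z - (0 : ℝ) • e)) :=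
      Continuous.tendsto (by fun_prop) 0
    simpa using this
  -- directions that enter the domain
  have henter : ∀ e : 𝔼[n], z ∈ closure Ω → (∀ᶠ t : ℝ in 𝓝[>] 0, z - t • e ∈ Ω) →
      ∃ c ∈ C₀, inner ℝ p e ≤ inner ℝ c e := by
    intro e hzc hev
    refine hs₀.exists_inner_le hC₀ ⟨hzc, hz⟩ hp
      (hmax.filter_mono (nhdsWithin_mono _ inter_subset_left)) fun κ hκ => ?_
    have h1 : ∀ᶠ t : ℝ in 𝓝[>] 0, z - t • e ∈ Ω ∧ z - t • e ∈ ball x r :=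
      hev.and (((hline e).mono_left nhdsWithin_le_nhds) (isOpen_ball.mem_nhds hz))
    obtain ⟨h₀, hh₀, hsub⟩ := (mem_nhdsGT_iff_exists_Ioo_subset).1 h1
    refine ⟨h₀, hh₀, fun t ht ht' => ⟨z - t • e, ?_, ?_⟩⟩
    · obtain ⟨h2, h3⟩ := hsub ⟨ht, ht'⟩
      exact ⟨subset_closure h2, h3⟩
    · rw [sub_self, norm_zero]; positivity
  constructor
  · intro hzΩ
    refine mem_of_forall_inner_le hC₀ hv₀ fun e => henter e (subset_closure hzΩ) ?_
    exact ((hline e).mono_left nhdsWithin_le_nhds) (h.isOpen.mem_nhds hzΩ)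
  · intro hzΓ
    have hzc := frontier_mem_closure hzΓ
    obtain ⟨ρ, hρ⟩ := h.hasC1Boundary z hzΓ
    have hβ := h.isOblique.inner_gradient_pos hzΓ hρ
    have hq0 := hρ.gradient_ne_zero
    set q := gradient ρ z
    -- Directions orthogonal to `q` can be followed along the frontier, where the smaller slope set
    -- `C₁` governs.
    obtain ⟨t₁, ht₁⟩ := exists_add_smul_mem hC₁ hv₁ (p := p) hq0 (fun e he => by
      refine hs₁.exists_inner_le hC₁ ⟨hzΓ, hz⟩ hp (hmax.filter_mono (nhdsWithin_mono _
        (inter_subset_left.trans frontier_subset_closure))) fun κ hκ => ?_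
      obtain ⟨h₀, hh₀, hfr⟩ := hρ.exists_frontier_near h.isOpen hzΓ he hκ
      have h0 : Tendsto (fun t : ℝ => ‖z - t • e - x‖ + κ * t) (𝓝 0) (𝓝 (‖z - x‖)) := by
        have : Tendsto (fun t : ℝ => ‖z - t • e - x‖ + κ * t) (𝓝 0)
            (𝓝 (‖z - (0 : ℝ) • e - x‖ + κ * 0)) := Continuous.tendsto (by fun_prop) 0
        simpa using this
      have h1 : ∀ᶠ t : ℝ in 𝓝[>] 0, ‖z - t • e - x‖ + κ * t < r :=
        (h0.mono_left nhdsWithin_le_nhds).eventually_lt_const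
          (by rw [← dist_eq_norm]; exact hz)
      obtain ⟨h₁, hh₁, hsub⟩ := (mem_nhdsGT_iff_exists_Ioo_subset).1 h1
      refine ⟨min h₀ h₁, lt_min hh₀ hh₁, fun t ht ht' => ?_⟩
      obtain ⟨y, hy, hyn⟩ := hfr t ht (ht'.trans_le (min_le_left _ _))
      refine ⟨y, ⟨hy, ?_⟩, hyn⟩
      rw [mem_ball, dist_eq_norm]
      have h2 : ‖z - t • e - x‖ + κ * t < r := hsub ⟨ht, ht'.trans_le (min_le_right _ _)⟩
      have h3 : y - x = (y - (z - t • e)) + (z - t • e - x) := by abel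
      rw [h3]
      exact (norm_add_le _ _).trans_lt (by linarith))
    -- For `t₁ < 0`, directions entering the domain give `p + t₂ q ∈ C₀` with `t₂ ≥ 0`; then `p`
    -- lies between two points of the convex set `C₀`.
    rcases le_or_gt 0 t₁ with ht0 | ht0
    · exact Or.inr ⟨q, hβ, t₁, ht0, ht₁⟩
    · left
      obtain ⟨t₂, ht₂0, ht₂⟩ := exists_add_nonneg_smul_mem hC₀ hv₀ (p := p) hq0 (fun e he => by
        refine henter e hzc ?_
        have hz0 : ρ z = 0 := by
          obtain ⟨r', hr', hch, -⟩ := hρ.exists_chart h.isOpen one_pos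
          exact ((hch z (mem_ball_self hr')).2.2.2).1 hzΓ
        have hder : HasDerivAt (fun t : ℝ => ρ (z - t • e)) (-inner ℝ q e) 0 := by
          have h1 : HasDerivAt (fun t : ℝ => z - t • e) (-e) 0 := by
            simpa using! ((hasDerivAt_id (0 : ℝ)).smul_const e).const_sub z
          have h2 : HasFDerivAt ρ (InnerProductSpace.toDual ℝ 𝔼[n] q) (z - (0 : ℝ) • e) := by
            rw [zero_smul, sub_zero]
            exact hasGradientAt_iff_hasFDerivAt.1 hρ.hasGradientAt
          have h3 := h2.comp_hasDerivAt 0 h1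
          simpa using! h3
        have h4 : ∀ᶠ t : ℝ in 𝓝[>] 0, ρ (z - t • e) < 0 := by
          have h5 := hder.hasDerivWithinAt (s := Ioi 0)
          rw [hasDerivWithinAt_iff_tendsto_slope' (by simp)] at h5
          filter_upwards [h5.eventually_lt_const (neg_lt_zero.2 he), self_mem_nhdsWithin]
            with t ht ht0
          have ht0' : 0 < t := ht0
          rw [slope_def_field, zero_smul, sub_zero, hz0, sub_zero, sub_zero] at ht
          exact (div_neg_iff.1 ht).resolve_left (fun hh => absurd ht0' (not_lt.2 hh.2.le)) |>.1
        filter_upwards [h4, ((hline e).mono_left nhdsWithin_le_nhds) hρ.eventually_mem_iff]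
          with t h5 h6
        exact h6.2 h5)
      have hden : 0 < t₂ - t₁ := by linarith
      have := hv₀ (hsub ht₁) ht₂ (a := t₂ / (t₂ - t₁)) (b := -t₁ / (t₂ - t₁)) (by positivity)
        (div_nonneg (by linarith) hden.le) (by field_simp; ring)
      convert this using 1
      have e1 : (t₂ / (t₂ - t₁)) + (-t₁ / (t₂ - t₁)) = 1 := by field_simp; ring
      have e2 : (t₂ / (t₂ - t₁)) * t₁ + (-t₁ / (t₂ - t₁)) * t₂ = 0 := by field_simp; ring
      calc p = ((t₂ / (t₂ - t₁)) + (-t₁ / (t₂ - t₁))) • p +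
            ((t₂ / (t₂ - t₁)) * t₁ + (-t₁ / (t₂ - t₁)) * t₂) • q := by
              rw [e1, e2, one_smul, zero_smul, add_zero]
        _ = _ := by module

theorem obliqueSublevel_subset {x : 𝔼[n]} : obliqueSublevel H γ a b x ⊆ sublevel H a x :=
  fun _ hp => hp.1

/-- The thickness tends to zero. In the oblique alternative `q · γ > 0` and `t ≥ 0`, so `γ · p ≤ γ ·
(p + t q)`, which is at most `b` up to a multiple of the thickness. -/
theorem HasSlopesAt.test (h : Admissible Ω H γ g) {x p : 𝔼[n]} {ψ : 𝔼[n] → ℝ}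
    (hv : HasSlopesAt Ω H γ a b x v) (hx : x ∈ closure Ω) (hp : HasGradientAt ψ p x)
    (hmax : ∀ᶠ y in 𝓝[closure Ω] x, v y - ψ y ≤ v x - ψ x) :
    (x ∈ Ω → H x p ≤ a) ∧ (x ∈ frontier Ω → H x p ≤ a ∨ inner ℝ (γ x) p ≤ b) := by
  have hc₀ := h.isCompact_sublevel (a := a) hx
  have hc₁ := h.isCompact_obliqueSublevel (a := a) (b := b) hx
  have key : ∀ ε > 0, (x ∈ Ω → p ∈ thick ε (sublevel H a x)) ∧ (x ∈ frontier Ω →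
      p ∈ thick ε (sublevel H a x) ∨ ∃ q, 0 < inner ℝ q (γ x) ∧ ∃ t : ℝ, 0 ≤ t ∧
        p + t • q ∈ thick ε (obliqueSublevel H γ a b x)) := by
    intro ε hε
    obtain ⟨r, hr, hs₀, hs₁⟩ := hv ε hε
    exact h.gradient_of_slopesIn (isCompact_thick hc₀) (isCompact_thick hc₁)
      (convex_thick (h.convex_sublevel hx)) (convex_thick (h.convex_obliqueSublevel hx))
      (thick_mono le_rfl obliqueSublevel_subset) hs₀ hs₁ (mem_ball_self hr) hp hmax
  constructor
  · intro hxΩ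
    exact mem_of_forall_mem_thick hc₀.isClosed fun ε hε => (key ε hε).1 hxΩ
  · intro hxΓ
    by_contra! hcon
    obtain ⟨h1, h2⟩ := hcon
    have h3 : ∃ ε₀ > 0, p ∉ thick ε₀ (sublevel H a x) := by
      by_contra! hall
      exact absurd (mem_of_forall_mem_thick hc₀.isClosed hall) (not_le.2 h1)
    obtain ⟨ε₀, hε₀, hno⟩ := h3
    obtain ⟨ε, hε, hεs⟩ := exists_pos_mul_le_of_pos (X := ‖γ x‖)
      (Y := (inner ℝ (γ x) p - b) / 2) (norm_nonneg _) (by linarith)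
    rcases (key (min ε ε₀) (lt_min hε hε₀)).2 hxΓ with h4 | ⟨q, hq, t, ht, p', hp', hpp'⟩
    · exact hno (thick_mono (min_le_right _ _) subset_rfl h4)
    · have h5 : inner ℝ (γ x) (p + t • q) = inner ℝ (γ x) p + t * inner ℝ q (γ x) := by
        rw [inner_add_right, inner_smul_right, real_inner_comm q]
      have h6 : inner ℝ (γ x) (p + t • q) =
          inner ℝ (γ x) p' + inner ℝ (γ x) (p + t • q - p') := by
        rw [inner_sub_right]; ring
      have h7 := real_inner_le_norm (γ x) (p + t • q - p')
      have h8 : ‖γ x‖ * ‖p + t • q - p'‖ ≤ ‖γ x‖ * ε :=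
        mul_le_mul_of_nonneg_left (hpp'.trans (min_le_left _ _)) (norm_nonneg _)
      have h9 := hp'.2
      have h10 : 0 ≤ t * inner ℝ q (γ x) := mul_nonneg ht hq.le
      linarith

theorem HasSlopesAt.continuousWithinAt (h : Admissible Ω H γ g) {x : 𝔼[n]}
    (hv : HasSlopesAt Ω H γ a b x v) (hx : x ∈ closure Ω) :
    ContinuousWithinAt v (closure Ω) x := by
  obtain ⟨r, hr, hs, -⟩ := hv 1 one_pos
  obtain ⟨M, hM, hLip⟩ := hs.exists_lipschitz (isCompact_thick (h.isCompact_sublevel hx))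
  rw [ContinuousWithinAt, tendsto_iff_dist_tendsto_zero]
  have h1 : Tendsto (fun z => M * ‖z - x‖) (𝓝[closure Ω] x) (𝓝 0) := by
    have h2 : Continuous fun z => M * ‖z - x‖ := by fun_prop
    have h3 := (h2.tendsto x).mono_left (nhdsWithin_le_nhds (s := closure Ω))
    simpa using h3
  refine squeeze_zero' (Eventually.of_forall fun _ => dist_nonneg) ?_ h1
  filter_upwards [self_mem_nhdsWithin, mem_nhdsWithin_of_mem_nhds (ball_mem_nhds x hr)]
    with z hz hz'
  exact hLip z ⟨hz, hz'⟩ x ⟨hx, mem_ball_self hr⟩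

/-- A function with the slope bounds of a subsolution is a subsolution. -/
theorem Admissible.isSubsolution_of_hasSlopesAt (h : Admissible Ω H γ g)
    (hv : ∀ x ∈ closure Ω, HasSlopesAt Ω H γ a (g x) x v) :
    ContinuousOn v (closure Ω) ∧ IsSubsolution Ω H γ g a v := by
  have hc : ContinuousOn v (closure Ω) := fun x hx => (hv x hx).continuousWithinAt h hx
  have key : ∀ x ∈ closure Ω, ∀ φ : 𝔼[n] → ℝ, ContDiff ℝ 1 φ →
      IsMaxOn (fun z => uscEnvelope (closure Ω) v z - φ z) (closure Ω) x →
      (x ∈ Ω → H x (gradient φ x) ≤ a) ∧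
      (x ∈ frontier Ω → H x (gradient φ x) ≤ a ∨ inner ℝ (γ x) (gradient φ x) ≤ g x) := by
    intro x hx φ hφ hmax
    refine (hv x hx).test h hx ((hφ.differentiable (by simp)) x).hasGradientAt ?_
    filter_upwards [self_mem_nhdsWithin] with y hy
    have := hmax hy
    simpa only [mem_ofPred_eq, uscEnvelope_eq hc.upperSemicontinuousOn hy,
      uscEnvelope_eq hc.upperSemicontinuousOn hx] using this
  exact ⟨hc, (h.isCompact.image_of_continuousOn hc).bddAbove,
    fun x hx φ hφ hmax => (key x (subset_closure hx) φ hφ hmax).1 hx,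
    fun x hx φ hφ hmax => (key x (frontier_mem_closure hx) φ hφ hmax).2 hx⟩

end

section

variable {Ω : Set 𝔼[n]} {H : 𝔼[n] → 𝔼[n] → ℝ} {γ : 𝔼[n] → 𝔼[n]} {g : 𝔼[n] → ℝ} {a b : ℝ}
  {u v w : 𝔼[n] → ℝ} {x : 𝔼[n]}

/-! ### Operations preserving slope bounds -/

/-- The increment of a maximum is at most that of whichever function is larger at the first point.
-/
theorem SlopesIn.max {S C : Set 𝔼[n]} (hv : SlopesIn S C v) (hw : SlopesIn S C w) :
    SlopesIn S C fun z => max (v z) (w z) := by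
  intro x hx y hy
  rcases le_total (v x) (w x) with hle | hle
  · obtain ⟨p, hp, h⟩ := hw x hx y hy
    refine ⟨p, hp, ?_⟩
    have := le_max_right (v y) (w y)
    simp only [max_eq_right hle]
    linarith
  · obtain ⟨p, hp, h⟩ := hv x hx y hy
    refine ⟨p, hp, ?_⟩
    have := le_max_left (v y) (w y)
    simp only [max_eq_left hle]
    linarith

theorem SlopesIn.congr {S C : Set 𝔼[n]} (hv : SlopesIn S C v) (h : ∀ z ∈ S, w z = v z) :
    SlopesIn S C w := fun x hx y hy => by
  rw [h x hx, h y hy]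
  exact hv x hx y hy

theorem HasSlopesAt.mono {a' b' : ℝ} (hv : HasSlopesAt Ω H γ a b x v) (ha : a ≤ a')
    (hb : b ≤ b') : HasSlopesAt Ω H γ a' b' x v := fun ε hε =>
  let ⟨r, hr, h0, h1⟩ := hv ε hε
  ⟨r, hr, h0.mono subset_rfl (thick_mono le_rfl fun _ hp => le_trans hp ha),
    h1.mono subset_rfl (thick_mono le_rfl fun _ hp => ⟨hp.1.trans ha, hp.2.trans hb⟩)⟩

theorem HasSlopesAt.max (hv : HasSlopesAt Ω H γ a b x v) (hw : HasSlopesAt Ω H γ a b x w) :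
    HasSlopesAt Ω H γ a b x fun z => max (v z) (w z) := fun ε hε => by
  obtain ⟨r, hr, h0, h1⟩ := hv ε hε
  obtain ⟨r', hr', h0', h1'⟩ := hw ε hε
  have e1 : ball x (min r r') ⊆ ball x r := ball_subset_ball (min_le_left _ _)
  have e2 : ball x (min r r') ⊆ ball x r' := ball_subset_ball (min_le_right _ _)
  exact ⟨min r r', lt_min hr hr',
    (h0.mono (inter_subset_inter_right _ e1) subset_rfl).max
      (h0'.mono (inter_subset_inter_right _ e2) subset_rfl),
    (h1.mono (inter_subset_inter_right _ e1) subset_rfl).max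
      (h1'.mono (inter_subset_inter_right _ e2) subset_rfl)⟩

theorem HasSlopesAt.congr (hv : HasSlopesAt Ω H γ a b x v)
    (h : ∀ᶠ z in 𝓝 x, z ∈ closure Ω → w z = v z) : HasSlopesAt Ω H γ a b x w := fun ε hε => by
  obtain ⟨r, hr, h0, h1⟩ := hv ε hε
  obtain ⟨r', hr', hball⟩ := Metric.eventually_nhds_iff_ball.1 h
  have e1 : ball x (min r r') ⊆ ball x r := ball_subset_ball (min_le_left _ _)
  have e2 : ball x (min r r') ⊆ ball x r' := ball_subset_ball (min_le_right _ _)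
  exact ⟨min r r', lt_min hr hr',
    (h0.mono (inter_subset_inter_right _ e1) subset_rfl).congr fun z hz => hball z (e2 hz.2) hz.1,
    (h1.mono (inter_subset_inter_right _ e1) subset_rfl).congr fun z hz =>
      hball z (e2 hz.2) (frontier_mem_closure hz.1)⟩

theorem SlopesIn.convexComb {S C C' D : Set 𝔼[n]} {θ : ℝ} (hv : SlopesIn S C v)
    (hw : SlopesIn S C' w) (h0 : 0 ≤ θ) (h1 : θ ≤ 1)
    (hD : ∀ p ∈ C, ∀ p' ∈ C', (1 - θ) • p + θ • p' ∈ D) :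
    SlopesIn S D fun z => (1 - θ) * v z + θ * w z := by
  intro x hx y hy
  obtain ⟨p, hp, h⟩ := hv x hx y hy
  obtain ⟨p', hp', h'⟩ := hw x hx y hy
  refine ⟨_, hD p hp p' hp', ?_⟩
  rw [inner_add_left, inner_smul_left, inner_smul_left, conj_trivial, conj_trivial]
  have e1 := mul_le_mul_of_nonneg_left h (sub_nonneg.2 h1)
  have e2 := mul_le_mul_of_nonneg_left h' h0
  linarith

theorem thick_convexComb {ε θ : ℝ} {C C' D : Set 𝔼[n]} (h0 : 0 ≤ θ) (h1 : θ ≤ 1)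
    (hD : ∀ p ∈ C, ∀ p' ∈ C', (1 - θ) • p + θ • p' ∈ D) :
    ∀ p ∈ thick ε C, ∀ p' ∈ thick ε C', (1 - θ) • p + θ • p' ∈ thick ε D := by
  rintro p ⟨q, hq, hpq⟩ p' ⟨q', hq', hpq'⟩
  refine ⟨_, hD q hq q' hq', ?_⟩
  have e1 : (1 - θ) • p + θ • p' - ((1 - θ) • q + θ • q') =
      (1 - θ) • (p - q) + θ • (p' - q') := by module
  rw [e1]
  refine (norm_add_le _ _).trans ?_
  rw [norm_smul, norm_smul, Real.norm_of_nonneg (sub_nonneg.2 h1), Real.norm_of_nonneg h0]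
  have e2 := mul_le_mul_of_nonneg_left hpq (sub_nonneg.2 h1)
  have e3 := mul_le_mul_of_nonneg_left hpq' h0
  linarith

/-- Convexity of `H` in the slope, with levels and data averaged separately: strictness of one
function survives mixing. -/
theorem HasSlopesAt.convexComb (h : Admissible Ω H γ g) (hx : x ∈ closure Ω) {a' b' θ : ℝ}
    (hv : HasSlopesAt Ω H γ a b x v) (hw : HasSlopesAt Ω H γ a' b' x w) (h0 : 0 ≤ θ)
    (h1 : θ ≤ 1) : HasSlopesAt Ω H γ ((1 - θ) * a + θ * a') ((1 - θ) * b + θ * b') x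
      fun z => (1 - θ) * v z + θ * w z := fun ε hε => by
  have hH : ∀ p ∈ sublevel H a x, ∀ p' ∈ sublevel H a' x,
      (1 - θ) • p + θ • p' ∈ sublevel H ((1 - θ) * a + θ * a') x := fun p hp p' hp' => by
    refine ((h.convexOn x hx).2 (mem_univ p) (mem_univ p') (sub_nonneg.2 h1) h0 (by ring)).trans ?_
    exact add_le_add (mul_le_mul_of_nonneg_left hp (sub_nonneg.2 h1))
      (mul_le_mul_of_nonneg_left hp' h0)
  obtain ⟨r, hr, hv0, hv1⟩ := hv ε hε
  obtain ⟨r', hr', hw0, hw1⟩ := hw ε hε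
  have e1 : ball x (min r r') ⊆ ball x r := ball_subset_ball (min_le_left _ _)
  have e2 : ball x (min r r') ⊆ ball x r' := ball_subset_ball (min_le_right _ _)
  refine ⟨min r r', lt_min hr hr',
    (hv0.mono (inter_subset_inter_right _ e1) subset_rfl).convexComb
      (hw0.mono (inter_subset_inter_right _ e2) subset_rfl) h0 h1 (thick_convexComb h0 h1 hH),
    (hv1.mono (inter_subset_inter_right _ e1) subset_rfl).convexComb
      (hw1.mono (inter_subset_inter_right _ e2) subset_rfl) h0 h1 (thick_convexComb h0 h1
        fun p hp p' hp' => ⟨hH p hp.1 p' hp'.1, ?_⟩)⟩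
  rw [inner_add_right, inner_smul_right, inner_smul_right]
  exact add_le_add (mul_le_mul_of_nonneg_left hp.2 (sub_nonneg.2 h1))
    (mul_le_mul_of_nonneg_left hp'.2 h0)

theorem SlopesIn.add_const {S C : Set 𝔼[n]} (hv : SlopesIn S C v) (k : ℝ) :
    SlopesIn S C fun z => v z + k := fun x hx y hy =>
  let ⟨p, hp, h⟩ := hv x hx y hy
  ⟨p, hp, by simpa using h⟩

theorem HasSlopesAt.add_const (hv : HasSlopesAt Ω H γ a b x v) (k : ℝ) :
    HasSlopesAt Ω H γ a b x fun z => v z + k := fun ε hε =>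
  let ⟨r, hr, h0, h1⟩ := hv ε hε
  ⟨r, hr, h0.add_const k, h1.add_const k⟩

/-- The error `ε ‖y - z‖` of the affine approximation is the contribution of a slope of length `ε`
along `y - z`, which the thickening absorbs. -/
theorem hasSlopesAt_of_contDiffAt (h : Admissible Ω H γ g) (hx : x ∈ closure Ω) {p : 𝔼[n]}
    (hφ : ContDiffAt ℝ 1 v x) (hp : HasGradientAt v p x) (hH : H x p ≤ a)
    (hγ : x ∈ frontier Ω → inner ℝ (γ x) p ≤ b) : HasSlopesAt Ω H γ a b x v := fun ε hε => by
  obtain ⟨r, hr, hest⟩ := hasStrictGradient_estimate hφ hp hε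
  have key : ∀ C : Set 𝔼[n], p ∈ C → SlopesIn (ball x r) (thick ε C) v := by
    intro C hpC y hy z hz
    by_cases hyz : y = z
    · subst hyz
      exact ⟨p, subset_thick hε.le hpC, by simp⟩
    · have h1 := (abs_le.1 (hest y hy z hz)).2
      have h2 : 0 < ‖y - z‖ := norm_pos_iff.2 (sub_ne_zero.2 hyz)
      refine ⟨p + (ε / ‖y - z‖) • (y - z), ⟨p, hpC, ?_⟩, ?_⟩
      · rw [add_sub_cancel_left, norm_smul, Real.norm_of_nonneg (by positivity),
          div_mul_cancel₀ _ h2.ne']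
      · have h3 : inner ℝ (p + (ε / ‖y - z‖) • (y - z)) (y - z) =
            inner ℝ p (y - z) + ε * ‖y - z‖ := by
          rw [inner_add_left, inner_smul_left, real_inner_self_eq_norm_sq, conj_trivial]
          field_simp
        rw [h3]
        linarith
  rcases h.mem_or hx with hΩ | hΓ
  · obtain ⟨r', hr', hball⟩ := Metric.isOpen_iff.1 h.isOpen x hΩ
    refine ⟨min r r', lt_min hr hr', (key (sublevel H a x) hH).mono (inter_subset_right.trans
      (ball_subset_ball (min_le_left _ _))) subset_rfl, fun z hz => ?_⟩
    exact absurd (hball (ball_subset_ball (min_le_right _ _) hz.2)) (h.notMem hz.1)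
  · exact ⟨r, hr, (key (sublevel H a x) hH).mono inter_subset_right subset_rfl,
      (key (obliqueSublevel H γ a b x) ⟨hH, hγ hΓ⟩).mono inter_subset_right subset_rfl⟩

/-! ### Comparison -/

/-- The slopes of the penalization are compatible with the oblique condition. -/
theorem Admissible.exists_penalty (h : Admissible Ω H γ g) (hx : x ∈ closure Ω) {δ : ℝ}
    (hδ : 0 < δ) :
    ∃ B : 𝔼[n] →L[ℝ] 𝔼[n], ∃ q : 𝔼[n], ∃ c > 0, (∀ z, c * ‖z‖ ≤ ‖B z‖) ∧
      ∀ M > 0, ∃ r > 0, ∀ y ∈ closure Ω ∩ ball x r, ∀ z ∈ closure Ω ∩ ball x r, ∀ t : ℝ, 0 ≤ t →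
        t * ‖y - z‖ ≤ M →
        (y ∈ frontier Ω → g x - 3 * δ / 4 ≤ inner ℝ (γ y) (q + t • B.adjoint (B (y - z)))) ∧
        (z ∈ frontier Ω → inner ℝ (γ z) (q + t • B.adjoint (B (y - z))) < g z) := by
  rcases h.mem_or hx with hΩ | hΓ
  · obtain ⟨r, hr, hball⟩ := Metric.isOpen_iff.1 h.isOpen x hΩ
    refine ⟨ContinuousLinearMap.id ℝ _, 0, 1, one_pos, by simp, fun M hM => ⟨r, hr, ?_⟩⟩
    intro y hy z hz t _ _
    exact ⟨fun hyΓ => absurd (hball hy.2) (h.notMem hyΓ),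
      fun hzΓ => absurd (hball hz.2) (h.notMem hzΓ)⟩
  · obtain ⟨q₀, hβ, ⟨B, c, hc, hB, hBγ⟩, hfr⟩ := h.exists_frame hΓ
    -- The linear part centres the oblique slope between `g x - δ` and `g x`. The quadratic part
    -- adds `t q₀ · (y - z)`, almost nonnegative for `y` on the frontier and almost nonpositive for
    -- `z` on it: the favourable sign in both cases.
    set q := ((g x - δ / 2) / inner ℝ q₀ (γ x)) • q₀ with hq
    have hqγ : inner ℝ (γ x) q = g x - δ / 2 := by
      rw [hq, inner_smul_right, real_inner_comm q₀ (γ x)]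
      exact div_mul_cancel₀ _ hβ.ne'
    refine ⟨B, q, c, hc, hB, fun M hM => ?_⟩
    obtain ⟨κ, hκ, hκM⟩ := exists_pos_mul_le_of_pos hM.le (by positivity : 0 < δ / 16)
    obtain ⟨r, hr, hfr'⟩ := hfr κ hκ
    obtain ⟨r', hr', hdata⟩ := h.data_near hΓ (C := ‖q‖ + ‖B‖ * (‖B‖ * M))
      (by positivity : 0 < δ / 16)
    refine ⟨min r r', lt_min hr hr', fun y hy z hz t ht htM => ?_⟩
    have hy1 : y ∈ closure Ω ∩ ball x r := ⟨hy.1, ball_subset_ball (min_le_left _ _) hy.2⟩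
    have hz1 : z ∈ closure Ω ∩ ball x r := ⟨hz.1, ball_subset_ball (min_le_left _ _) hz.2⟩
    set p := q + t • B.adjoint (B (y - z)) with hp
    have hpn : ‖p‖ ≤ ‖q‖ + ‖B‖ * (‖B‖ * M) := by
      refine (norm_add_le _ _).trans (add_le_add_right ?_ _)
      rw [norm_smul, Real.norm_of_nonneg ht]
      have h1 : ‖B.adjoint (B (y - z))‖ ≤ ‖B‖ * (‖B‖ * ‖y - z‖) := by
        refine (B.adjoint.le_opNorm _).trans ?_
        rw [LinearIsometryEquiv.norm_map]
        exact mul_le_mul_of_nonneg_left (B.le_opNorm _) (norm_nonneg _)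
      calc t * ‖B.adjoint (B (y - z))‖ ≤ t * (‖B‖ * (‖B‖ * ‖y - z‖)) :=
            mul_le_mul_of_nonneg_left h1 ht
        _ = ‖B‖ * (‖B‖ * (t * ‖y - z‖)) := by ring
        _ ≤ _ := by gcongr
    have hpγ : inner ℝ (γ x) p = g x - δ / 2 + t * inner ℝ q₀ (y - z) := by
      rw [hp, inner_add_right, hqγ, inner_smul_right, ContinuousLinearMap.adjoint_inner_right,
        real_inner_comm, hBγ]
    have hsm : t * (κ * ‖y - z‖) ≤ δ / 16 := by
      calc t * (κ * ‖y - z‖) = κ * (t * ‖y - z‖) := by ring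
        _ ≤ κ * M := mul_le_mul_of_nonneg_left htM hκ.le
        _ ≤ _ := hκM
    constructor
    · intro hyΓ
      obtain ⟨-, h2⟩ := hdata y ⟨hyΓ, ball_subset_ball (min_le_right _ _) hy.2⟩
      have h3 := (abs_le.1 (h2 p hpn)).1
      have h4 := mul_le_mul_of_nonneg_left ((hfr' y hy1 z hz1).1 hyΓ) ht
      linarith
    · intro hzΓ
      obtain ⟨h1, h2⟩ := hdata z ⟨hzΓ, ball_subset_ball (min_le_right _ _) hz.2⟩
      have h3 := (abs_le.1 (h2 p hpn)).2
      have h4 := mul_le_mul_of_nonneg_left ((hfr' y hy1 z hz1).2 hzΓ) ht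
      have h5 := (abs_le.1 h1).1
      linarith

/-- A function that is a strict subsolution near `x` cannot touch a supersolution at `x` from
below. -/
theorem HasSlopesAt.not_isMax (h : Admissible Ω H γ g) (hx : x ∈ closure Ω) {δ : ℝ} (hδ : 0 < δ)
    (hv : HasSlopesAt Ω H γ (a - δ) (g x - δ) x v) (hu : IsSupersolution Ω H γ g a u)
    (huc : ContinuousOn u (closure Ω)) :
    ¬ ∀ z ∈ closure Ω, v z - u z ≤ v x - u x := by
  intro hmax
  obtain ⟨B, q, c, hc, hB, hpen⟩ := h.exists_penalty hx hδ
  obtain ⟨r₀, hr₀, hs₀, -⟩ := hv 1 one_pos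
  obtain ⟨L, hL, hLip⟩ := hs₀.exists_lipschitz (isCompact_thick (h.isCompact_sublevel hx))
  set D := L + ‖q‖
  have hD : 0 < D := by positivity
  obtain ⟨r₁, hr₁, hpen₁⟩ := hpen (2 * D / c ^ 2) (by positivity)
  obtain ⟨r₂, hr₂, hham⟩ := h.ham_lt_near hx (by linarith : a - δ < a)
  obtain ⟨RH, hRH, hbound⟩ := h.exists_bound (a - δ)
  -- Errors up to `3 ε` occur: `ε` from the thickening and at most `2 ε` from the gradient of the
  -- localizing term `‖y - x‖²`.
  obtain ⟨ε, hε, hεs⟩ := exists_pos_mul_le_of_pos (X := 4 * (‖γ x‖ + 1))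
    (Y := min (δ / 16) (min 1 r₂)) (by positivity) (by positivity)
  have hε1 : ‖γ x‖ * (3 * ε) ≤ δ / 16 := by
    have := hεs.trans (min_le_left _ _)
    nlinarith [mul_nonneg hε.le (norm_nonneg (γ x))]
  have hε2 : 3 * ε ≤ 1 := by
    have := (hεs.trans (min_le_right _ _)).trans (min_le_left _ _)
    nlinarith [mul_nonneg hε.le (norm_nonneg (γ x))]
  have hε3 : 3 * ε < r₂ := by
    have := (hεs.trans (min_le_right _ _)).trans (min_le_right _ _)
    nlinarith [mul_nonneg hε.le (norm_nonneg (γ x))]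
  obtain ⟨r₃, hr₃, hs₃, hs₃'⟩ := hv ε hε
  have hdata : ∃ r > 0, ∀ z ∈ frontier Ω ∩ ball x r, ∀ p, ‖p‖ ≤ RH + 1 →
      |inner ℝ (γ z) p - inner ℝ (γ x) p| ≤ δ / 32 := by
    rcases h.mem_or hx with hΩ | hΓ
    · obtain ⟨r, hr, hball⟩ := Metric.isOpen_iff.1 h.isOpen x hΩ
      exact ⟨r, hr, fun z hz => absurd (hball hz.2) (h.notMem hz.1)⟩
    · obtain ⟨r, hr, hd⟩ := h.data_near hΓ (C := RH + 1) (by positivity : 0 < δ / 32)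
      exact ⟨r, hr, fun z hz => (hd z hz).2⟩
  obtain ⟨r₄, hr₄, hdata⟩ := hdata
  set R := min ε (min (min r₀ r₁) (min (min r₂ r₃) r₄)) / 2
  have hm : 0 < min ε (min (min r₀ r₁) (min (min r₂ r₃) r₄)) := by positivity
  have hR : 0 < R := by positivity
  have hRm : R < min ε (min (min r₀ r₁) (min (min r₂ r₃) r₄)) := by simp only [R]; linarith
  obtain ⟨hRε, ⟨hR0, hR1⟩, ⟨hR2, hR3⟩, hR4⟩ :
      R < ε ∧ (R < r₀ ∧ R < r₁) ∧ (R < r₂ ∧ R < r₃) ∧ R < r₄ := by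
    simpa only [lt_min_iff] using hRm
  obtain ⟨E, hE, hEs⟩ := exists_pos_mul_le_of_pos (X := D ^ 2 / c ^ 2 + D / c ^ 2)
    (Y := min (R ^ 2 / 16) (R / 4)) (by positivity) (by positivity)
  have hE1 : D ^ 2 * E / c ^ 2 ≤ R ^ 2 / 16 := by
    have h1 := hEs.trans (min_le_left _ _)
    have h2 : 0 ≤ E * (D / c ^ 2) := by positivity
    have h3 : D ^ 2 * E / c ^ 2 = E * (D ^ 2 / c ^ 2) := by ring
    linarith
  have hE2 : D * E / c ^ 2 ≤ R / 4 := by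
    have h1 := hEs.trans (min_le_right _ _)
    have h2 : 0 ≤ E * (D ^ 2 / c ^ 2) := by positivity
    have h3 : D * E / c ^ 2 = E * (D / c ^ 2) := by ring
    linarith
  set S := closure Ω ∩ closedBall x R with hS
  have hScomp : IsCompact S := h.isCompact.inter_right isClosed_closedBall
  have hSx : x ∈ S := ⟨hx, mem_closedBall_self hR.le⟩
  have hSr₀ : S ⊆ closure Ω ∩ ball x r₀ := fun z hz => ⟨hz.1, closedBall_subset_ball hR0 hz.2⟩
  have hvc : ContinuousOn v S := by
    have : LipschitzOnWith ⟨L, hL.le⟩ v S := LipschitzOnWith.of_dist_le_mul fun y hy z hz => by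
      rw [Real.dist_eq, dist_eq_norm]
      exact hLip y (hSr₀ hy) z (hSr₀ hz)
    exact this.continuousOn
  -- doubling of variables
  set Φ : 𝔼[n] × 𝔼[n] → ℝ := fun z => v z.1 - u z.2 -
    (inner ℝ q (z.1 - z.2) + E⁻¹ * ‖B (z.1 - z.2)‖ ^ 2) - ‖z.1 - x‖ ^ 2 with hΦ
  have hΦc : ContinuousOn Φ (S ×ˢ S) := by
    refine ((ContinuousOn.sub ?_ ?_).sub ?_).sub ?_
    · exact hvc.comp continuousOn_fst fun z hz => hz.1
    · exact (huc.mono inter_subset_left).comp continuousOn_snd fun z hz => hz.2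
    · fun_prop
    · fun_prop
  obtain ⟨⟨y, z⟩, ⟨hyS, hzS⟩, hyz⟩ := (hScomp.prod hScomp).exists_isMaxOn ⟨(x, x), hSx, hSx⟩ hΦc
  simp only at hyS hzS
  have hΦmax : ∀ y' ∈ S, ∀ z' ∈ S, Φ (y', z') ≤ Φ (y, z) := fun y' hy' z' hz' =>
    hyz (⟨hy', hz'⟩ : (y', z') ∈ S ×ˢ S)
  have hyzL := (le_abs_self _).trans (hLip y (hSr₀ hyS) z (hSr₀ hzS))
  have h0 := hΦmax x hSx x hSx
  simp only [hΦ, sub_self, inner_zero_right, map_zero, norm_zero] at h0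
  have h1 := hmax z hzS.1
  have h2 := neg_le_of_abs_le (abs_real_inner_le_norm q (y - z))
  -- The maximality of `v - u` at `x` and the Lipschitz bound for `v` give `‖y - z‖ = O(E)`. Penalty
  -- slopes are thus bounded independently of `E`, and one small `E` suffices in place of a limit.
  have h3 : E⁻¹ * ‖B (y - z)‖ ^ 2 + ‖y - x‖ ^ 2 ≤ D * ‖y - z‖ := by
    simp only [D]
    linarith
  have h4 : E⁻¹ * (c * ‖y - z‖) ^ 2 ≤ E⁻¹ * ‖B (y - z)‖ ^ 2 := by
    have := hB (y - z)
    gcongr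
  have hyz1 : ‖y - z‖ ≤ D * E / c ^ 2 := by
    by_contra! hlt
    have hpos : 0 < ‖y - z‖ := lt_trans (by positivity) hlt
    rw [div_lt_iff₀ (by positivity)] at hlt
    have h5 : E⁻¹ * (c * ‖y - z‖) ^ 2 = E⁻¹ * (‖y - z‖ * c ^ 2) * ‖y - z‖ := by ring
    have h6 : D = E⁻¹ * (D * E) := by field_simp
    have h7 : D * ‖y - z‖ < E⁻¹ * (‖y - z‖ * c ^ 2) * ‖y - z‖ := by
      refine mul_lt_mul_of_pos_right ?_ hpos
      calc D = E⁻¹ * (D * E) := h6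
        _ < _ := mul_lt_mul_of_pos_left hlt (by positivity)
    have h8 : 0 ≤ ‖y - x‖ ^ 2 := by positivity
    linarith
  have hyx : ‖y - x‖ ≤ R / 4 := by
    have h5 : 0 ≤ E⁻¹ * ‖B (y - z)‖ ^ 2 := by positivity
    have h6 : ‖y - x‖ ^ 2 ≤ (R / 4) ^ 2 := by
      have : D * ‖y - z‖ ≤ D * (D * E / c ^ 2) := mul_le_mul_of_nonneg_left hyz1 hD.le
      have e : D * (D * E / c ^ 2) = D ^ 2 * E / c ^ 2 := by ring
      have e' : (R / 4) ^ 2 = R ^ 2 / 16 := by ring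
      linarith
    exact abs_le_of_sq_le_sq' h6 (by positivity) |>.2
  have hyR : y ∈ ball x R := by rw [mem_ball, dist_eq_norm]; linarith
  have hzR : z ∈ ball x R := by
    rw [mem_ball, dist_eq_norm]
    have : z - x = (y - x) - (y - z) := by abel
    rw [this]
    refine (norm_sub_le _ _).trans_lt ?_
    linarith
  have hnear : ∀ y' ∈ ball x R, ∀ᶠ w in 𝓝[closure Ω] y', w ∈ S := fun y' hy' => by
    filter_upwards [self_mem_nhdsWithin, mem_nhdsWithin_of_mem_nhds (isOpen_ball.mem_nhds hy')]
      with w hw hw'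
    exact ⟨hw, ball_subset_closedBall hw'⟩
  set t := 2 * E⁻¹ with ht
  have htM : t * ‖y - z‖ ≤ 2 * D / c ^ 2 := by
    calc t * ‖y - z‖ ≤ t * (D * E / c ^ 2) := mul_le_mul_of_nonneg_left hyz1 (by positivity)
      _ = 2 * D / c ^ 2 := by rw [ht]; field_simp
  set p := q + t • B.adjoint (B (y - z)) with hp
  obtain ⟨hpy, hpz⟩ := hpen₁ y ⟨hyS.1, ball_subset_ball hR1.le hyR⟩ z
    ⟨hzS.1, ball_subset_ball hR1.le hzR⟩ t (by positivity) htM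
  -- the test at `y`
  have hgy : HasGradientAt (fun w => (inner ℝ q (w - z) + E⁻¹ * ‖B (w - z)‖ ^ 2) + ‖w - x‖ ^ 2)
      (p + (2 : ℝ) • (y - x)) y := by
    have e1 := hasGradientAt_quadratic B q z y E⁻¹
    have e2 := hasGradientAt_quadratic (ContinuousLinearMap.id ℝ 𝔼[n]) 0 x y 1
    rw [hasGradientAt_iff_hasFDerivAt] at e1 e2 ⊢
    have e3 := e1.add e2
    rw [← map_add] at e3
    convert! e3 using 2
    · simp
    · congr 1
      rw [zero_add, mul_one]
      congr 1
      exact (ext_inner_right ℝ fun w => by rw [ContinuousLinearMap.adjoint_inner_left]; rfl)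
  have hw := h.gradient_of_slopesIn (z := y)
    (isCompact_thick (ε := ε) (h.isCompact_sublevel (a := a - δ) hx))
    (isCompact_thick (ε := ε) (h.isCompact_obliqueSublevel (a := a - δ) (b := g x - δ) hx))
    (convex_thick (h.convex_sublevel hx)) (convex_thick (h.convex_obliqueSublevel hx))
    (thick_mono le_rfl obliqueSublevel_subset) hs₃ hs₃' (ball_subset_ball hR3.le hyR) hgy (by
      filter_upwards [hnear y hyR] with w hw
      have := hΦmax w hw z hzS
      simp only [hΦ] at this
      linarith)
  have hshift : ∀ p', ‖p + (2 : ℝ) • (y - x) - p'‖ ≤ ε → ‖p - p'‖ ≤ 3 * ε := fun p' hp' => by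
    have e1 : p - p' = (p + (2 : ℝ) • (y - x) - p') - (2 : ℝ) • (y - x) := by abel
    rw [e1]
    refine (norm_sub_le _ _).trans ?_
    rw [norm_smul, Real.norm_of_nonneg two_pos.le]
    linarith
  -- On the frontier, the oblique alternative would make `γ y · p` at most `g x - 7 δ / 8`, against
  -- the lower bound `g x - 3 δ / 4` built into the penalty.
  have hmem : p + (2 : ℝ) • (y - x) ∈ thick ε (sublevel H (a - δ) x) := by
    rcases h.mem_or hyS.1 with hyΩ | hyΓ
    · exact hw.1 hyΩ
    · rcases hw.2 hyΓ with h5 | ⟨e, he, s, hs, p', hp', hpp'⟩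
      · exact h5
      · exfalso
        have h5 := hpy hyΓ
        have h6 : ‖p + s • e - p'‖ ≤ 3 * ε := by
          have e1 : p + s • e - p' = (p + (2 : ℝ) • (y - x) + s • e - p') - (2 : ℝ) • (y - x) := by
            abel
          rw [e1]
          refine (norm_sub_le _ _).trans ?_
          rw [norm_smul, Real.norm_of_nonneg two_pos.le]
          linarith
        have h7 : inner ℝ (γ y) p + s * inner ℝ e (γ y) =
            inner ℝ (γ y) p' + inner ℝ (γ y) (p + s • e - p') := by
          rw [inner_sub_right, inner_add_right _ p, inner_smul_right _ e, real_inner_comm (γ y) e]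
          ring
        have hyΓ' : y ∈ frontier Ω ∩ ball x r₄ := ⟨hyΓ, ball_subset_ball hR4.le hyR⟩
        have h8 := (abs_le.1 (hdata y hyΓ' p'
          ((hbound x hx p' hp'.1).trans (by linarith)))).2
        have h9 := (abs_le.1 (hdata y hyΓ' _ (h6.trans (by linarith)))).2
        have h10 := (real_inner_le_norm (γ x) (p + s • e - p')).trans
          (mul_le_mul_of_nonneg_left h6 (norm_nonneg _))
        have h11 := hp'.2
        have h12 : 0 ≤ s * inner ℝ e (γ y) := mul_nonneg hs he.le
        linarith
  obtain ⟨p', hp', hpp'⟩ := hmem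
  have hHz : H z p < a := hham z ⟨hzS.1, ball_subset_ball hR2.le hzR⟩ p' hp' p
    ((hshift p' hpp').trans_lt hε3)
  -- the test at `z`
  have hgz : HasGradientAt (fun w => inner ℝ q (w - y) + -E⁻¹ * ‖B (w - y)‖ ^ 2) p z := by
    have e1 := hasGradientAt_quadratic B q y z (-E⁻¹)
    convert e1 using 1
    rw [hp, ht, ← neg_sub y z, map_neg, map_neg]
    module
  have hz := hu.local_test huc hzS.1 (contDiff_quadratic B q y (-E⁻¹)).contDiffAt hgz (by
    filter_upwards [hnear z hzR] with w hw
    have := hΦmax y hyS w hw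
    simp only [hΦ] at this
    have e1 : ∀ w : 𝔼[n], inner ℝ q (w - y) = -inner ℝ q (y - w) := fun w => by
      rw [← inner_neg_right, neg_sub]
    have e2 : ∀ w : 𝔼[n], ‖B (w - y)‖ = ‖B (y - w)‖ := fun w => by
      rw [← neg_sub, map_neg, norm_neg]
    rw [e1, e1, e2, e2]
    linarith)
  rcases h.mem_or hzS.1 with hzΩ | hzΓ
  · exact absurd (hz.1 hzΩ) (not_le.2 hHz)
  · rcases hz.2 hzΓ with h5 | h5
    · exact absurd h5 (not_le.2 hHz)
    · exact absurd h5 (not_le.2 (hpz hzΓ))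

end

section

variable {Ω : Set 𝔼[n]} {H : 𝔼[n] → 𝔼[n] → ℝ} {γ : 𝔼[n] → 𝔼[n]} {g : 𝔼[n] → ℝ} {a : ℝ}
  {u v w : 𝔼[n] → ℝ} {x y : 𝔼[n]}

/-! ### The semidistance -/

/-- By the local equi-Lipschitz estimate, points at bounded difference, uniformly over subsolutions,
form relatively open classes; the closure is connected, so there is only one. -/
theorem Admissible.exists_difference_bound (h : Admissible Ω H γ g) (a : ℝ) (hx : x ∈ closure Ω)
    (hy : y ∈ closure Ω) :
    ∃ C, ∀ v, UpperSemicontinuousOn v (closure Ω) → IsSubsolution Ω H γ g a v →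
      v x - v y ≤ C := by
  refine h.isConnected.isPreconnected.closure.induction₂' (fun x y => ∃ C, ∀ v,
    UpperSemicontinuousOn v (closure Ω) → IsSubsolution Ω H γ g a v → v x - v y ≤ C)
    (fun x hx => ?_) (fun x y z _ _ _ hxy hyz => ?_) hx hy
  · obtain ⟨r, hr, L, -, hL⟩ := h.exists_lipschitz a hx
    filter_upwards [self_mem_nhdsWithin, mem_nhdsWithin_of_mem_nhds (ball_mem_nhds x hr)]
      with z hz hzr
    exact ⟨⟨_, fun v hv hv' => hL v hv hv' x ⟨hx, mem_ball_self hr⟩ z ⟨hz, hzr⟩⟩,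
      ⟨_, fun v hv hv' => hL v hv hv' z ⟨hz, hzr⟩ x ⟨hx, mem_ball_self hr⟩⟩⟩
  · obtain ⟨C, hC⟩ := hxy
    obtain ⟨C', hC'⟩ := hyz
    exact ⟨C + C', fun v hv hv' => by linarith [hC v hv hv', hC' v hv hv']⟩

theorem Admissible.bddAbove_subsolutionDifferences (h : Admissible Ω H γ g) (a : ℝ)
    (hx : x ∈ closure Ω) (hy : y ∈ closure Ω) :
    BddAbove (subsolutionDifferences Ω H γ g a x y) := by
  obtain ⟨C, hC⟩ := h.exists_difference_bound a hx hy
  refine ⟨C, ?_⟩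
  rintro _ ⟨v, hv, hv', rfl⟩
  exact hC v hv hv'

theorem Admissible.sub_le_semiDist (h : Admissible Ω H γ g) (hv : UpperSemicontinuousOn v (closure Ω))
    (hv' : IsSubsolution Ω H γ g a v) (hx : x ∈ closure Ω) (hy : y ∈ closure Ω) :
    v x - v y ≤ semiDist Ω H γ g a x y :=
  le_csSup (h.bddAbove_subsolutionDifferences a hx hy) ⟨v, hv, hv', rfl⟩

/-- The subsolution `u` makes the set of differences nonempty; otherwise `sSup` would take its
default value `0` and `hC` would be vacuous. -/
theorem semiDist_le (hu : UpperSemicontinuousOn u (closure Ω)) (hu' : IsSubsolution Ω H γ g a u)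
    {C : ℝ} (hC : ∀ v, UpperSemicontinuousOn v (closure Ω) → IsSubsolution Ω H γ g a v →
      v x - v y ≤ C) : semiDist Ω H γ g a x y ≤ C := by
  refine csSup_le ⟨_, u, hu, hu', rfl⟩ ?_
  rintro _ ⟨v, hv, hv', rfl⟩
  exact hC v hv hv'

theorem Admissible.semiDist_self (h : Admissible Ω H γ g) (hu : UpperSemicontinuousOn u (closure Ω))
    (hu' : IsSubsolution Ω H γ g a u) (hx : x ∈ closure Ω) : semiDist Ω H γ g a x x = 0 :=
  le_antisymm (semiDist_le hu hu' fun v _ _ => (sub_self _).le)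
    (by simpa using h.sub_le_semiDist hu hu' hx hx)

theorem Admissible.semiDist_triangle (h : Admissible Ω H γ g)
    (hu : UpperSemicontinuousOn u (closure Ω)) (hu' : IsSubsolution Ω H γ g a u) {z : 𝔼[n]}
    (hx : x ∈ closure Ω) (hy : y ∈ closure Ω) (hz : z ∈ closure Ω) :
    semiDist Ω H γ g a x z ≤ semiDist Ω H γ g a x y + semiDist Ω H γ g a y z :=
  semiDist_le hu hu' fun v hv hv' => by
    linarith [h.sub_le_semiDist hv hv' hx hy, h.sub_le_semiDist hv hv' hy hz]

/-- A function with increments bounded by the semidistance inherits the slope bounds. -/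
theorem Admissible.hasSlopesAt_of_sub_le_semiDist (h : Admissible Ω H γ g)
    (hu : UpperSemicontinuousOn u (closure Ω)) (hu' : IsSubsolution Ω H γ g a u)
    (hw : ∀ y ∈ closure Ω, ∀ z ∈ closure Ω, w y - w z ≤ semiDist Ω H γ g a y z)
    (hx : x ∈ closure Ω) : HasSlopesAt Ω H γ a (g x) x w := fun ε hε => by
  obtain ⟨r, hr, hs⟩ := h.exists_slopes a hx hε
  have key : ∀ S ⊆ closure Ω, ∀ C, IsCompact C → (∀ v, UpperSemicontinuousOn v (closure Ω) →
      IsSubsolution Ω H γ g a v → SlopesIn S C v) → SlopesIn S C w := by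
    intro S hS C hC hv y hy z hz
    obtain ⟨p₀, hp₀, -⟩ := hv u hu hu' y hy z hz
    obtain ⟨p, hp, hmax⟩ := exists_max_inner hC ⟨p₀, hp₀⟩ (y - z)
    refine ⟨p, hp, (hw y (hS hy) z (hS hz)).trans (semiDist_le hu hu' fun v h1 h2 => ?_)⟩
    obtain ⟨p', hp', hle⟩ := hv v h1 h2 y hy z hz
    exact hle.trans (hmax p' hp')
  exact ⟨r, hr, key _ inter_subset_left _ (isCompact_thick (h.isCompact_sublevel hx))
      fun v h1 h2 => (hs v h1 h2).1,
    key _ (inter_subset_left.trans frontier_subset_closure) _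
      (isCompact_thick (h.isCompact_obliqueSublevel hx)) fun v h1 h2 => (hs v h1 h2).2⟩

theorem Admissible.hasSlopesAt_semiDist (h : Admissible Ω H γ g)
    (hu : UpperSemicontinuousOn u (closure Ω)) (hu' : IsSubsolution Ω H γ g a u)
    (hy : y ∈ closure Ω) (hx : x ∈ closure Ω) :
    HasSlopesAt Ω H γ a (g x) x fun z => semiDist Ω H γ g a z y :=
  h.hasSlopesAt_of_sub_le_semiDist hu hu' (fun z hz z' hz' => by
    linarith [h.semiDist_triangle hu hu' hz hz' hy]) hx

/-- Two triangle inequalities reduce this to `d(y, z)` and `d(z, y)`, both locally at most `L ‖z -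
y‖`. -/
theorem Admissible.continuousOn_semiDist_right (h : Admissible Ω H γ g)
    (hu : UpperSemicontinuousOn u (closure Ω)) (hu' : IsSubsolution Ω H γ g a u)
    (hx : x ∈ closure Ω) : ContinuousOn (fun y => semiDist Ω H γ g a x y) (closure Ω) := by
  intro y hy
  obtain ⟨r, hr, L, hL, hlip⟩ := h.exists_lipschitz a hy
  rw [ContinuousWithinAt, tendsto_iff_dist_tendsto_zero]
  have hlim : Tendsto (fun z => L * ‖z - y‖) (𝓝[closure Ω] y) (𝓝 0) := by
    have : Continuous fun z => L * ‖z - y‖ := by fun_prop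
    simpa using (this.tendsto y).mono_left nhdsWithin_le_nhds
  refine squeeze_zero' (Eventually.of_forall fun _ => dist_nonneg) ?_ hlim
  filter_upwards [self_mem_nhdsWithin, mem_nhdsWithin_of_mem_nhds (ball_mem_nhds y hr)]
    with z hz hzr
  have e1 : semiDist Ω H γ g a y z ≤ L * ‖z - y‖ := semiDist_le hu hu' fun v hv hv' => by
    rw [norm_sub_rev]
    exact hlip v hv hv' y ⟨hy, mem_ball_self hr⟩ z ⟨hz, hzr⟩
  have e2 : semiDist Ω H γ g a z y ≤ L * ‖z - y‖ := semiDist_le hu hu' fun v hv hv' =>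
    hlip v hv hv' z ⟨hz, hzr⟩ y ⟨hy, mem_ball_self hr⟩
  rw [Real.dist_eq, abs_le]
  constructor
  · linarith [h.semiDist_triangle hu hu' hx hz hy]
  · linarith [h.semiDist_triangle hu hu' hx hy hz]

/-! ### Strict subsolutions off the Aubry–Mather set -/

theorem Admissible.strict_near (h : Admissible Ω H γ g) {G : 𝔼[n] → 𝔼[n]}
    (hG : Continuous G) (hH : H x (G x) < a)
    (hγ : x ∈ frontier Ω → inner ℝ (γ x) (G x) < g x) :
    ∃ δ > 0, ∃ r > 0, ∀ z ∈ closure Ω ∩ ball x r,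
      H z (G z) ≤ a - δ ∧ (z ∈ frontier Ω → inner ℝ (γ z) (G z) ≤ g z - δ) := by
  obtain ⟨δ₁, hδ₁, hev₁⟩ : ∃ δ > 0, ∀ᶠ z in 𝓝 x, z ∈ closure Ω → H z (G z) < a - δ := by
    refine ⟨(a - H x (G x)) / 2, by linarith, ?_⟩
    have hc : Continuous fun z => (z, G z) := by fun_prop
    exact ((h.isOpen_lt (a - (a - H x (G x)) / 2)).preimage hc).mem_nhds fun _ => by
      show H x (G x) < _
      linarith
  obtain ⟨δ₂, hδ₂, hev₂⟩ : ∃ δ > 0, ∀ᶠ z in 𝓝 x, z ∈ frontier Ω →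
      inner ℝ (γ z) (G z) < g z - δ := by
    by_cases hΓ : x ∈ frontier Ω
    · have hγ' := hγ hΓ
      refine ⟨(g x - inner ℝ (γ x) (G x)) / 2, by linarith, ?_⟩
      have hc : ContinuousOn (fun z => g z - inner ℝ (γ z) (G z)) (frontier Ω) :=
        h.continuousOn_datum.sub (h.continuousOn_oblique.inner hG.continuousOn)
      have := (hc x hΓ).eventually (lt_mem_nhds
        (by linarith : (g x - inner ℝ (γ x) (G x)) / 2 < g x - inner ℝ (γ x) (G x)))
      filter_upwards [eventually_nhdsWithin_iff.1 this] with z hz hzΓ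
      linarith [hz hzΓ]
    · refine ⟨1, one_pos, ?_⟩
      filter_upwards [isClosed_frontier.isOpen_compl.mem_nhds hΓ] with z hz hzΓ
      exact absurd hzΓ hz
  obtain ⟨r, hr, hball⟩ := Metric.eventually_nhds_iff_ball.1 (hev₁.and hev₂)
  refine ⟨min δ₁ δ₂, lt_min hδ₁ hδ₂, r, hr, fun z hz => ⟨?_, fun hzΓ => ?_⟩⟩
  · linarith [(hball z hz.2).1 hz.1, min_le_left δ₁ δ₂]
  · linarith [(hball z hz.2).2 hzΓ, min_le_right δ₁ δ₂]

theorem Admissible.exists_strict_test (h : Admissible Ω H γ g) (hb : BddBelow (v '' closure Ω))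
    (hc : ContinuousOn v (closure Ω)) (hv : ¬ IsSupersolution Ω H γ g a v) :
    ∃ x ∈ closure Ω, ∃ φ : 𝔼[n] → ℝ, ContDiff ℝ 1 φ ∧
      (∀ z ∈ closure Ω, v x - φ x ≤ v z - φ z) ∧ H x (gradient φ x) < a ∧
      (x ∈ frontier Ω → inner ℝ (γ x) (gradient φ x) < g x) := by
  by_contra! hcon
  have key : ∀ x ∈ closure Ω, ∀ φ : 𝔼[n] → ℝ,
      IsMinOn (fun z => lscEnvelope (closure Ω) v z - φ z) (closure Ω) x →
      ∀ z ∈ closure Ω, v x - φ x ≤ v z - φ z := fun x hx φ hmin z hz => by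
    have := hmin hz
    simpa only [mem_ofPred_eq, lscEnvelope_eq hc hz, lscEnvelope_eq hc hx] using this
  refine hv ⟨hb, fun x hx φ hφ hmin => ?_, fun x hx φ hφ hmin => ?_⟩
  · by_contra! hlt
    exact h.notMem (hcon x (subset_closure hx) φ hφ (key x (subset_closure hx) φ hmin) hlt).1 hx
  · by_contra! hlt
    have hx' := frontier_mem_closure hx
    exact absurd (hcon x hx' φ hφ (key x hx' φ hmin) hlt.1).2 (not_le.2 hlt.2)

/-- The bump construction of Perron's method. Since `d(·, y)` is a subsolution, it fails to be a
supersolution, and it can be raised strictly near a point `x₁` of failure. If `x₁ ≠ y`, the raised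
function keeps its value at `y` and exceeds `d(x₁, y)` at `x₁`, against the definition of `d`. So
`x₁ = y`, and the raised function is strict near `y`. -/
theorem Admissible.exists_strict_of_notMem (h : Admissible Ω H γ g)
    (hu : UpperSemicontinuousOn u (closure Ω)) (hu' : IsSubsolution Ω H γ g a u)
    (hy : y ∈ closure Ω) (hyA : y ∉ aubryMatherSet Ω H γ g a) :
    ∃ ψ : 𝔼[n] → ℝ, (∀ x ∈ closure Ω, HasSlopesAt Ω H γ a (g x) x ψ) ∧
      ∃ δ > 0, ∃ r > 0, ∀ x ∈ closure Ω ∩ ball y r,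
        HasSlopesAt Ω H γ (a - δ) (g x - δ) x ψ := by
  set D : 𝔼[n] → ℝ := fun x => semiDist Ω H γ g a x y with hDdef
  have hD : ∀ x ∈ closure Ω, HasSlopesAt Ω H γ a (g x) x D := fun x hx =>
    h.hasSlopesAt_semiDist hu hu' hy hx
  obtain ⟨hDc, hDs⟩ := h.isSubsolution_of_hasSlopesAt hD
  have hDy : D y = 0 := h.semiDist_self hu hu' hy
  obtain ⟨x₁, hx₁, φ, hφ, hmin, hH, hγ⟩ := h.exists_strict_test
    (h.isCompact.bddBelow_image hDc) hDc fun hsup => hyA ⟨hy, hDs, hsup⟩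
  have hquad := contDiff_quadratic (ContinuousLinearMap.id ℝ 𝔼[n]) 0 x₁ (-1)
  set χ : 𝔼[n] → ℝ := fun z => φ z +
    (inner ℝ (0 : 𝔼[n]) (z - x₁) + -1 * ‖ContinuousLinearMap.id ℝ 𝔼[n] (z - x₁)‖ ^ 2) with hχdef
  have hχ : ContDiff ℝ 1 χ := hφ.add hquad
  have hχg : ∀ z, HasGradientAt χ (gradient χ z) z := fun z =>
    ((hχ.differentiable (by simp)) z).hasGradientAt
  have hχx : gradient χ x₁ = gradient φ x₁ := by
    refine HasGradientAt.gradient ?_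
    have e1 := ((hφ.differentiable (by simp)) x₁).hasGradientAt
    have e2 := hasGradientAt_quadratic (ContinuousLinearMap.id ℝ 𝔼[n]) 0 x₁ x₁ (-1)
    rw [hasGradientAt_iff_hasFDerivAt] at e1 e2 ⊢
    convert! e1.add e2 using 1
    simp
  have hχv : ∀ z, χ z = φ z - ‖z - x₁‖ ^ 2 := fun z => by
    simp only [hχdef, inner_zero_left, ContinuousLinearMap.id_apply]
    ring
  have hGc : Continuous (gradient χ) :=
    (InnerProductSpace.toDual ℝ 𝔼[n]).symm.continuous.comp (hχ.continuous_fderiv (by simp))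
  obtain ⟨δ, hδ, r₁, hr₁, hstrict⟩ := h.strict_near hGc (by rwa [hχx]) (by rwa [hχx])
  obtain ⟨r, hr, hrr₁, hry⟩ : ∃ r > 0, r ≤ r₁ ∧ (x₁ ≠ y → r ≤ ‖y - x₁‖) := by
    by_cases hxy : x₁ = y
    · exact ⟨r₁, hr₁, le_rfl, fun hne => absurd hxy hne⟩
    · have : 0 < ‖y - x₁‖ := norm_pos_iff.2 (sub_ne_zero.2 (Ne.symm hxy))
      exact ⟨min r₁ ‖y - x₁‖, lt_min hr₁ this, min_le_left _ _, fun _ => min_le_right _ _⟩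
  -- The lift `r² / 4` equals the drop of `-‖z - x₁‖²` at distance `r / 2`, so the bump is invisible
  -- from there on.
  set k : ℝ := D x₁ - φ x₁ + r ^ 2 / 4 with hk
  have hstr : ∀ x ∈ closure Ω ∩ ball x₁ r₁,
      HasSlopesAt Ω H γ (a - δ) (g x - δ) x fun z => χ z + k := fun x hx =>
    (hasSlopesAt_of_contDiffAt h hx.1 hχ.contDiffAt (hχg x) (hstrict x hx).1
      (hstrict x hx).2).add_const k
  have hfar : ∀ z ∈ closure Ω, r / 2 ≤ ‖z - x₁‖ → max (D z) (χ z + k) = D z := fun z hz hzr => by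
    have e1 : (r / 2) ^ 2 ≤ ‖z - x₁‖ ^ 2 := by gcongr
    have e2 := hmin z hz
    refine max_eq_left ?_
    rw [hχv, hk]
    linarith
  set ψ : 𝔼[n] → ℝ := fun z => max (D z) (χ z + k) with hψdef
  have hψ : ∀ x ∈ closure Ω, HasSlopesAt Ω H γ a (g x) x ψ := fun x hx => by
    rcases lt_or_ge ‖x - x₁‖ r with hlt | hge
    · exact (hD x hx).max ((hstr x ⟨hx, by rw [mem_ball, dist_eq_norm]; linarith⟩).mono
        (by linarith) (by linarith))
    · refine (hD x hx).congr ?_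
      have hc : Continuous fun z => ‖z - x₁‖ := by fun_prop
      filter_upwards [(hc.tendsto x).eventually (lt_mem_nhds (by linarith : r / 2 < ‖x - x₁‖))]
        with z hz hzΩ
      exact hfar z hzΩ hz.le
  obtain ⟨hψc, hψs⟩ := h.isSubsolution_of_hasSlopesAt hψ
  have hχk : χ x₁ + k = D x₁ + r ^ 2 / 4 := by
    rw [hχv, sub_self, norm_zero, hk]
    ring
  by_cases hxy : x₁ = y
  · subst hxy
    have hev : ∀ᶠ z in 𝓝 x₁, z ∈ closure Ω → ψ z = χ z + k := by
      have hc : ContinuousOn (fun z => χ z + k - D z) (closure Ω) :=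
        (hχ.continuous.continuousOn.add continuousOn_const).sub hDc
      have := (hc x₁ hx₁).eventually (lt_mem_nhds
        (by rw [hχk, add_sub_cancel_left]; positivity : 0 < χ x₁ + k - D x₁))
      filter_upwards [eventually_nhdsWithin_iff.1 this] with z hz hzΩ
      exact max_eq_right (by linarith [hz hzΩ])
    obtain ⟨r₂, hr₂, hball⟩ := Metric.eventually_nhds_iff_ball.1 (eventually_eventually_nhds.2 hev)
    refine ⟨ψ, hψ, δ, hδ, min r₁ r₂, lt_min hr₁ hr₂, fun x hx => ?_⟩
    exact (hstr x ⟨hx.1, ball_subset_ball (min_le_left _ _) hx.2⟩).congr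
      (hball x (ball_subset_ball (min_le_right _ _) hx.2))
  · exfalso
    have e1 := h.sub_le_semiDist hψc.upperSemicontinuousOn hψs hx₁ hy
    have e2 : ψ y = D y := hfar y hy (by linarith [hry hxy])
    have e3 : D x₁ + r ^ 2 / 4 ≤ ψ x₁ := hχk ▸ le_max_right _ _
    have e4 : 0 < r ^ 2 / 4 := by positivity
    have e5 : semiDist Ω H γ g a x₁ y = D x₁ := rfl
    linarith

/-- If `ψ` is strict near `y` and some nearby `z` were in the set, then `ψ - d(·, z)` would be
maximal at `z` by the definition of `d`, while `d(·, z)` is a supersolution: `HasSlopesAt.not_isMax`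
forbids it. -/
theorem Admissible.isCompact_aubryMatherSet (h : Admissible Ω H γ g)
    (hu : UpperSemicontinuousOn u (closure Ω)) (hu' : IsSubsolution Ω H γ g a u) :
    IsCompact (aubryMatherSet Ω H γ g a) := by
  refine h.isCompact.of_isClosed_subset ?_ fun y hy => hy.1
  refine isOpen_compl_iff.1 (isOpen_iff_mem_nhds.2 fun y hyA => ?_)
  by_cases hy : y ∈ closure Ω
  · obtain ⟨ψ, hψ, δ, hδ, r, hr, hstrict⟩ := h.exists_strict_of_notMem hu hu' hy hyA
    obtain ⟨hψc, hψs⟩ := h.isSubsolution_of_hasSlopesAt hψ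
    filter_upwards [ball_mem_nhds y hr] with z hz hzA
    have hcont := (h.isSubsolution_of_hasSlopesAt fun x hx =>
      h.hasSlopesAt_semiDist hu hu' hzA.1 hx).1
    refine (hstrict z ⟨hzA.1, hz⟩).not_isMax h hzA.1 hδ hzA.2.2 hcont fun x hx => ?_
    rw [h.semiDist_self hu hu' hzA.1]
    linarith [h.sub_le_semiDist hψc.upperSemicontinuousOn hψs hx hzA.1]
  · filter_upwards [isClosed_closure.isOpen_compl.mem_nhds hy] with z hz hzA
    exact hz hzA.1

/-! ### The representation formula -/

/-- Comparison of a subsolution and a supersolution ordered on the Aubry–Mather set. -/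
theorem Admissible.le_of_le_on_aubryMatherSet (h : Admissible Ω H γ g)
    (hw : ∀ x ∈ closure Ω, HasSlopesAt Ω H γ a (g x) x w) (hu : IsSupersolution Ω H γ g a u)
    (huc : ContinuousOn u (closure Ω)) (hle : ∀ y ∈ aubryMatherSet Ω H γ g a, w y ≤ u y) :
    ∀ x ∈ closure Ω, w x ≤ u x := by
  obtain ⟨hwc, hws⟩ := h.isSubsolution_of_hasSlopesAt hw
  obtain ⟨x₀, hx₀, hmax⟩ := h.isCompact.exists_isMaxOn h.isConnected.nonempty.closure
    (hwc.sub huc)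
  suffices hμ : w x₀ - u x₀ ≤ 0 from fun x hx => by
    have : w x - u x ≤ w x₀ - u x₀ := hmax hx
    linarith
  by_contra! hμ
  set μ := w x₀ - u x₀ with hμdef
  -- `K` misses the Aubry–Mather set and contains the maximum points of `w - u`, with enough margin
  -- to contain those of small perturbations.
  set K : Set 𝔼[n] := closure Ω ∩ (fun x => w x - u x) ⁻¹' Ici (μ / 2) with hKdef
  have hK : IsCompact K := h.isCompact.of_isClosed_subset
    ((hwc.sub huc).preimage_isClosed_of_isClosed isClosed_closure isClosed_Ici) inter_subset_left
  obtain ⟨ψ, hψ, δ, hδ, hstrict⟩ : ∃ ψ : 𝔼[n] → ℝ,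
      (∀ x ∈ closure Ω, HasSlopesAt Ω H γ a (g x) x ψ) ∧
      ∃ δ > 0, ∀ x ∈ closure Ω ∩ K, HasSlopesAt Ω H γ (a - δ) (g x - δ) x ψ := by
    -- Averaging two subsolutions keeps the strictness of each on its own piece, with half the
    -- margin.
    refine hK.induction_on (p := fun S => ∃ ψ : 𝔼[n] → ℝ,
      (∀ x ∈ closure Ω, HasSlopesAt Ω H γ a (g x) x ψ) ∧
      ∃ δ > 0, ∀ x ∈ closure Ω ∩ S, HasSlopesAt Ω H γ (a - δ) (g x - δ) x ψ) ?_ ?_ ?_ ?_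
    · exact ⟨w, hw, 1, one_pos, fun x hx => absurd hx.2 (notMem_empty x)⟩
    · rintro S T hST ⟨ψ, hψ, δ, hδ, hs⟩
      exact ⟨ψ, hψ, δ, hδ, fun x hx => hs x ⟨hx.1, hST hx.2⟩⟩
    · rintro S T ⟨ψ, hψ, δ, hδ, hs⟩ ⟨ψ', hψ', δ', hδ', hs'⟩
      have hm := min_le_left δ δ'
      have hm' := min_le_right δ δ'
      refine ⟨fun z => (1 - 1 / 2) * ψ z + 1 / 2 * ψ' z, fun x hx =>
        ((hψ x hx).convexComb h hx (hψ' x hx) (by norm_num) (by norm_num)).mono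
          (by linarith) (by linarith), min δ δ' / 2, by positivity, fun x hx => ?_⟩
      rcases hx.2 with hxS | hxT
      · exact ((hs x ⟨hx.1, hxS⟩).convexComb h hx.1 (hψ' x hx.1) (by norm_num)
          (by norm_num)).mono (by linarith) (by linarith)
      · exact ((hψ x hx.1).convexComb h hx.1 (hs' x ⟨hx.1, hxT⟩) (by norm_num)
          (by norm_num)).mono (by linarith) (by linarith)
    · intro x hx
      have hxA : x ∉ aubryMatherSet Ω H γ g a := fun hxA => by
        have e1 : μ / 2 ≤ w x - u x := hx.2
        linarith [hle x hxA]
      obtain ⟨ψ, hψ, δ, hδ, r, hr, hs⟩ :=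
        h.exists_strict_of_notMem hwc.upperSemicontinuousOn hws hx.1 hxA
      exact ⟨ball x r, mem_nhdsWithin_of_mem_nhds (ball_mem_nhds x hr), ψ, hψ, δ, hδ, hs⟩
  have hψc := (h.isSubsolution_of_hasSlopesAt hψ).1
  obtain ⟨M, hM⟩ := h.isCompact.exists_bound_of_continuousOn (hψc.sub hwc)
  have hM0 : 0 ≤ M := (norm_nonneg _).trans (hM x₀ hx₀)
  -- With `θ M ≤ μ / 4` the perturbation lowers the difference by at most `μ / 2`, so the new
  -- maximum point stays in `K`, where the mixture is strict.
  obtain ⟨θ, hθ, hθM⟩ := exists_pos_mul_le_of_pos (X := 4 * (M + 1)) (Y := min 1 μ)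
    (by positivity) (lt_min one_pos hμ)
  have hθM0 : 0 ≤ θ * M := by positivity
  have hθ1 : θ ≤ 1 := by linarith [min_le_left 1 μ]
  have hθμ : 4 * (θ * M) ≤ μ := by linarith [min_le_right 1 μ]
  set wθ : 𝔼[n] → ℝ := fun z => (1 - θ) * w z + θ * ψ z with hwθ
  have hbd : ∀ z ∈ closure Ω, |wθ z - w z| ≤ θ * M := fun z hz => by
    have e1 : wθ z - w z = θ * (ψ z - w z) := by simp only [hwθ]; ring
    rw [e1, abs_mul, abs_of_pos hθ]
    exact mul_le_mul_of_nonneg_left (hM z hz) hθ.le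
  have hwθc : ContinuousOn wθ (closure Ω) :=
    (continuousOn_const.mul hwc).add (continuousOn_const.mul hψc)
  obtain ⟨x, hx, hxmax⟩ := h.isCompact.exists_isMaxOn ⟨x₀, hx₀⟩ (hwθc.sub huc)
  have hxK : x ∈ K := by
    refine ⟨hx, ?_⟩
    have e1 : wθ x₀ - u x₀ ≤ wθ x - u x := hxmax hx₀
    have e2 := abs_le.1 (hbd x hx)
    have e3 := abs_le.1 (hbd x₀ hx₀)
    show μ / 2 ≤ w x - u x
    linarith [e2.2, e3.1]
  exact ((hw x hx).convexComb h hx (hstrict x ⟨hx, hxK⟩) hθ.le hθ1 |>.mono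
    (a' := a - θ * δ) (b' := g x - θ * δ) (by linarith) (by linarith)).not_isMax h hx
      (by positivity) hu huc fun z hz => hxmax hz

/-- With nothing to check on an empty set, comparison would give `u + 1 ≤ u`. -/
theorem Admissible.aubryMatherSet_nonempty (h : Admissible Ω H γ g) (hu : IsSolution Ω H γ g a u)
    (huc : ContinuousOn u (closure Ω)) : (aubryMatherSet Ω H γ g a).Nonempty := by
  by_contra hne
  obtain ⟨x, hx⟩ := h.isConnected.nonempty.closure
  have := h.le_of_le_on_aubryMatherSet (w := fun z => u z + 1) (fun x hx =>
    (hu.1.hasSlopesAt h huc.upperSemicontinuousOn hx).add_const 1) hu.2 huc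
    (fun y hy => absurd ⟨y, hy⟩ hne) x hx
  linarith

theorem Admissible.isLeast_image_aubryMatherSet (h : Admissible Ω H γ g)
    (hu : IsSolution Ω H γ g a u) (huc : ContinuousOn u (closure Ω)) (hx : x ∈ closure Ω) :
    IsLeast ((fun y => u y + semiDist Ω H γ g a x y) '' aubryMatherSet Ω H γ g a) (u x) := by
  have husc := huc.upperSemicontinuousOn
  have hmin : ∀ z ∈ closure Ω, ∃ y ∈ aubryMatherSet Ω H γ g a,
      ∀ y' ∈ aubryMatherSet Ω H γ g a,
        u y + semiDist Ω H γ g a z y ≤ u y' + semiDist Ω H γ g a z y' := fun z hz =>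
    (h.isCompact_aubryMatherSet husc hu.1).exists_isMinOn (h.aubryMatherSet_nonempty hu huc)
      ((huc.add (h.continuousOn_semiDist_right husc hu.1 hz)).mono fun y hy => hy.1)
  -- Using the minimizer of `z'` as a competitor at `z`, the triangle inequality bounds the
  -- increments of the minimum by `d(z, z')`.
  choose! Y hYA hY using hmin
  have hw := h.le_of_le_on_aubryMatherSet
    (w := fun z => u (Y z) + semiDist Ω H γ g a z (Y z)) (fun z hz =>
      h.hasSlopesAt_of_sub_le_semiDist husc hu.1 (fun z hz z' hz' => by
        have e1 := hY z hz (Y z') (hYA z' hz')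
        have e2 := h.semiDist_triangle husc hu.1 hz hz' (hYA z' hz').1
        linarith) hz) hu.2 huc (fun y hy => by
      have e1 := hY y hy.1 y hy
      rwa [h.semiDist_self husc hu.1 hy.1, add_zero] at e1) x hx
  have hlow : ∀ y ∈ aubryMatherSet Ω H γ g a, u x ≤ u y + semiDist Ω H γ g a x y := fun y hy => by
    linarith [h.sub_le_semiDist husc hu.1 hx hy.1]
  refine ⟨⟨Y x, hYA x hx, le_antisymm hw (hlow _ (hYA x hx))⟩, ?_⟩
  rintro _ ⟨y, hy, rfl⟩
  exact hlow y hy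

end

end NeumannHJ

end

/-! ### The theorem. -/

open NeumannHJ in
theorem theorem6p6 {n : ℕ}
    (Ω : Set (EuclideanSpace ℝ (Fin n)))
    (hΩ_open : IsOpen Ω) (hΩ_conn : IsConnected Ω) (hΩ_bdd : Bornology.IsBounded Ω)
    (hΩ_C1 : HasC1Boundary Ω)
    (H : EuclideanSpace ℝ (Fin n) → EuclideanSpace ℝ (Fin n) → ℝ)
    (hH_cont : ContinuousOn (Function.uncurry H) (closure Ω ×ˢ Set.univ))
    (hH_convex : ∀ x ∈ closure Ω, ConvexOn ℝ Set.univ (H x))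
    (hH_coercive : ∀ x ∈ closure Ω,
      Filter.Tendsto (H x) (Bornology.cobounded (EuclideanSpace ℝ (Fin n))) Filter.atTop)
    (γ : EuclideanSpace ℝ (Fin n) → EuclideanSpace ℝ (Fin n))
    (hγ_cont : ContinuousOn γ (frontier Ω)) (hγ_oblique : IsOblique Ω γ)
    (g : EuclideanSpace ℝ (Fin n) → ℝ) (hg_cont : ContinuousOn g (frontier Ω))
    (c : ℝ) (hc : c = criticalValue Ω H γ g)
    (u : EuclideanSpace ℝ (Fin n) → ℝ) (hu_cont : ContinuousOn u (closure Ω))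
    (hu : IsSolution Ω H γ g c u) :
    -- the supremum defining `d(x, y)` is finite
    (∀ x ∈ closure Ω, ∀ y ∈ closure Ω,
      IsLUB (subsolutionDifferences Ω H γ g c x y) (semiDist Ω H γ g c x y)) ∧
    -- `u(x) = min {u(y) + d(x, y) : y ∈ 𝒜}`
    (∀ x ∈ closure Ω,
      IsLeast ((fun y => u y + semiDist Ω H γ g c x y) '' aubryMatherSet Ω H γ g c) (u x)) ∧
    -- a solution is determined by its values on the Aubry–Mather set
    (∀ w : EuclideanSpace ℝ (Fin n) → ℝ, ContinuousOn w (closure Ω) →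
      IsSolution Ω H γ g c w → Set.EqOn w u (aubryMatherSet Ω H γ g c) →
      Set.EqOn w u (closure Ω)) := by
  have h : Admissible Ω H γ g := ⟨hΩ_open, hΩ_conn, hΩ_bdd, hΩ_C1, hH_cont, hH_convex, hH_coercive,
    hγ_cont, hγ_oblique, hg_cont⟩
  refine ⟨fun x hx y hy => isLUB_csSup ⟨_, u, hu_cont.upperSemicontinuousOn, hu.1, rfl⟩
    (h.bddAbove_subsolutionDifferences c hx hy),
    fun x hx => h.isLeast_image_aubryMatherSet hu hu_cont hx, fun w hw_cont hw hwu x hx => ?_⟩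
  -- The formula involves a solution only through its values on the Aubry–Mather set, so `w x` and
  -- `u x` are least elements of the same set.
  have e : (fun y => w y + semiDist Ω H γ g c x y) '' aubryMatherSet Ω H γ g c =
      (fun y => u y + semiDist Ω H γ g c x y) '' aubryMatherSet Ω H γ g c :=
    Set.image_congr fun y hy => by rw [hwu hy]
  exact (e ▸ h.isLeast_image_aubryMatherSet hw hw_cont hx).unique
    (h.isLeast_image_aubryMatherSet hu hu_cont hx)
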